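/- Let $p$ be a prime, $n\ge 1$ an integer, and $R$ an $\mathbb F_p$-algebra. Let $W_n(R)$ be the ring of $p$-typical Witt vectors of length $n$, with Frobenius $F$ and Verschiebung $V$; put $I_{n,R}=\ker(W_n(R)\to R)$ and $J_{n,R}=\ker(W_n(R)\to W_{n-1}(R))$. A weak $n$-truncated semidisplay over $R$ is a quadruple $\mathscr P=(M,Q,F,F_1)$, where $M$ is a $W_n(R)$-module, $Q\subset M$ is a submodule, and $F:M\to M$ and $F_1:Q\to M/J_{n,R}M$ are Frobenius-semilinear maps, such that (i) $F_1(V(a)x)=a\cdot\overline{F(x)}$ for $a\in W_n(R)$, $x\in M$, where $\overline{F(x)}$ is the image of $F(x)$ in $M/J_{n,R}M$; (ii) $F(y)=pF_1(y)$ for $y\in Q$ (this makes sense because $pJ_{n,R}=0$); (iii) $(M,Q)\cong (T,I_{n,R}T)\oplus(L,L)$ for some finitely generated projective $W_n(R)$-module $T$ and some finitely generated projective $W_{n-1}(R)$-module $L$. Let $\mathfrak D_{n,R}$ be the $n$-truncated Dieudonné–Cartier ring, that is, the ring generated by the ring $W_n(R)$ and elements $F,V$ with the defining relations $V^n=0$,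 $FV=p$, $F\cdot a=F(a)\cdot F$, $a\cdot V=V\cdot F(a)$, $V\cdot a\cdot F=V(a)$ for $a\in W_n(R)$. A left $\mathfrak D_{n,R}$-module $N$ is called $n$-cosmooth if $N/VN$ is a finitely generated projective $R$-module and $\ker(V^i:N\to N)=\operatorname{im}(V^{n-i}:N\to N)$ for $0\le i\le n$. Let $D(\mathscr P)$ be the left $\mathfrak D_{n,R}$-module with the following universal property: for every left $\mathfrak D_{n,R}$-module $N$, the group $\operatorname{Hom}_{\mathfrak D_{n,R}}(D(\mathscr P),N)$ is the group of $W_n(R)$-linear maps $f:M\to N$ such that $f(F(x))=F f(x)$ for $x\in M$ and $V f(F_1(y))=f(y)$ for $y\in Q$ (the left-hand side makes sense because $V J_{n,R}=0$ in $\mathfrak D_{n,R}$). Let $\underline{\operatorname{Hom}}(\mathscr P,\mathbf 1_{n,R})$ be the commutative group scheme over $R$ whose points over an $R$-algebra $S$ are the $W_n(R)$-linear maps $\eta:M\to W_n(S)$ such that $\eta(F(x))=F(\eta(x))$ for $x\in M$ and $\eta(y)=V(\eta(F_1(y)))$ for $y\in Q$. Let $\mathfrak Z_{\mathscr P}$ be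 its Cartier dual. Proposition. The $\mathfrak D_{n,R}$-module $D(\mathscr P)$ is $n$-cosmooth. Moreover, it is the module attached to $\mathfrak Z_{\mathscr P}$ by $n$-truncated Cartier theory: there is an isomorphism of $\mathfrak D_{n,R}$-modules $$e: D(\mathscr P)\to \operatorname{Hom}(\mathfrak Z_{\mathscr P}^*,W_{n,R}),$$ where $\mathfrak Z_{\mathscr P}^*$ is the Cartier dual of $\mathfrak Z_{\mathscr P}$, the right-hand side is the group of homomorphisms of group schemes over $R$, and $\mathfrak D_{n,R}$ acts on it through its action on the group scheme $W_{n,R}$. It is the canonical one: if $x\in M$ and $\bar x$ is its image in $D(\mathscr P)$, then $e(\bar x)$ takes the point of $\mathfrak Z_{\mathscr P}^*$ given by $\eta\in\underline{\operatorname{Hom}}(\mathscr P,\mathbf 1_{n,R})(S)$ under the biduality map to $\eta(x)\in W_n(S)$. -/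

import Mathlib

universe u v w

namespace Semidisplay

/-! ### Truncated Witt vectors: functoriality, Frobenius, Verschiebung -/

section Witt

variable (p : ℕ) [Fact p.Prime] (n : ℕ)

/-- The ring homomorphism `W_n(R) → W_n(S)` induced by `f : R → S` (coefficientwise). -/
def wittMap {R S : Type*} [CommRing R] [CommRing S] (f : R →+* S) :
    TruncatedWittVector p n R →+* TruncatedWittVector p n S :=
  have key : ∀ X : WittVector p R,
      TruncatedWittVector.mk p (fun i => f ((WittVector.truncate n X).coeff i)) =
        WittVector.truncate n (WittVector.map f X) := by
    intro X
    ext i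
    simp
  { toFun := fun x => TruncatedWittVector.mk p fun i => f (x.coeff i)
    map_one' := by
      rw [← map_one (WittVector.truncate (p := p) (R := R) n), key, map_one, map_one]
    map_zero' := by
      rw [← map_zero (WittVector.truncate (p := p) (R := R) n), key, map_zero, map_zero]
    map_mul' := by
      intro x y
      obtain ⟨X, rfl⟩ := WittVector.truncate_surjective p n R x
      obtain ⟨Y, rfl⟩ := WittVector.truncate_surjective p n R y
      rw [← map_mul, key, key, key, map_mul, map_mul]
    map_add' := by
      intro x y
      obtain ⟨X, rfl⟩ := WittVector.truncate_surjective p n R x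
      obtain ⟨Y, rfl⟩ := WittVector.truncate_surjective p n R y
      rw [← map_add, key, key, key, map_add, map_add] }

theorem coeff_wittMap {R S : Type*} [CommRing R] [CommRing S] (f : R →+* S)
    (x : TruncatedWittVector p n R) (i : Fin n) : (wittMap p n f x).coeff i = f (x.coeff i) :=
  TruncatedWittVector.coeff_mk _ i

/-- The Frobenius `(x₀, x₁, …) ↦ (x₀ ^ p, x₁ ^ p, …)` of `W_n(R)`, as a function
(meaningful if `p = 0` in `R`). -/
def frob {R : Type*} [CommRing R] (x : TruncatedWittVector p n R) : TruncatedWittVector p n R :=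
  TruncatedWittVector.mk p fun i => x.coeff i ^ p

/-- The Verschiebung `(x₀, x₁, …) ↦ (0, x₀, x₁, …)` of `W_n(R)`, as a function. -/
noncomputable def vers {R : Type*} [CommRing R] (x : TruncatedWittVector p n R) :
    TruncatedWittVector p n R :=
  WittVector.truncate n (WittVector.verschiebung x.out)

variable {R : Type*} [CommRing R]

theorem frob_truncate (h : (p : R) = 0) (X : WittVector p R) :
    frob p n (WittVector.truncate n X) = WittVector.truncate n (WittVector.frobenius X) := by
  ext i
  rw [frob, TruncatedWittVector.coeff_mk, WittVector.coeff_truncate, WittVector.coeff_truncate,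
    WittVector.coeff_frobenius, WittVector.frobeniusPoly]
  simp [h]

theorem vers_truncate (X : WittVector p R) :
    vers p n (WittVector.truncate n X) = WittVector.truncate n (WittVector.verschiebung X) := by
  ext i
  rw [vers, WittVector.coeff_truncate, WittVector.coeff_truncate]
  obtain ⟨i, hi⟩ := i
  cases i with
  | zero => simp
  | succ i =>
    have hi' : i < n := Nat.lt_of_succ_lt hi
    have h1 := TruncatedWittVector.coeff_out (WittVector.truncate n X) ⟨i, hi'⟩
    rw [WittVector.coeff_truncate] at h1
    simpa [WittVector.verschiebung_coeff_succ] using h1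

/-- The Frobenius endomorphism `F` of the ring `W_n(R)`, where `p = 0` in `R`. -/
def frobHom (h : (p : R) = 0) : TruncatedWittVector p n R →+* TruncatedWittVector p n R where
  toFun x := frob p n x
  map_one' := by
    rw [← map_one (WittVector.truncate (p := p) (R := R) n), frob_truncate p n h, map_one]
  map_zero' := by
    rw [← map_zero (WittVector.truncate (p := p) (R := R) n), frob_truncate p n h, map_zero]
  map_mul' := by
    intro x y
    obtain ⟨X, rfl⟩ := WittVector.truncate_surjective p n R x
    obtain ⟨Y, rfl⟩ := WittVector.truncate_surjective p n R y
    simp only [← map_mul, frob_truncate p n h]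
  map_add' := by
    intro x y
    obtain ⟨X, rfl⟩ := WittVector.truncate_surjective p n R x
    obtain ⟨Y, rfl⟩ := WittVector.truncate_surjective p n R y
    simp only [← map_add, frob_truncate p n h]

/-- The additive endomorphism `V` of `W_n(R)`. -/
noncomputable def versHom : TruncatedWittVector p n R →+ TruncatedWittVector p n R where
  toFun x := vers p n x
  map_zero' := by
    rw [← map_zero (WittVector.truncate (p := p) (R := R) n), vers_truncate, map_zero]
  map_add' := by
    intro x y
    obtain ⟨X, rfl⟩ := WittVector.truncate_surjective p n R x
    obtain ⟨Y, rfl⟩ := WittVector.truncate_surjective p n R y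
    simp only [← map_add, vers_truncate]

theorem frob_vers (h : (p : R) = 0) (x : TruncatedWittVector p n R) :
    frob p n (vers p n x) = p * x := by
  obtain ⟨X, rfl⟩ := WittVector.truncate_surjective p n R x
  rw [vers_truncate, frob_truncate p n h, WittVector.frobenius_verschiebung, map_mul, map_natCast,
    mul_comm]

theorem vers_mul_frob (h : (p : R) = 0) (x y : TruncatedWittVector p n R) :
    vers p n (x * frob p n y) = vers p n x * y := by
  obtain ⟨X, rfl⟩ := WittVector.truncate_surjective p n R x
  obtain ⟨Y, rfl⟩ := WittVector.truncate_surjective p n R y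
  rw [frob_truncate p n h, ← map_mul, vers_truncate, vers_truncate, ← map_mul,
    WittVector.verschiebung_mul_frobenius]

theorem vers_iterate (x : TruncatedWittVector p n R) : (vers p n)^[n] x = 0 := by
  obtain ⟨X, rfl⟩ := WittVector.truncate_surjective p n R x
  have h : ∀ k : ℕ, (vers p n)^[k] (WittVector.truncate n X) =
      WittVector.truncate n (WittVector.verschiebung^[k] X) := by
    intro k
    induction k with
    | zero => rfl
    | succ k ih => rw [Function.iterate_succ_apply', ih, vers_truncate,
        Function.iterate_succ_apply']
  rw [h]
  ext i
  rw [WittVector.coeff_truncate, TruncatedWittVector.coeff_zero]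
  exact WittVector.iterate_verschiebung_coeff_eq_zero X i.2

theorem wittMap_frob {S : Type*} [CommRing S] (f : R →+* S) (x : TruncatedWittVector p n R) :
    wittMap p n f (frob p n x) = frob p n (wittMap p n f x) := by
  ext i
  rw [coeff_wittMap, frob, frob, TruncatedWittVector.coeff_mk, TruncatedWittVector.coeff_mk,
    coeff_wittMap, map_pow]

theorem wittMap_truncate {S : Type*} [CommRing S] (f : R →+* S) (X : WittVector p R) :
    wittMap p n f (WittVector.truncate n X) = WittVector.truncate n (WittVector.map f X) := by
  ext i
  rw [coeff_wittMap, WittVector.coeff_truncate, WittVector.coeff_truncate, WittVector.map_coeff]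

theorem wittMap_vers {S : Type*} [CommRing S] (f : R →+* S) (x : TruncatedWittVector p n R) :
    wittMap p n f (vers p n x) = vers p n (wittMap p n f x) := by
  obtain ⟨X, rfl⟩ := WittVector.truncate_surjective p n R x
  rw [vers_truncate, wittMap_truncate, wittMap_truncate, vers_truncate,
    WittVector.map_verschiebung]

theorem wittMap_comp {S T : Type*} [CommRing S] [CommRing T] (f : R →+* S) (g : S →+* T)
    (x : TruncatedWittVector p n R) :
    wittMap p n (g.comp f) x = wittMap p n g (wittMap p n f x) := by
  ext i
  simp only [coeff_wittMap, RingHom.comp_apply]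

theorem wittMap_id (x : TruncatedWittVector p n R) : wittMap p n (RingHom.id R) x = x := by
  ext i
  simp only [coeff_wittMap, RingHom.id_apply]

variable (R)

/-- The projection `W_n(R) → W_1(R) = R` (for `n ≥ 1`). -/
def proj [NeZero n] : TruncatedWittVector p n R →+* R :=
  have key : ∀ X : WittVector p R,
      (WittVector.truncate n X).coeff 0 = WittVector.constantCoeff X := fun X => by
    rw [WittVector.coeff_truncate]; rfl
  { toFun := fun x => x.coeff 0
    map_one' := by
      rw [← map_one (WittVector.truncate (p := p) (R := R) n), key, map_one]
    map_zero' := by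
      rw [← map_zero (WittVector.truncate (p := p) (R := R) n), key, map_zero]
    map_mul' := by
      intro x y
      obtain ⟨X, rfl⟩ := WittVector.truncate_surjective p n R x
      obtain ⟨Y, rfl⟩ := WittVector.truncate_surjective p n R y
      rw [← map_mul, key, key, key, map_mul]
    map_add' := by
      intro x y
      obtain ⟨X, rfl⟩ := WittVector.truncate_surjective p n R x
      obtain ⟨Y, rfl⟩ := WittVector.truncate_surjective p n R y
      rw [← map_add, key, key, key, map_add] }

theorem proj_surjective [NeZero n] : Function.Surjective (proj p n R) := fun r =>
  ⟨TruncatedWittVector.mk p fun _ => r, by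
    exact TruncatedWittVector.coeff_mk (p := p) (fun _ => r) (0 : Fin n)⟩

/-- `I_{n,R} = ker (W_n(R) → W_1(R))`. -/
noncomputable def idealI [NeZero n] : Ideal (TruncatedWittVector p n R) := RingHom.ker (proj p n R)

/-- `J_{n,R} = ker (W_n(R) → W_{n-1}(R))`. -/
noncomputable def idealJ : Ideal (TruncatedWittVector p n R) :=
  RingHom.ker (TruncatedWittVector.truncate (p := p) (R := R) (Nat.sub_le n 1))

theorem exists_vers_of_proj_eq_zero [NeZero n] (x : TruncatedWittVector p n R)
    (hx : proj p n R x = 0) : ∃ y, x = vers p n y := by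
  obtain ⟨X, rfl⟩ := WittVector.truncate_surjective p n R x
  have h0 : X.coeff 0 = 0 := by
    have h1 : (WittVector.truncate n X).coeff 0 = 0 := hx
    rwa [WittVector.coeff_truncate] at h1
  refine ⟨WittVector.truncate n (WittVector.mk p fun i => X.coeff (i + 1)), ?_⟩
  rw [vers_truncate]
  congr 1
  ext i
  cases i with
  | zero => rw [h0, WittVector.verschiebung_coeff_zero]
  | succ i => rw [WittVector.verschiebung_coeff_succ]; rfl

/-- In an `𝔽_p`-algebra `p = 0`. -/
theorem natCast_eq_zero [Algebra (ZMod p) R] : (p : R) = 0 := by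
  rw [← map_natCast (algebraMap (ZMod p) R), CharP.cast_eq_zero, map_zero]

end Witt

/-! ### The truncated Dieudonné–Cartier ring -/

section DieudonneRing

variable (p : ℕ) [Fact p.Prime] (n : ℕ) (R : Type u) [CommRing R]

/-- Generators of the ring `𝔇_{n,R}`: the elements of `W_n(R)`, and `F`, `V`. -/
inductive DGen : Type u
  | w (a : TruncatedWittVector p n R) : DGen
  | F : DGen
  | V : DGen

/-- Generators in the free ring. -/
abbrev DGen.ι {p n R} (g : DGen p n R) : FreeAlgebra ℤ (DGen p n R) := FreeAlgebra.ι ℤ g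

/-- The defining relations of `𝔇_{n,R}`; the first three say that `W_n(R)` maps to it by a
ring homomorphism. -/
inductive DRel : FreeAlgebra ℤ (DGen p n R) → FreeAlgebra ℤ (DGen p n R) → Prop
  | one : DRel (DGen.w 1).ι 1
  | add (a b : TruncatedWittVector p n R) : DRel (DGen.w (a + b)).ι ((DGen.w a).ι + (DGen.w b).ι)
  | mul (a b : TruncatedWittVector p n R) : DRel (DGen.w (a * b)).ι ((DGen.w a).ι * (DGen.w b).ι)
  | V_pow : DRel (DGen.V.ι ^ n) 0
  | F_V : DRel (DGen.F.ι * DGen.V.ι) (p : FreeAlgebra ℤ (DGen p n R))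
  | F_w (a : TruncatedWittVector p n R) :
      DRel (DGen.F.ι * (DGen.w a).ι) ((DGen.w (frob p n a)).ι * DGen.F.ι)
  | w_V (a : TruncatedWittVector p n R) :
      DRel ((DGen.w a).ι * DGen.V.ι) (DGen.V.ι * (DGen.w (frob p n a)).ι)
  | V_w_F (a : TruncatedWittVector p n R) :
      DRel (DGen.V.ι * (DGen.w a).ι * DGen.F.ι) (DGen.w (vers p n a)).ι

/-- The `n`-truncated Dieudonné–Cartier ring `𝔇_{n,R}`. -/
def DRing : Type u := RingQuot (DRel p n R)

noncomputable instance : Ring (DRing p n R) := inferInstanceAs (Ring (RingQuot (DRel p n R)))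

namespace DRing

/-- The canonical map from the free ring. -/
noncomputable def mk : FreeAlgebra ℤ (DGen p n R) →+* DRing p n R := RingQuot.mkRingHom (DRel p n R)

variable {p n R} in
theorem mk_rel {x y : FreeAlgebra ℤ (DGen p n R)} (h : DRel p n R x y) :
    mk p n R x = mk p n R y := RingQuot.mkRingHom_rel h

/-- The element `F` of `𝔇_{n,R}`. -/
noncomputable def F : DRing p n R := mk p n R DGen.F.ι

/-- The element `V` of `𝔇_{n,R}`. -/
noncomputable def V : DRing p n R := mk p n R DGen.V.ι

/-- The ring homomorphism `W_n(R) → 𝔇_{n,R}`. -/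
noncomputable def ofW : TruncatedWittVector p n R →+* DRing p n R where
  toFun a := mk p n R (DGen.w a).ι
  map_one' := by rw [mk_rel DRel.one, map_one]
  map_mul' a b := by rw [mk_rel (DRel.mul a b), map_mul]
  map_add' a b := by rw [mk_rel (DRel.add a b), map_add]
  map_zero' := by
    have h := mk_rel (DRel.add (0 : TruncatedWittVector p n R) 0)
    rw [map_add, add_zero] at h
    exact left_eq_add.mp h

theorem V_pow : V p n R ^ n = 0 := by
  rw [V, ← map_pow, mk_rel DRel.V_pow, map_zero]

theorem F_mul_V : F p n R * V p n R = p := by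
  rw [V, F, ← map_mul, mk_rel DRel.F_V, map_natCast]

theorem F_mul_ofW (a : TruncatedWittVector p n R) :
    F p n R * ofW p n R a = ofW p n R (frob p n a) * F p n R :=
  (map_mul (mk p n R) _ _).symm.trans ((mk_rel (DRel.F_w a)).trans (map_mul (mk p n R) _ _))

theorem ofW_mul_V (a : TruncatedWittVector p n R) :
    ofW p n R a * V p n R = V p n R * ofW p n R (frob p n a) :=
  (map_mul (mk p n R) _ _).symm.trans ((mk_rel (DRel.w_V a)).trans (map_mul (mk p n R) _ _))

theorem V_mul_ofW_mul_F (a : TruncatedWittVector p n R) :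
    V p n R * ofW p n R a * F p n R = ofW p n R (vers p n a) := by
  have h := mk_rel (DRel.V_w_F a)
  rw [map_mul, map_mul] at h
  exact h

/-- The universal property of `𝔇_{n,R}`. -/
noncomputable def lift {A : Type*} [Ring A] (w : TruncatedWittVector p n R →+* A) (f v : A)
    (h1 : v ^ n = 0) (h2 : f * v = p) (h3 : ∀ a, f * w a = w (frob p n a) * f)
    (h4 : ∀ a, w a * v = v * w (frob p n a)) (h5 : ∀ a, v * w a * f = w (vers p n a)) :
    DRing p n R →+* A :=
  RingQuot.lift ⟨(FreeAlgebra.lift ℤ fun g : DGen p n R => match g with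
    | .w a => w a
    | .F => f
    | .V => v : FreeAlgebra ℤ (DGen p n R) →ₐ[ℤ] A).toRingHom, by
      intro x y h
      cases h <;> simp [h1, h2, h3, h4, h5]⟩

end DRing

end DieudonneRing

/-! ### `n`-cosmooth modules -/

section Cosmooth

variable (p : ℕ) [Fact p.Prime] (n : ℕ) (R : Type u) [CommRing R]
  (N : Type v) [AddCommGroup N] [Module (DRing p n R) N]

/-- The subgroup `V N ⊆ N`. -/
noncomputable def rangeV : AddSubgroup N :=
  (Module.toAddMonoidEnd (DRing p n R) N (DRing.V p n R)).range

/-- The quotient `N / V N`. -/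
abbrev ModV : Type v := N ⧸ rangeV p n R N

/-- The action of `W_n(R)` on `N / V N`. -/
noncomputable def modVAction : TruncatedWittVector p n R →+* AddMonoid.End (ModV p n R N) where
  toFun a := QuotientAddGroup.map _ _ (Module.toAddMonoidEnd (DRing p n R) N (DRing.ofW p n R a))
    (by
      rintro _ ⟨x, rfl⟩
      refine ⟨DRing.ofW p n R (frob p n a) • x, ?_⟩
      simp only [Module.toAddMonoidEnd_apply_apply, ← mul_smul, DRing.ofW_mul_V])
  map_one' := DFunLike.ext _ _ fun x => QuotientAddGroup.induction_on x fun x =>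
    congrArg QuotientAddGroup.mk (by rw [map_one, map_one]; rfl)
  map_mul' a b := DFunLike.ext _ _ fun x => QuotientAddGroup.induction_on x fun x =>
    congrArg QuotientAddGroup.mk (by rw [map_mul, map_mul]; rfl)
  map_zero' := DFunLike.ext _ _ fun x => QuotientAddGroup.induction_on x fun x =>
    congrArg QuotientAddGroup.mk (by rw [map_zero, map_zero]; rfl)
  map_add' a b := DFunLike.ext _ _ fun x => QuotientAddGroup.induction_on x fun x =>
    congrArg QuotientAddGroup.mk (by rw [map_add, map_add]; rfl)

/-- The induced action of `R = W_1(R)` on `N / V N`. It exists because `V(a) = V ∘ a ∘ F`. -/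
noncomputable def modVActionR [NeZero n] : R →+* AddMonoid.End (ModV p n R N) :=
  RingHom.liftOfSurjective (proj p n R) (proj_surjective p n R) ⟨modVAction p n R N, by
    intro a ha
    obtain ⟨b, rfl⟩ := exists_vers_of_proj_eq_zero p n R a ha
    refine DFunLike.ext _ _ fun x => ?_
    induction x using QuotientAddGroup.induction_on with
    | H x =>
      refine (QuotientAddGroup.eq_zero_iff _).mpr ⟨DRing.ofW p n R b • DRing.F p n R • x, ?_⟩
      simp only [Module.toAddMonoidEnd_apply_apply, ← mul_smul, ← mul_assoc,
        DRing.V_mul_ofW_mul_F]⟩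

/-- The `R`-module structure on `N / V N`: an element `r` acts as any `a ∈ W_n(R)` with
zeroth component `r`. -/
noncomputable instance [NeZero n] : Module R (ModV p n R N) :=
  Module.compHom _ (modVActionR p n R N)

/-- A `𝔇_{n,R}`-module `N` is `n`-cosmooth if `N / V N` is a finitely generated projective
`R`-module and `ker (V ^ i) = im (V ^ (n - i))` on `N` for `0 ≤ i ≤ n`. -/
def IsCosmooth [NeZero n] : Prop :=
  Module.Finite R (ModV p n R N) ∧ Module.Projective R (ModV p n R N) ∧
    ∀ i ≤ n, ∀ x : N, DRing.V p n R ^ i • x = 0 ↔ ∃ y : N, x = DRing.V p n R ^ (n - i) • y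

end Cosmooth

/-! ### Weak `n`-truncated semidisplays and their Dieudonné modules -/

/-- A weak `n`-truncated semidisplay `(M, Q, F, F₁)` over an `𝔽_p`-algebra `R`. -/
structure WeakSemidisplay (p : ℕ) [Fact p.Prime] (n : ℕ) [NeZero n]
    (R : Type u) [CommRing R] [Algebra (ZMod p) R] where
  /-- the module `M` -/
  M : Type u
  [addCommGroup : AddCommGroup M]
  [module : Module (TruncatedWittVector p n R) M]
  /-- the submodule `Q` -/
  Q : Submodule (TruncatedWittVector p n R) M
  /-- the Frobenius-semilinear map `F : M → M` -/
  F : M →ₛₗ[frobHom p n (natCast_eq_zero p R)] M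
  /-- the Frobenius-semilinear map `F₁ : Q → M / J M` -/
  F₁ : Q →ₛₗ[frobHom p n (natCast_eq_zero p R)]
    M ⧸ (idealJ p n R • (⊤ : Submodule (TruncatedWittVector p n R) M))
  /-- `F₁ (V(a) x) = a F(x)` in `M / J M` -/
  F₁_vers : ∀ (a : TruncatedWittVector p n R) (x : M) (h : vers p n a • x ∈ Q),
    F₁ ⟨vers p n a • x, h⟩ = a • Submodule.Quotient.mk (F x)
  /-- `F = p F₁` on `Q`; here `p : M / J M → M` is well defined since `p J = 0` -/
  F_eq : ∀ (y : Q) (z : M), Submodule.Quotient.mk z = F₁ y → F y = p • z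
  /-- `(M, Q) ≅ (T, I T) ⊕ (L, L)` with `T`, `L` finitely generated projective over `W_n(R)` and
  `W_{n-1}(R)` respectively -/
  exists_decomp : ∃ (T L : Type u) (_ : AddCommGroup T) (_ : AddCommGroup L)
    (_ : Module (TruncatedWittVector p n R) T) (_ : Module (TruncatedWittVector p (n - 1) R) L)
    (e : M ≃+ T × L),
    Module.Finite (TruncatedWittVector p n R) T ∧ Module.Projective (TruncatedWittVector p n R) T ∧
    Module.Finite (TruncatedWittVector p (n - 1) R) L ∧
    Module.Projective (TruncatedWittVector p (n - 1) R) L ∧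
    (∀ (a : TruncatedWittVector p n R) (x : M),
      e (a • x) = (a • (e x).1, TruncatedWittVector.truncate (Nat.sub_le n 1) a • (e x).2)) ∧
    ∀ x : M, x ∈ Q ↔ (e x).1 ∈ idealI p n R • (⊤ : Submodule (TruncatedWittVector p n R) T)

attribute [instance] WeakSemidisplay.addCommGroup WeakSemidisplay.module

namespace WeakSemidisplay

variable {p : ℕ} [Fact p.Prime] {n : ℕ} [NeZero n] {R : Type u} [CommRing R] [Algebra (ZMod p) R]
  (P : WeakSemidisplay p n R)

/-- The relations defining `D(P)` in the free `𝔇_{n,R}`-module with basis `(e_x)`, `x ∈ M`: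
the map `x ↦ e_x` is `W_n(R)[F]`-linear, and `V e_{F₁(y)} = e_y` for `y ∈ Q`. -/
inductive DModRel : (P.M →₀ DRing p n R) → Prop
  | add (x y : P.M) :
      DModRel (Finsupp.single (x + y) 1 - (Finsupp.single x 1 + Finsupp.single y 1))
  | smul (a : TruncatedWittVector p n R) (x : P.M) :
      DModRel (Finsupp.single (a • x) 1 - Finsupp.single x (DRing.ofW p n R a))
  | F (x : P.M) : DModRel (Finsupp.single (P.F x) 1 - Finsupp.single x (DRing.F p n R))
  | F₁ (y : P.Q) (z : P.M) (h : Submodule.Quotient.mk z = P.F₁ y) :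
      DModRel (Finsupp.single z (DRing.V p n R) - Finsupp.single (y : P.M) 1)

/-- The submodule generated by the relations. -/
noncomputable def relations : Submodule (DRing p n R) (P.M →₀ DRing p n R) :=
  Submodule.span (DRing p n R) {r | P.DModRel r}

/-- The `𝔇_{n,R}`-module `D(P)`. -/
abbrev DMod : Type u := (P.M →₀ DRing p n R) ⧸ P.relations

/-- The canonical map `M → D(P)`. -/
noncomputable def toDMod (x : P.M) : P.DMod := P.relations.mkQ (Finsupp.single x 1)

/-- The conditions on a map `f : M → N` in the universal property of `D(P)`. -/
structure IsDHom {N : Type*} [AddCommGroup N] [Module (DRing p n R) N] (f : P.M →+ N) : Prop where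
  smul : ∀ (a : TruncatedWittVector p n R) (x : P.M), f (a • x) = DRing.ofW p n R a • f x
  F : ∀ x : P.M, f (P.F x) = DRing.F p n R • f x
  V_F₁ : ∀ (y : P.Q) (z : P.M), Submodule.Quotient.mk z = P.F₁ y → DRing.V p n R • f z = f y

/-- The universal property of `D(P)`: for every `𝔇_{n,R}`-module `N`, composition with `M → D(P)`
identifies `Hom(D(P), N)` with the set of maps `f : M → N` satisfying `IsDHom`. -/
theorem existsUnique_DMod_hom {N : Type*} [AddCommGroup N] [Module (DRing p n R) N]
    (f : P.M →+ N) :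
    P.IsDHom f ↔ ∃! g : P.DMod →ₗ[DRing p n R] N, ∀ x, g (P.toDMod x) = f x := by
  constructor
  · intro hf
    let g₀ : (P.M →₀ DRing p n R) →ₗ[DRing p n R] N :=
      Finsupp.lsum ℕ fun x => LinearMap.toSpanSingleton (DRing p n R) N (f x)
    have hg₀ : ∀ x d, g₀ (Finsupp.single x d) = d • f x := by
      intro x d
      simp [g₀]
    have hle : P.relations ≤ LinearMap.ker g₀ := by
      refine Submodule.span_le.mpr ?_
      rintro r hr
      rw [SetLike.mem_coe, LinearMap.mem_ker]
      cases hr with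
      | add x y => simp [hg₀]
      | smul a x => simp [hg₀, hf.smul]
      | F x => simp [hg₀, hf.F]
      | F₁ y z h => simp [hg₀, hf.V_F₁ y z h]
    refine ⟨P.relations.liftQ g₀ hle, fun x => ?_, fun g' hg' => ?_⟩
    · exact (hg₀ x 1).trans (one_smul _ _)
    · refine Submodule.linearMap_qext _ (Finsupp.lhom_ext fun x d => ?_)
      have h1 : Finsupp.single x d = d • Finsupp.single x (1 : DRing p n R) := by simp
      rw [h1, map_smul, map_smul]
      exact congrArg (d • ·) ((hg' x).trans ((hg₀ x 1).trans (one_smul _ _)).symm)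
  · rintro ⟨g, hg, -⟩
    have key : ∀ r, P.DModRel r → g (P.relations.mkQ r) = 0 := by
      intro r hr
      have : P.relations.mkQ r = 0 := by
        rw [← LinearMap.mem_ker, Submodule.ker_mkQ]
        exact Submodule.subset_span hr
      rw [this, map_zero]
    have hs : ∀ x d, g (P.relations.mkQ (Finsupp.single x d)) = d • f x := by
      intro x d
      have h1 : Finsupp.single x d = d • Finsupp.single x (1 : DRing p n R) := by simp
      rw [h1, map_smul]
      exact (map_smul g d _).trans (congrArg (d • ·) (hg x))
    have hsub : ∀ r s, P.DModRel (r - s) → g (P.relations.mkQ r) = g (P.relations.mkQ s) := by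
      intro r s h
      have h2 := key _ h
      rw [map_sub] at h2
      exact sub_eq_zero.mp ((map_sub g _ _).symm.trans h2)
    refine ⟨fun a x => ?_, fun x => ?_, fun y z h => ?_⟩
    · have := hsub _ _ (DModRel.smul a x)
      rwa [hs, hs, one_smul] at this
    · have := hsub _ _ (DModRel.F x)
      rwa [hs, hs, one_smul] at this
    · have := hsub _ _ (DModRel.F₁ y z h)
      rwa [hs, hs, one_smul] at this

end WeakSemidisplay

/-! ### Commutative group schemes through their functors of points, and Cartier duality -/

/-- A functor from `R`-algebras to abelian groups (additively written). An `R`-algebra is a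
commutative ring `S` with a ring homomorphism `φ : R → S`. -/
structure GroupFunctor (R : Type u) [CommRing R] where
  /-- the group of `S`-points -/
  obj (S : Type u) [CommRing S] (φ : R →+* S) : Type v
  [addCommGroup (S : Type u) [CommRing S] (φ : R →+* S) : AddCommGroup (obj S φ)]
  /-- functoriality -/
  map {S S' : Type u} [CommRing S] [CommRing S'] {φ : R →+* S} {φ' : R →+* S'} (f : S →+* S')
    (hf : f.comp φ = φ') : obj S φ →+ obj S' φ'
  map_id {S : Type u} [CommRing S] (φ : R →+* S) (x : obj S φ) :
    map (RingHom.id S) (RingHom.id_comp φ) x = x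
  map_map {S S' S'' : Type u} [CommRing S] [CommRing S'] [CommRing S''] {φ : R →+* S}
    {φ' : R →+* S'} {φ'' : R →+* S''} (f : S →+* S') (hf : f.comp φ = φ') (g : S' →+* S'')
    (hg : g.comp φ' = φ'') (x : obj S φ) :
    map g hg (map f hf x) = map (g.comp f) (by rw [RingHom.comp_assoc, hf, hg]) x

attribute [instance] GroupFunctor.addCommGroup

namespace GroupFunctor

/-- Homomorphisms of commutative group functors. -/
@[ext]
structure Hom {R : Type u} [CommRing R] (G : GroupFunctor.{u, v} R) (H : GroupFunctor.{u, w} R) where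
  /-- the homomorphism on `S`-points -/
  app (S : Type u) [CommRing S] (φ : R →+* S) : G.obj S φ →+ H.obj S φ
  naturality {S S' : Type u} [CommRing S] [CommRing S'] {φ : R →+* S} {φ' : R →+* S'}
    (f : S →+* S') (hf : f.comp φ = φ') (x : G.obj S φ) :
    app S' φ' (G.map f hf x) = H.map f hf (app S φ x)

section Hom

variable {R : Type u} [CommRing R] {G : GroupFunctor.{u, v} R} {H : GroupFunctor.{u, w} R}

instance : Zero (Hom G H) := ⟨⟨fun _ _ _ => 0, by intros; simp⟩⟩

instance : Add (Hom G H) :=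
  ⟨fun a b => ⟨fun S _ φ => a.app S φ + b.app S φ, by intros; simp [a.naturality, b.naturality]⟩⟩

instance : Neg (Hom G H) :=
  ⟨fun a => ⟨fun S _ φ => -a.app S φ, by intros; simp [a.naturality]⟩⟩

/-- Homomorphisms form an abelian group under pointwise addition. -/
instance : AddCommGroup (Hom G H) where
  add_assoc a b c := by
    ext S _ φ x; exact add_assoc (a.app S φ x) (b.app S φ x) (c.app S φ x)
  zero_add a := by ext S _ φ x; exact zero_add (a.app S φ x)
  add_zero a := by ext S _ φ x; exact add_zero (a.app S φ x)
  add_comm a b := by ext S _ φ x; exact add_comm (a.app S φ x) (b.app S φ x)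
  neg_add_cancel a := by ext S _ φ x; exact neg_add_cancel (a.app S φ x)
  nsmul := nsmulRec
  zsmul := zsmulRec

theorem add_app (a b : Hom G H) (S : Type u) [CommRing S] (φ : R →+* S) (x : G.obj S φ) :
    (a + b).app S φ x = a.app S φ x + b.app S φ x := rfl

theorem zero_app (S : Type u) [CommRing S] (φ : R →+* S) (x : G.obj S φ) :
    (0 : Hom G H).app S φ x = 0 := rfl

theorem nsmul_app (m : ℕ) (a : Hom G H) (S : Type u) [CommRing S] (φ : R →+* S) (x : G.obj S φ) :
    (m • a).app S φ x = m • a.app S φ x := by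
  induction m with
  | zero => rw [zero_smul, zero_smul, zero_app]
  | succ m ih => rw [succ_nsmul, succ_nsmul, add_app, ih]

end Hom

/-- Base change of a group functor along `φ : R → S`. -/
def baseChange {R : Type u} [CommRing R] (G : GroupFunctor.{u, v} R) {S : Type u} [CommRing S]
    (φ : R →+* S) : GroupFunctor.{u, v} S where
  obj S' _ ψ := G.obj S' (ψ.comp φ)
  map f hf := G.map f (by rw [← hf, RingHom.comp_assoc])
  map_id ψ x := G.map_id _ x
  map_map f _ g _ x := G.map_map f _ g _ x

/-- The multiplicative group `𝔾_m`, written additively. -/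
def Gm (R : Type u) [CommRing R] : GroupFunctor.{u, u} R where
  obj S _ _ := Additive Sˣ
  addCommGroup _ _ _ := inferInstance
  map {_ _} _ _ {_ _} f _ := (Units.map (f : _ →* _)).toAdditive
  map_id _ _ := rfl
  map_map _ _ _ _ _ := rfl

/-- The additive group of truncated Witt vectors, as a commutative group functor `W_{n,R}`. -/
noncomputable def witt (p : ℕ) [Fact p.Prime] (n : ℕ) (R : Type u) [CommRing R] :
    GroupFunctor.{u, u} R where
  obj S _ _ := TruncatedWittVector p n S
  addCommGroup _ _ _ := inferInstance
  map {_ _} _ _ {_ _} f _ := (wittMap p n f).toAddMonoidHom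
  map_id _ x := wittMap_id p n x
  map_map f _ g _ x := (wittMap_comp p n f g x).symm

theorem map_map_eq {R : Type u} [CommRing R] (G : GroupFunctor.{u, v} R)
    {S S₁ S₂ T : Type u} [CommRing S] [CommRing S₁] [CommRing S₂] [CommRing T]
    {φ : R →+* S} {φ₁ : R →+* S₁} {φ₂ : R →+* S₂} {φ' : R →+* T}
    (f₁ : S →+* S₁) (hf₁ : f₁.comp φ = φ₁) (g₁ : S₁ →+* T) (hg₁ : g₁.comp φ₁ = φ')
    (f₂ : S →+* S₂) (hf₂ : f₂.comp φ = φ₂) (g₂ : S₂ →+* T) (hg₂ : g₂.comp φ₂ = φ')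
    (h : g₁.comp f₁ = g₂.comp f₂) (x : G.obj S φ) :
    G.map g₁ hg₁ (G.map f₁ hf₁ x) = G.map g₂ hg₂ (G.map f₂ hf₂ x) := by
  rw [G.map_map, G.map_map]
  congr 1
  simp only [h]

section Duality

variable {R : Type u} [CommRing R] (G : GroupFunctor.{u, v} R)

/-- For `f : S → S'` over `R` and `α : G_S → 𝔾_{m,S}`, the base change of `α` along `f`. -/
def dualMap {S S' : Type u} [CommRing S] [CommRing S'] {φ : R →+* S} {φ' : R →+* S'}
    (f : S →+* S') (hf : f.comp φ = φ') (α : Hom (G.baseChange φ) (Gm S)) :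
    Hom (G.baseChange φ') (Gm S') where
  app T _ ψ := (α.app T (ψ.comp f)).comp
    (G.map (φ := ψ.comp φ') (φ' := (ψ.comp f).comp φ) (RingHom.id T)
      (by rw [RingHom.id_comp, RingHom.comp_assoc, hf]))
  naturality {T T'} _ _ {ψ ψ'} g hg x := by
    have h := α.naturality (φ := ψ.comp f) (φ' := ψ'.comp f) g
      (by rw [← hg, RingHom.comp_assoc])
      (G.map (φ := ψ.comp φ') (φ' := (ψ.comp f).comp φ) (RingHom.id T)
        (by rw [RingHom.id_comp, RingHom.comp_assoc, hf]) x)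
    refine Eq.trans (congrArg (α.app T' (ψ'.comp f)) ?_) h
    apply G.map_map_eq
    rfl

/-- The Cartier dual `G^* = Hom(G, 𝔾_m)`: its group of `S`-points is the group of homomorphisms
`G_S → 𝔾_{m,S}` of group functors over `S`. -/
def cartierDual : GroupFunctor.{u, max (u + 1) v} R where
  obj S _ φ := Hom (G.baseChange φ) (Gm S)
  addCommGroup _ _ _ := inferInstance
  map {_ _} _ _ {_ _} f hf :=
    { toFun := G.dualMap f hf
      map_zero' := rfl
      map_add' := fun _ _ => rfl }
  map_id φ α := by
    ext T _ ψ x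
    exact congrArg (α.app T ψ) (G.map_id _ x)
  map_map f hf g hg α := by
    ext T _ ψ x
    exact congrArg (α.app T _) (G.map_map _ _ _ _ x)

/-- The `S`-point `α ↦ α(x)` of `G^{**}` defined by an `S`-point `x` of `G`. -/
def evalAt {S : Type u} [CommRing S] (φ : R →+* S) (x : G.obj S φ) :
    Hom (G.cartierDual.baseChange φ) (Gm S) where
  app T _ ψ :=
    { toFun := fun α => Hom.app (G := G.baseChange (ψ.comp φ)) (H := Gm T) α T (RingHom.id T)
        (G.map (φ' := ψ.comp φ) ψ rfl x)
      map_zero' := rfl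
      map_add' := fun _ _ => rfl }
  naturality {T T'} _ _ {ψ ψ'} g hg α := by
    have h := Hom.naturality (G := G.baseChange (ψ.comp φ)) (H := Gm T) α
      (φ := RingHom.id T) (φ' := g) g rfl (G.map (φ' := ψ.comp φ) ψ rfl x)
    refine Eq.trans ?_ h
    refine congrArg (Hom.app (G := G.baseChange (ψ.comp φ)) (H := Gm T) α T' g) ?_
    refine (G.map_map _ _ _ _ _).trans (Eq.trans ?_ (G.map_map _ _ _ _ _).symm)
    congr 1
    subst hg
    rfl

/-- The canonical biduality homomorphism `G → G^{**}`, `x ↦ (α ↦ α(x))`. -/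
def biduality : Hom G G.cartierDual.cartierDual where
  app S _ φ :=
    { toFun := G.evalAt φ
      map_zero' := by
        refine Hom.ext (funext fun T => funext fun _ => funext fun ψ => DFunLike.ext _ _ fun α => ?_)
        change Hom.app (G := G.baseChange (ψ.comp φ)) (H := Gm T) α T _ (G.map _ _ 0) = 0
        rw [map_zero]
        exact map_zero (Hom.app (G := G.baseChange (ψ.comp φ)) (H := Gm T) α T _)
      map_add' := fun x y => by
        refine Hom.ext (funext fun T => funext fun _ => funext fun ψ => DFunLike.ext _ _ fun α => ?_)
        change Hom.app (G := G.baseChange (ψ.comp φ)) (H := Gm T) α T _ (G.map _ _ (x + y)) = _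
        rw [map_add]
        exact map_add (Hom.app (G := G.baseChange (ψ.comp φ)) (H := Gm T) α T _) _ _ }
  naturality {S S'} _ _ {φ φ'} f hf x := by
    refine Hom.ext (funext fun T => funext fun _ => funext fun ψ => DFunLike.ext _ _ fun α => ?_)
    refine congrArg (Hom.app (G := G.baseChange (ψ.comp φ')) (H := Gm T) α T _) ?_
    apply G.map_map_eq
    rfl

end Duality

/-! The ring `𝔇_{n,R}` acts on `W_{n,R}`, hence on `Hom(G, W_{n,R})`. -/

section WittHom

variable (p : ℕ) [Fact p.Prime] (n : ℕ) {R : Type u} [CommRing R] (G : GroupFunctor.{u, v} R)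

variable {p n G}

/-- A homomorphism `G → W_{n,R}` on `S`-points. -/
def Hom.val (f : Hom G (witt p n R)) {S : Type u} [CommRing S] (φ : R →+* S) :
    G.obj S φ →+ TruncatedWittVector p n S := f.app S φ

theorem Hom.val_map (f : Hom G (witt p n R)) {S S' : Type u} [CommRing S] [CommRing S']
    {φ : R →+* S} {φ' : R →+* S'} (g : S →+* S') (hg : g.comp φ = φ') (x : G.obj S φ) :
    f.val φ' (G.map g hg x) = wittMap p n g (f.val φ x) := f.naturality g hg x

theorem Hom.ext_val {f g : Hom G (witt p n R)}
    (h : ∀ (S : Type u) [CommRing S] (φ : R →+* S) (x : G.obj S φ), f.val φ x = g.val φ x) :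
    f = g :=
  Hom.ext (funext fun S => funext fun _ => funext fun φ => DFunLike.ext _ _ fun x => h S φ x)

variable (p n G)

/-- The action of `a ∈ W_n(R)` on `Hom(G, W_{n,R})`. -/
noncomputable def wittSMul :
    TruncatedWittVector p n R →+* AddMonoid.End (Hom G (witt p n R)) where
  toFun a :=
    { toFun := fun f =>
        { app := fun S _ φ => (AddMonoidHom.mulLeft (wittMap p n φ a)).comp (f.val φ)
          naturality := fun {S S'} _ _ {φ φ'} g hg x => by
            change wittMap p n φ' a * f.val φ' (G.map g hg x) =
              wittMap p n g (wittMap p n φ a * f.val φ x)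
            rw [map_mul, f.val_map, ← wittMap_comp, hg] }
      map_zero' := Hom.ext_val fun S _ φ x => mul_zero (wittMap p n φ a)
      map_add' := fun f g => Hom.ext_val fun S _ φ x =>
        mul_add (wittMap p n φ a) (f.val φ x) (g.val φ x) }
  map_one' := DFunLike.ext _ _ fun f => Hom.ext_val fun S _ φ x => by
    change wittMap p n φ 1 * f.val φ x = f.val φ x
    rw [map_one, one_mul]
  map_mul' a b := DFunLike.ext _ _ fun f => Hom.ext_val fun S _ φ x => by
    change wittMap p n φ (a * b) * f.val φ x = wittMap p n φ a * (wittMap p n φ b * f.val φ x)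
    rw [map_mul, mul_assoc]
  map_zero' := DFunLike.ext _ _ fun f => Hom.ext_val fun S _ φ x => by
    change wittMap p n φ 0 * f.val φ x = 0
    rw [map_zero, zero_mul]
  map_add' a b := DFunLike.ext _ _ fun f => Hom.ext_val fun S _ φ x => by
    change wittMap p n φ (a + b) * f.val φ x =
      wittMap p n φ a * f.val φ x + wittMap p n φ b * f.val φ x
    rw [map_add, add_mul]

/-- The action of `F` on `Hom(G, W_{n,R})`. -/
noncomputable def wittF (h : (p : R) = 0) : AddMonoid.End (Hom G (witt p n R)) where
  toFun f :=
    { app := fun S _ φ => (frobHom p n (by rw [← map_natCast φ, h, map_zero] :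
        (p : S) = 0)).toAddMonoidHom.comp (f.val φ)
      naturality := fun {S S'} _ _ {φ φ'} g hg x => by
        change frob p n (f.val φ' (G.map g hg x)) = wittMap p n g (frob p n (f.val φ x))
        rw [f.val_map, wittMap_frob] }
  map_zero' := Hom.ext_val fun S _ φ x =>
    map_zero (frobHom p n (by rw [← map_natCast φ, h, map_zero] : (p : S) = 0))
  map_add' f g := Hom.ext_val fun S _ φ x =>
    map_add (frobHom p n (by rw [← map_natCast φ, h, map_zero] : (p : S) = 0))
      (f.val φ x) (g.val φ x)

/-- The action of `V` on `Hom(G, W_{n,R})`. -/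
noncomputable def wittV : AddMonoid.End (Hom G (witt p n R)) where
  toFun f :=
    { app := fun S _ φ => (versHom p n).comp (f.val φ)
      naturality := fun {S S'} _ _ {φ φ'} g hg x => by
        change vers p n (f.val φ' (G.map g hg x)) = wittMap p n g (vers p n (f.val φ x))
        rw [f.val_map, wittMap_vers] }
  map_zero' := Hom.ext_val fun S _ φ x => map_zero (versHom p n)
  map_add' f g := Hom.ext_val fun S _ φ x => map_add (versHom p n) (f.val φ x) (g.val φ x)

/-- The ring homomorphism `𝔇_{n,R} → End(Hom(G, W_{n,R}))`. -/
noncomputable def wittAction (h : (p : R) = 0) :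
    DRing p n R →+* AddMonoid.End (Hom G (witt p n R)) :=
  have hS : ∀ {S : Type u} [CommRing S] (φ : R →+* S), (p : S) = 0 := fun φ => by
    rw [← map_natCast φ, h, map_zero]
  DRing.lift p n R (wittSMul p n G) (wittF p n G h) (wittV p n G)
    (by
      have key : ∀ (k : ℕ) (f : Hom G (witt p n R)) (S : Type u) [CommRing S] (φ : R →+* S)
          (x : G.obj S φ), ((wittV p n G ^ k) f).val φ x = (vers p n)^[k] (f.val φ x) := by
        intro k
        induction k with
        | zero => intros; rfl
        | succ k ih =>
          intro f S _ φ x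
          rw [pow_succ, Function.iterate_succ_apply]
          exact ih (wittV p n G f) S φ x
      refine DFunLike.ext _ _ fun f => Hom.ext_val fun S _ φ x => ?_
      rw [key, vers_iterate]
      rfl)
    (by
      refine DFunLike.ext _ _ fun f => Hom.ext_val fun S _ φ x => ?_
      refine (frob_vers p n (hS φ) (f.val φ x)).trans ?_
      rw [← nsmul_eq_mul]
      exact (nsmul_app p f S φ x).symm)
    (fun a => DFunLike.ext _ _ fun f => Hom.ext_val fun S _ φ x => by
      refine (map_mul (frobHom p n (hS φ)) (wittMap p n φ a) (f.val φ x)).trans ?_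
      exact congrArg (· * frob p n (f.val φ x)) (wittMap_frob p n φ a).symm)
    (fun a => DFunLike.ext _ _ fun f => Hom.ext_val fun S _ φ x => by
      change wittMap p n φ a * vers p n (f.val φ x) =
        vers p n (wittMap p n φ (frob p n a) * f.val φ x)
      rw [wittMap_frob, mul_comm, mul_comm (frob p n _), vers_mul_frob p n (hS φ)])
    (fun a => DFunLike.ext _ _ fun f => Hom.ext_val fun S _ φ x => by
      change vers p n (wittMap p n φ a * frob p n (f.val φ x)) =
        wittMap p n φ (vers p n a) * f.val φ x
      rw [wittMap_vers, vers_mul_frob p n (hS φ)])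

/-- The `𝔇_{n,R}`-module `Hom(G, W_{n,R})`. -/
noncomputable instance [Algebra (ZMod p) R] : Module (DRing p n R) (Hom G (witt p n R)) :=
  Module.compHom _ (wittAction p n G (natCast_eq_zero p R))

end WittHom

end GroupFunctor

/-! ### The group schemes attached to a weak semidisplay -/

namespace WeakSemidisplay

variable {p : ℕ} [Fact p.Prime] {n : ℕ} [NeZero n] {R : Type u} [CommRing R] [Algebra (ZMod p) R]
  (P : WeakSemidisplay p n R)

/-- The group `Hom(P, 1)(S)` for `φ : R → S`: the `W_n(R)`-linear maps `η : M → W_n(S)` such that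
`η(F x) = F(η(x))` for `x ∈ M` and `η(y) = V(η(F₁ y))` for `y ∈ Q`. -/
def dualPoints {S : Type u} [CommRing S] (φ : R →+* S) :
    AddSubgroup (P.M →ₛₗ[wittMap p n φ] TruncatedWittVector p n S) :=
  have hS : (p : S) = 0 := by rw [← map_natCast φ, natCast_eq_zero, map_zero]
  { carrier := {η | (∀ x : P.M, η (P.F x) = frob p n (η x)) ∧
      ∀ (y : P.Q) (z : P.M), Submodule.Quotient.mk z = P.F₁ y → η y = vers p n (η z)}
    zero_mem' := ⟨fun _ => (map_zero (frobHom p n hS)).symm,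
      fun _ _ _ => (map_zero (versHom p n (R := S))).symm⟩
    add_mem' {η θ} hη hθ := ⟨fun x =>
        (congrArg₂ (· + ·) (hη.1 x) (hθ.1 x)).trans (map_add (frobHom p n hS) (η x) (θ x)).symm,
      fun y z h =>
        (congrArg₂ (· + ·) (hη.2 y z h) (hθ.2 y z h)).trans (map_add (versHom p n) (η z) (θ z)).symm⟩
    neg_mem' {η} hη := ⟨fun x =>
        (congrArg (- ·) (hη.1 x)).trans (map_neg (frobHom p n hS) (η x)).symm,
      fun y z h => (congrArg (- ·) (hη.2 y z h)).trans (map_neg (versHom p n) (η z)).symm⟩ }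

/-- The commutative group scheme `Hom(P, 1)`. -/
noncomputable def dual : GroupFunctor.{u, u} R where
  obj S _ φ := P.dualPoints φ
  addCommGroup _ _ _ := inferInstance
  map {S S'} _ _ {φ φ'} f hf :=
    { toFun := fun η => ⟨
        { toFun := fun x => wittMap p n f (η.1 x)
          map_add' := fun x y => by rw [map_add, map_add]
          map_smul' := fun a x => by
            rw [map_smulₛₗ, smul_eq_mul, map_mul, ← wittMap_comp, hf, smul_eq_mul] },
        And.intro (fun x => (congrArg (wittMap p n f) (η.2.1 x)).trans (wittMap_frob p n f _))
          (fun y z h => (congrArg (wittMap p n f) (η.2.2 y z h)).trans (wittMap_vers p n f _))⟩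
      map_zero' := Subtype.ext (LinearMap.ext fun x => map_zero (wittMap p n f))
      map_add' := fun η θ => Subtype.ext (LinearMap.ext fun x =>
        map_add (wittMap p n f) (η.1 x) (θ.1 x)) }
  map_id φ η := Subtype.ext (LinearMap.ext fun x => wittMap_id p n (η.1 x))
  map_map f hf g hg η := Subtype.ext (LinearMap.ext fun x => (wittMap_comp p n f g (η.1 x)).symm)

/-- The group scheme `Z_P`, i.e. the Cartier dual of `Hom(P, 1)`. -/
noncomputable def zink : GroupFunctor.{u, u + 1} R := P.dual.cartierDual

end WeakSemidisplay

/-- The `𝔇_{n,R}`-module `Hom(Z^*, W_{n,R})` attached to a commutative group scheme `Z` by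
`n`-truncated Cartier theory. -/
abbrev cartierModule (p : ℕ) [Fact p.Prime] (n : ℕ) {R : Type u} [CommRing R]
    (Z : GroupFunctor.{u, v} R) : Type (max (u + 1) v) :=
  GroupFunctor.Hom Z.cartierDual (GroupFunctor.witt p n R)

end Semidisplay

set_option linter.unusedSectionVars false
set_option linter.style.haveILetI false

/-! Choose generators `t_j` of `T` and `l_i` of `L`. If `f` is a map from `M` to a `𝔇`-module as in
the universal property of `D(P)`, then `f(l) = V f(F₁ l)`. Expanding lifts of the `F₁ l_i` in the
generators gives an equation `γ = V C + V D γ` for a matrix with `f(l) = γ f(t)`. Since `V ^ n = 0`,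
it can be solved by iteration, and the relation `f(l) = γ f(t)` is forced. So `f` is determined by
the vector `X = f(t)`, which satisfies `F X = δ X` for a square matrix `δ` with entries in `W_n(R) +
V 𝔇`. Conversely every solution `X` defines such a map (`Frame.isDHom_hom`). As the `t_j` need not
be independent, going from `X` to the map and back to its values at the `t_j` need not return `X`;
only the other composite is the identity. Hence `D(P)` is a direct summand of the module `SolMod δ`
with generators `t_j` and relations `F t = δ t`, and, taking values in `W_n(S)`, `Hom(P, 1)` is a
retract of the group functor `sol δ` of Witt vector solutions. Everything to be proved passes to
retracts, so it suffices to treat `δ`.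

In components, `F X = δ X` reads: the `p`-th power of `X_(j,k)` equals a polynomial in the
components of level below `k` plus a linear form in those of level `k`. A leading term argument
shows that the coordinate ring of `sol δ` is free over `R` on the monomials with all exponents less
than `p`. This has two consequences. First, biduality holds for `sol δ`: over a finite free
coordinate ring `A`, characters are group-like elements, the dual is represented by the convolution
algebra of linear forms on `A`, and a point of the bidual is a linear form which turns out to be
multiplicative. Second, an identity between reduced polynomials that holds on all solutions is an
identity of polynomials.

The main computation (`exists_eq_sum_of_additive`) determines the additive functions on `sol δ`:
they are the linear combinations of the zeroth components. Translating by `V ^ m Z` shows that the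
derivatives in the variables of the top level `m` are constant, so these variables occur linearly;
for `m > 0` the first carry in Witt vector addition, which contains `x ^ (p - 1) y`, forces their
coefficients to vanish.

Now filter by powers of `V`. Every element of `SolMod δ` has the form `∑ a_j t_j + V m`, and its
evaluation on solutions has zeroth component `∑ a_(j,0) X_(j,0)`. Independence of the `X_(j,0)`
yields injectivity of evaluation and the kernel-image condition of cosmoothness; the description of
additive functions yields surjectivity, one component at a time. The isomorphism `e` is evaluation
followed by the inverse of pullback along biduality. -/

namespace Semidisplay

/-! ### Reduced polynomials -/

section Reduced

open MvPolynomial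

variable {I R Γ : Type*} [CommRing R] [AddCommMonoid Γ] [LinearOrder Γ]
  [IsOrderedCancelAddMonoid Γ] (deg : (I →₀ ℕ) →+ Γ)

/-- The polynomials all of whose monomials have degree less than `γ`. -/
noncomputable def lowPoly (R : Type*) [CommRing R] (γ : Γ) : Submodule R (MvPolynomial I R) :=
  restrictSupport R {e | deg e < γ}

theorem mem_lowPoly {γ : Γ} {f : MvPolynomial I R} :
    f ∈ lowPoly deg R γ ↔ ∀ e ∈ f.support, deg e < γ := by
  rw [lowPoly, mem_restrictSupport_iff]; rfl

theorem monomial_mem_lowPoly {γ : Γ} {e : I →₀ ℕ} (h : deg e < γ) (r : R) :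
    monomial e r ∈ lowPoly deg R γ := by
  classical
  rw [mem_lowPoly]
  intro e' he'
  rw [support_monomial] at he'
  split_ifs at he' with h0
  · simp at he'
  · rw [Finset.mem_singleton.mp he']; exact h

/-- `f` is a monic polynomial with leading monomial `X ^ e`. -/
def HasLead (e : I →₀ ℕ) (f : MvPolynomial I R) : Prop :=
  f - monomial e 1 ∈ lowPoly deg R (deg e)

theorem mul_mem_lowPoly {a b : Γ} {f g : MvPolynomial I R}
    (hf : ∀ e ∈ f.support, deg e ≤ a) (hg : g ∈ lowPoly deg R b) : f * g ∈ lowPoly deg R (a + b) := by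
  classical
  rw [mem_lowPoly] at hg ⊢
  intro e he
  obtain ⟨x, hx, y, hy, rfl⟩ := Finset.mem_add.mp (support_mul f g he)
  rw [map_add]
  exact add_lt_add_of_le_of_lt (hf x hx) (hg y hy)

variable {deg}

theorem HasLead.mul {a b : I →₀ ℕ} {f g : MvPolynomial I R} (hf : HasLead deg a f)
    (hg : HasLead deg b g) : HasLead deg (a + b) (f * g) := by
  classical
  have h1 : f * g - monomial (a + b) 1 =
      monomial a 1 * (g - monomial b 1) + monomial b 1 * (f - monomial a 1) +
        (f - monomial a 1) * (g - monomial b 1) := by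
    rw [← one_mul (1 : R), ← monomial_mul, one_mul]; ring
  have hm : ∀ c : I →₀ ℕ, ∀ e ∈ (monomial c (1 : R)).support, deg e ≤ deg c := by
    intro c e he
    have := support_monomial_subset he
    rw [Finset.mem_singleton.mp this]
  rw [HasLead, h1, map_add]
  refine Submodule.add_mem _ (Submodule.add_mem _ (mul_mem_lowPoly deg (hm a) hg) ?_) ?_
  · rw [add_comm]; exact mul_mem_lowPoly deg (hm b) hf
  · exact mul_mem_lowPoly deg (fun e he => ((mem_lowPoly deg).mp hf e he).le) hg

theorem HasLead.one : HasLead deg (0 : I →₀ ℕ) (1 : MvPolynomial I R) := by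
  rw [HasLead, ← C_1, ← C_apply, sub_self]; exact Submodule.zero_mem _

theorem HasLead.pow {a : I →₀ ℕ} {f : MvPolynomial I R} (hf : HasLead deg a f) (k : ℕ) :
    HasLead deg (k • a) (f ^ k) := by
  induction k with
  | zero => simpa using HasLead.one
  | succ k ih => rw [succ_nsmul, pow_succ]; exact ih.mul hf

theorem HasLead.prod {ι : Type*} (s : Finset ι) {a : ι → I →₀ ℕ} {f : ι → MvPolynomial I R}
    (h : ∀ i, HasLead deg (a i) (f i)) : HasLead deg (∑ i ∈ s, a i) (∏ i ∈ s, f i) := by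
  classical
  induction s using Finset.induction_on with
  | empty => simpa using HasLead.one
  | insert i s hi ih => rw [Finset.sum_insert hi, Finset.prod_insert hi]; exact (h i).mul ih

theorem HasLead.monomial (a : I →₀ ℕ) : HasLead deg a (MvPolynomial.monomial a (1 : R)) := by
  rw [HasLead, sub_self]; exact Submodule.zero_mem _

variable [Fintype I] (p : ℕ) (Q : I → MvPolynomial I R)

/-- The ideal generated by the polynomials `X_i ^ p - Q_i`. -/
noncomputable def relIdeal : Ideal (MvPolynomial I R) :=
  Ideal.span (Set.range fun i => X i ^ p - Q i)

/-- Replace `X_i ^ p` by `X_i ^ p - Q_i` in monomials. -/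
noncomputable def twist : MvPolynomial I R →ₗ[R] MvPolynomial I R :=
  (basisMonomials I R).constr R fun m => ∏ i, (X i ^ (m i % p) * (X i ^ p - Q i) ^ (m i / p))

theorem twist_monomial (m : I →₀ ℕ) : twist p Q (monomial m 1) =
    ∏ i, (X i ^ (m i % p) * (X i ^ p - Q i) ^ (m i / p)) := by
  have h : monomial m (1 : R) = basisMonomials I R m := by rw [coe_basisMonomials]
  rw [twist, h, Module.Basis.constr_basis]

variable {p Q}

theorem hasLead_twist (hQ : ∀ i, Q i ∈ lowPoly deg R (deg (Finsupp.single i p)))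
    (m : I →₀ ℕ) : HasLead deg m (twist p Q (monomial m 1)) := by
  rw [twist_monomial]
  have h := HasLead.prod (deg := deg) Finset.univ
    (a := fun i => (m i % p) • Finsupp.single i 1 + (m i / p) • Finsupp.single i p)
    (f := fun i => (X i : MvPolynomial I R) ^ (m i % p) * (X i ^ p - Q i) ^ (m i / p)) fun i => by
      refine HasLead.mul (HasLead.pow (HasLead.monomial _) _) (HasLead.pow ?_ _)
      rw [HasLead, X_pow_eq_monomial, sub_sub_cancel_left]
      exact Submodule.neg_mem _ (hQ i)
  convert h
  classical
  ext j
  simp only [Finsupp.finsetSum_apply, Finsupp.add_apply, Finsupp.smul_apply, Finsupp.single_apply,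
    smul_eq_mul, mul_ite, mul_one, mul_zero, Finset.sum_add_distrib, Finset.sum_ite_eq',
    Finset.mem_univ, if_true, Nat.mod_add_div']

/-- `twist` sends a monomial to itself plus terms of smaller degree, so well-founded induction on a
strict degree bound puts every polynomial in the range. -/
theorem twist_surjective [WellFoundedLT Γ]
    (hQ : ∀ i, Q i ∈ lowPoly deg R (deg (Finsupp.single i p))) :
    Function.Surjective (twist p Q) := by
  have key : ∀ γ : Γ, ∀ f ∈ lowPoly deg R γ, f ∈ LinearMap.range (twist p Q) := by
    intro γ
    induction γ using WellFoundedLT.induction with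
    | ind γ ih =>
      intro f hf
      rw [f.as_sum]
      refine Submodule.sum_mem _ fun e he => ?_
      have h1 := ih (deg e) ((mem_lowPoly deg).mp hf e he) _ (hasLead_twist hQ e)
      have h2 : monomial e (1 : R) ∈ LinearMap.range (twist p Q) := by
        have := Submodule.sub_mem _ (LinearMap.mem_range_self (twist p Q) (monomial e 1)) h1
        rwa [sub_sub_cancel] at this
      have h3 := Submodule.smul_mem _ (f.coeff e) h2
      rwa [smul_monomial, smul_eq_mul, mul_one] at h3
  intro f
  rw [← LinearMap.mem_range, f.as_sum]
  refine Submodule.sum_mem _ fun e he => ?_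
  have h1 := key _ _ (hasLead_twist hQ e)
  have h2 : monomial e (1 : R) ∈ LinearMap.range (twist p Q) := by
    have := Submodule.sub_mem _ (LinearMap.mem_range_self (twist p Q) (monomial e 1)) h1
    rwa [sub_sub_cancel] at this
  have h3 := Submodule.smul_mem _ (f.coeff e) h2
  rwa [smul_monomial, smul_eq_mul, mul_one] at h3

/-- A monomial of maximal degree in `f` keeps its coefficient: the corrections coming from any
monomial have strictly smaller degree. Thus `deg` need not be injective on monomials. -/
theorem twist_injective (hQ : ∀ i, Q i ∈ lowPoly deg R (deg (Finsupp.single i p))) :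
    Function.Injective (twist p Q) := by
  classical
  rw [← LinearMap.ker_eq_bot, LinearMap.ker_eq_bot']
  intro f hf
  by_contra h0
  obtain ⟨e, he, hmax⟩ := Finset.exists_max_image f.support deg (support_nonempty.mpr h0)
  have h1 : (twist p Q f).coeff e = f.coeff e := by
    conv_lhs => rw [f.as_sum]
    rw [map_sum, coeff_sum, Finset.sum_eq_single e]
    · have h2 := hasLead_twist hQ e
      have h3 : ((twist p Q) (monomial e 1) - monomial e 1).coeff e = 0 := by
        by_contra h4
        exact lt_irrefl _ ((mem_lowPoly deg).mp h2 e (mem_support_iff.mpr h4))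
      rw [coeff_sub, coeff_monomial, if_pos rfl, sub_eq_zero] at h3
      rw [← mul_one (f.coeff e), ← smul_eq_mul, ← smul_monomial, map_smul, coeff_smul, h3]
    · intro m hm hne
      have h2 := hasLead_twist hQ m
      have h3 : ((twist p Q) (monomial m 1) - monomial m 1).coeff e = 0 := by
        by_contra h4
        exact absurd ((mem_lowPoly deg).mp h2 e (mem_support_iff.mpr h4)) (hmax m hm).not_gt
      rw [coeff_sub, coeff_monomial, if_neg hne, sub_zero] at h3
      rw [← mul_one (f.coeff m), ← smul_eq_mul, ← smul_monomial, map_smul, coeff_smul, h3,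
        smul_zero]
    · intro h; exact absurd he h
  rw [hf, coeff_zero] at h1
  exact mem_support_iff.mp he h1.symm

/-- Adding `p` to the `i`-th exponent preserves its residue and raises its quotient by one. So
`twist`, although not multiplicative, intertwines multiplication by `X_i ^ p` and by `X_i ^ p -
Q_i`. -/
theorem twist_X_pow_mul (hp : 0 < p) (i : I) (f : MvPolynomial I R) :
    twist p Q (X i ^ p * f) = (X i ^ p - Q i) * twist p Q f := by
  classical
  have h : (twist p Q) ∘ₗ (LinearMap.mulLeft R (X i ^ p)) =
      (LinearMap.mulLeft R (X i ^ p - Q i)) ∘ₗ twist p Q := by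
    refine (basisMonomials I R).ext fun m => ?_
    rw [coe_basisMonomials, LinearMap.comp_apply, LinearMap.comp_apply, LinearMap.mulLeft_apply,
      LinearMap.mulLeft_apply, X_pow_eq_monomial, monomial_mul, one_mul, twist_monomial,
      twist_monomial, mul_comm _ (∏ _, _)]
    have h1 : X i ^ p - Q i = ∏ j, if j = i then X i ^ p - Q i else 1 := by simp
    rw [← X_pow_eq_monomial]
    conv_rhs => rw [h1]
    rw [← Finset.prod_mul_distrib]
    refine Finset.prod_congr rfl fun j _ => ?_
    rw [Finsupp.add_apply, Finsupp.single_apply]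
    by_cases hj : i = j
    · subst hj
      rw [if_pos rfl, if_pos rfl, Nat.add_mod_left, Nat.add_div_left _ hp, pow_succ, mul_assoc]
    · rw [if_neg hj, if_neg (Ne.symm hj), zero_add, mul_one]
  exact LinearMap.congr_fun h f

theorem twist_eq_self {f : MvPolynomial I R} (hf : f ∈ restrictDegree I R (p - 1)) (hp : 0 < p) :
    twist p Q f = f := by
  conv_lhs => rw [f.as_sum]
  conv_rhs => rw [f.as_sum]
  rw [map_sum]
  refine Finset.sum_congr rfl fun e he => ?_
  have h1 : ∀ i, e i < p := fun i => by
    have := (mem_restrictDegree _ _ _).mp hf e he i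
    omega
  rw [← mul_one (f.coeff e), ← smul_eq_mul, ← smul_monomial, map_smul, twist_monomial,
    monomial_eq, Finsupp.prod_fintype _ _ (fun i => pow_zero _), C_1, one_mul]
  congr 1
  refine Finset.prod_congr rfl fun i _ => ?_
  rw [Nat.mod_eq_of_lt (h1 i), Nat.div_eq_of_lt (h1 i), pow_zero, mul_one]

/-- `twist` carries the monomial ideal generated by the `X_i ^ p` onto `relIdeal`. Surjectivity is
what allows arbitrary coefficients of the relations to be written as twisted polynomials. -/
theorem mem_relIdeal_iff (hp : 0 < p) [WellFoundedLT Γ]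
    (hQ : ∀ i, Q i ∈ lowPoly deg R (deg (Finsupp.single i p))) (f : MvPolynomial I R) :
    f ∈ relIdeal p Q ↔
      ∃ g ∈ Ideal.span (Set.range fun i : I => (X i : MvPolynomial I R) ^ p), f = twist p Q g := by
  constructor
  · intro hf
    rw [relIdeal, Ideal.mem_span_range_iff_exists_fun] at hf
    obtain ⟨c, rfl⟩ := hf
    choose c' hc' using fun i => twist_surjective hQ (c i)
    refine ⟨∑ i, X i ^ p * c' i, Ideal.sum_mem _ fun i _ =>
      Ideal.mul_mem_right _ _ (Ideal.subset_span ⟨i, rfl⟩), ?_⟩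
    rw [map_sum]
    refine Finset.sum_congr rfl fun i _ => ?_
    rw [twist_X_pow_mul hp, hc', mul_comm]
  · rintro ⟨g, hg, rfl⟩
    rw [Ideal.mem_span_range_iff_exists_fun] at hg
    obtain ⟨c, rfl⟩ := hg
    rw [map_sum]
    refine Ideal.sum_mem _ fun i _ => ?_
    rw [mul_comm, twist_X_pow_mul hp]
    exact Ideal.mul_mem_right _ _ (Ideal.subset_span ⟨i, rfl⟩)

theorem mem_span_X_pow_iff (f : MvPolynomial I R) :
    f ∈ Ideal.span (Set.range fun i : I => (X i : MvPolynomial I R) ^ p) ↔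
      ∀ e ∈ f.support, ∃ i, p ≤ e i := by
  have h : (Set.range fun i : I => (X i : MvPolynomial I R) ^ p) =
      (fun e => monomial e 1) '' (Set.range fun i : I => Finsupp.single i p) := by
    rw [← Set.range_comp]
    refine congrArg Set.range (funext fun i => X_pow_eq_monomial)
  rw [h, mem_ideal_span_monomial_image]
  simp only [Set.exists_range_iff, Finsupp.single_le_iff]

/-- `twist` fixes reduced polynomials, so injectivity reduces the claim to the monomial ideal, where
it is clear. -/
theorem eq_zero_of_mem_relIdeal (hp : 0 < p) [WellFoundedLT Γ]
    (hQ : ∀ i, Q i ∈ lowPoly deg R (deg (Finsupp.single i p))) {f : MvPolynomial I R}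
    (hf : f ∈ restrictDegree I R (p - 1)) (hf' : f ∈ relIdeal p Q) : f = 0 := by
  obtain ⟨g, hg, h⟩ := (mem_relIdeal_iff hp hQ f).mp hf'
  obtain rfl : f = g := twist_injective hQ ((twist_eq_self hf hp).trans h)
  rw [mem_span_X_pow_iff] at hg
  rw [← support_eq_empty, Finset.eq_empty_iff_forall_notMem]
  intro e he
  obtain ⟨i, hi⟩ := hg e he
  have := (mem_restrictDegree _ _ _).mp hf e he i
  omega

theorem exists_sub_mem_relIdeal (hp : 0 < p) [WellFoundedLT Γ]
    (hQ : ∀ i, Q i ∈ lowPoly deg R (deg (Finsupp.single i p))) (f : MvPolynomial I R) :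
    ∃ g ∈ restrictDegree I R (p - 1), f - g ∈ relIdeal p Q := by
  classical
  obtain ⟨h, rfl⟩ := twist_surjective hQ f
  rw [h.as_sum, map_sum]
  -- The representative keeps exactly the reduced monomials of the preimage `h` under `twist`; every
  -- other monomial is divisible by some `X_i ^ p`.
  refine ⟨∑ e ∈ h.support, if ∀ i, e i < p then monomial e (h.coeff e) else 0,
    Submodule.sum_mem _ fun e _ => ?_, ?_⟩
  · split_ifs with hi
    · rw [mem_restrictDegree]
      intro e' he' i
      rw [Finset.mem_singleton.mp (support_monomial_subset he')]
      have := hi i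
      omega
    · exact Submodule.zero_mem _
  · rw [← Finset.sum_sub_distrib]
    refine Ideal.sum_mem _ fun e _ => ?_
    split_ifs with hi
    · rw [twist_eq_self _ hp, sub_self]
      · exact Ideal.zero_mem _
      · rw [mem_restrictDegree]
        intro e' he' i
        rw [Finset.mem_singleton.mp (support_monomial_subset he')]
        have := hi i
        omega
    · rw [sub_zero, mem_relIdeal_iff hp hQ]
      refine ⟨_, ?_, rfl⟩
      rw [mem_span_X_pow_iff]
      intro e' he'
      rw [Finset.mem_singleton.mp (support_monomial_subset he')]
      push Not at hi
      exact hi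

/-- `R[X] / (X_i ^ p - Q_i)`. -/
abbrev RelQuot (p : ℕ) (Q : I → MvPolynomial I R) : Type _ := MvPolynomial I R ⧸ relIdeal p Q

/-- The reduced polynomials form a system of representatives. -/
noncomputable def relQuotEquiv (hp : 0 < p) [WellFoundedLT Γ]
    (hQ : ∀ i, Q i ∈ lowPoly deg R (deg (Finsupp.single i p))) :
    restrictDegree I R (p - 1) ≃ₗ[R] RelQuot p Q :=
  LinearEquiv.ofBijective
    ((Ideal.Quotient.mkₐ R (relIdeal p Q)).toLinearMap ∘ₗ (restrictDegree I R (p - 1)).subtype)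
    ⟨by
      rw [← LinearMap.ker_eq_bot, LinearMap.ker_eq_bot']
      intro f hf
      exact Subtype.ext (eq_zero_of_mem_relIdeal hp hQ f.2 (Ideal.Quotient.eq_zero_iff_mem.mp hf)),
    by
      intro a
      obtain ⟨f, rfl⟩ := Ideal.Quotient.mk_surjective a
      obtain ⟨g, hg, h⟩ := exists_sub_mem_relIdeal hp hQ f
      exact ⟨⟨g, hg⟩, (Ideal.Quotient.eq.mpr h).symm⟩⟩

theorem free_relQuot (hp : 0 < p) [WellFoundedLT Γ]
    (hQ : ∀ i, Q i ∈ lowPoly deg R (deg (Finsupp.single i p))) : Module.Free R (RelQuot p Q) :=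
  Module.Free.of_basis ((basisRestrictSupport R _).map (relQuotEquiv hp hQ))

theorem finite_relQuot (hp : 0 < p) [WellFoundedLT Γ]
    (hQ : ∀ i, Q i ∈ lowPoly deg R (deg (Finsupp.single i p))) : Module.Finite R (RelQuot p Q) := by
  classical
  have hfin : Set.Finite {n : I →₀ ℕ | ∀ i, n i ≤ p - 1} := by
    refine Set.Finite.subset (Set.finite_Iic (Finsupp.equivFunOnFinite.symm fun _ => p - 1)) ?_
    intro e he i
    simpa using he i
  have : Finite {n : I →₀ ℕ | ∀ i, n i ≤ p - 1} := hfin.to_subtype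
  exact Module.Finite.of_basis ((basisRestrictSupport R {n : I →₀ ℕ | ∀ i, n i ≤ p - 1}).map
    (relQuotEquiv hp hQ))

end Reduced

/-! ### Representable group functors and Cartier duality -/

namespace GroupFunctor

open scoped TensorProduct

section Representable

variable {R : Type u} [CommRing R] (G : GroupFunctor.{u, v} R) {A : Type u} [CommRing A]
  [Algebra R A] (e : G.obj A (algebraMap R A))

/-- The point `e ∈ G(A)` represents `G`. -/
def IsUniversal : Prop :=
  ∀ (S : Type u) [CommRing S] (φ : R →+* S) (x : G.obj S φ),
    ∃! f : A →+* S, ∃ hf : f.comp (algebraMap R A) = φ, G.map f hf e = x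

variable {G e} (he : G.IsUniversal e)

namespace IsUniversal

section

variable {S : Type u} [CommRing S] {φ : R →+* S}

/-- The ring homomorphism corresponding to a point. -/
noncomputable def lift (x : G.obj S φ) : A →+* S := (he S φ x).choose

theorem lift_comp (x : G.obj S φ) : (he.lift x).comp (algebraMap R A) = φ :=
  (he S φ x).choose_spec.1.1

theorem map_lift (x : G.obj S φ) : G.map (he.lift x) (he.lift_comp x) e = x :=
  (he S φ x).choose_spec.1.2

theorem lift_map (f : A →+* S) (hf : f.comp (algebraMap R A) = φ) :
    he.lift (G.map f hf e) = f :=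
  ((he S φ (G.map f hf e)).choose_spec.2 f ⟨hf, rfl⟩).symm

theorem lift_naturality {S' : Type u} [CommRing S'] {φ' : R →+* S'} (g : S →+* S')
    (hg : g.comp φ = φ') (x : G.obj S φ) : he.lift (G.map g hg x) = g.comp (he.lift x) := by
  have h := he.lift_map (φ := φ') (g.comp (he.lift x))
    (by rw [RingHom.comp_assoc, he.lift_comp, hg])
  rw [← h, ← G.map_map (he.lift x) (he.lift_comp x) g hg, he.map_lift]

theorem lift_injective : Function.Injective (he.lift (S := S) (φ := φ)) := fun x y h => by
  rw [← he.map_lift x, ← he.map_lift y]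
  congr 1
  simp only [h]

end

/-! ### The coalgebra structure on the ring of functions. -/

section Coalgebra

variable {B : Type u} [CommRing B] [Algebra R B]

/-- The point attached to an algebra homomorphism. -/
def pt (_ : G.IsUniversal e) (f : A →ₐ[R] B) : G.obj B (algebraMap R B) :=
  G.map (f : A →+* B) f.comp_algebraMap e

/-- The Yoneda principle behind the coalgebra axioms: equalities of algebra maps out of `A` are
checked on the attached points, where they become the axioms of an abelian group. -/
theorem pt_injective {f g : A →ₐ[R] B} (h : he.pt f = he.pt g) : f = g := by
  have h1 := congrArg he.lift h
  rw [pt, pt, he.lift_map, he.lift_map] at h1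
  exact AlgHom.coe_ringHom_injective h1

theorem pt_comp {C : Type u} [CommRing C] [Algebra R C] (g : B →ₐ[R] C) (f : A →ₐ[R] B) :
    he.pt (g.comp f) = G.map (g : B →+* C) g.comp_algebraMap (he.pt f) := by
  rw [pt, pt, G.map_map]; rfl

/-- The algebra homomorphism attached to a point. -/
noncomputable def liftₐ (x : G.obj B (algebraMap R B)) : A →ₐ[R] B :=
  { he.lift x with commutes' := fun r => RingHom.congr_fun (he.lift_comp x) r }

theorem pt_liftₐ (x : G.obj B (algebraMap R B)) : he.pt (he.liftₐ x) = x := he.map_lift x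

/-- The comultiplication. -/
noncomputable def comul : A →ₐ[R] A ⊗[R] A :=
  he.liftₐ (he.pt Algebra.TensorProduct.includeLeft + he.pt Algebra.TensorProduct.includeRight)

/-- The counit. -/
noncomputable def counit : A →ₐ[R] R := he.liftₐ 0

theorem pt_comp_comul (m : A ⊗[R] A →ₐ[R] B) : he.pt (m.comp he.comul) =
    he.pt (m.comp Algebra.TensorProduct.includeLeft) +
      he.pt (m.comp Algebra.TensorProduct.includeRight) := by
  rw [he.pt_comp, comul, he.pt_liftₐ, map_add, ← he.pt_comp, ← he.pt_comp]

theorem pt_comp_counit (m : R →ₐ[R] B) : he.pt (m.comp he.counit) = 0 := by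
  rw [he.pt_comp, counit, he.pt_liftₐ, map_zero]

/-- The coalgebra structure on the ring of functions. -/
noncomputable abbrev coalgebra : Coalgebra R A where
  comul := he.comul.toLinearMap
  counit := he.counit.toLinearMap
  coassoc := by
    have h : ((Algebra.TensorProduct.assoc R R R A A A).toAlgHom.comp
        (Algebra.TensorProduct.map he.comul (.id R A))).comp he.comul =
        (Algebra.TensorProduct.map (.id R A) he.comul).comp he.comul := by
      apply he.pt_injective
      rw [he.pt_comp_comul, he.pt_comp_comul, AlgHom.comp_assoc, AlgHom.comp_assoc,
        Algebra.TensorProduct.map_comp_includeLeft, Algebra.TensorProduct.map_comp_includeRight,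
        Algebra.TensorProduct.map_comp_includeLeft, Algebra.TensorProduct.map_comp_includeRight,
        ← AlgHom.comp_assoc, ← AlgHom.comp_assoc, he.pt_comp_comul, he.pt_comp_comul, add_assoc]
      congr 1
    exact congrArg AlgHom.toLinearMap h
  rTensor_counit_comp_comul := by
    have h : (Algebra.TensorProduct.map he.counit (.id R A)).comp he.comul =
        ((Algebra.TensorProduct.lid R A).symm : A →ₐ[R] R ⊗[R] A) := by
      apply he.pt_injective
      rw [he.pt_comp_comul, Algebra.TensorProduct.map_comp_includeLeft,
        Algebra.TensorProduct.map_comp_includeRight, he.pt_comp_counit, zero_add]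
      rfl
    exact congrArg AlgHom.toLinearMap h
  lTensor_counit_comp_comul := by
    have h : (Algebra.TensorProduct.map (.id R A) he.counit).comp he.comul =
        ((Algebra.TensorProduct.rid R R A).symm : A →ₐ[R] A ⊗[R] R) := by
      apply he.pt_injective
      rw [he.pt_comp_comul, Algebra.TensorProduct.map_comp_includeLeft,
        Algebra.TensorProduct.map_comp_includeRight, he.pt_comp_counit, add_zero]
      rfl
    exact congrArg AlgHom.toLinearMap h

theorem isCocomm : letI := he.coalgebra; Coalgebra.IsCocomm R A := by
  letI := he.coalgebra
  refine ⟨?_⟩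
  have h : (Algebra.TensorProduct.comm R A A).toAlgHom.comp he.comul = he.comul := by
    apply he.pt_injective
    rw [he.pt_comp_comul]
    conv_rhs => rw [← AlgHom.id_comp he.comul, he.pt_comp_comul]
    rw [add_comm]
    congr 1
  exact congrArg AlgHom.toLinearMap h

end Coalgebra

/-! ### Characters of `G_S` as group-like elements, in coordinates. -/

section Coordinates

variable {I : Type*} [Fintype I] (b : Module.Basis I R A)

/-- The structure constants of the comultiplication. -/
noncomputable def cst (k i j : I) : R := (b.tensorProduct b).repr (he.comul (b k)) (i, j)

theorem comul_basis (k : I) : he.comul (b k) = ∑ i, ∑ j, he.cst b k i j • (b i ⊗ₜ[R] b j) := by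
  rw [← (b.tensorProduct b).sum_repr (he.comul (b k)), Fintype.sum_prod_type]
  simp only [Module.Basis.tensorProduct_apply]
  rfl

variable {S : Type u} [CommRing S] {φ : R →+* S}

theorem lift_add_basis (x y : G.obj S φ) (k : I) : he.lift (x + y) (b k) =
    ∑ i, ∑ j, φ (he.cst b k i j) * (he.lift x (b i) * he.lift y (b j)) := by
  letI := φ.toAlgebra
  let lx : A →ₐ[R] S := he.liftₐ (B := S) x
  let ly : A →ₐ[R] S := he.liftₐ (B := S) y
  let m := Algebra.TensorProduct.lift lx ly (fun _ _ => Commute.all _ _)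
  have h : m.comp he.comul = he.liftₐ (B := S) (x + y) := by
    apply he.pt_injective
    have h1 : m.comp Algebra.TensorProduct.includeRight = ly :=
      AlgHom.ext fun a => by simp [m]
    rw [he.pt_comp_comul, he.pt_liftₐ, Algebra.TensorProduct.lift_comp_includeLeft, h1,
      he.pt_liftₐ, he.pt_liftₐ]
  have h2 := AlgHom.congr_fun h (b k)
  refine h2.symm.trans ?_
  rw [AlgHom.comp_apply, he.comul_basis b, map_sum]
  refine Finset.sum_congr rfl fun i _ => ?_
  rw [map_sum]
  refine Finset.sum_congr rfl fun j _ => ?_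
  rw [map_smul, Algebra.TensorProduct.lift_tmul, Algebra.smul_def]
  rfl

theorem lift_zero_apply (a : A) : he.lift (0 : G.obj S φ) a = φ (he.counit a) := by
  letI := φ.toAlgebra
  have h : (Algebra.ofId R S).comp he.counit = he.liftₐ (B := S) 0 := by
    apply he.pt_injective
    rw [he.pt_comp_counit, he.pt_liftₐ]
  exact (AlgHom.congr_fun h a).symm

/-- The coordinates of a character of `G_S`. -/
def IsChar (φ : R →+* S) (κ : I → S) : Prop :=
  (∀ i j, ∑ k, φ (he.cst b k i j) * κ k = κ i * κ j) ∧ ∑ k, φ (he.counit (b k)) * κ k = 1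

/-- The value of a character with given coordinates. -/
noncomputable def charVal (κ : I → S) {T : Type u} [CommRing T] (ψ : S →+* T)
    (x : G.obj T (ψ.comp φ)) : T := ∑ i, ψ (κ i) * he.lift x (b i)

variable {b}

theorem IsChar.charVal_add {κ : I → S} (hκ : he.IsChar b φ κ) {T : Type u} [CommRing T]
    (ψ : S →+* T) (x y : G.obj T (ψ.comp φ)) :
    he.charVal b κ ψ (x + y) = he.charVal b κ ψ x * he.charVal b κ ψ y := by
  simp only [charVal, he.lift_add_basis b, Finset.sum_mul_sum]
  simp only [Finset.mul_sum]
  rw [Finset.sum_comm]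
  refine Finset.sum_congr rfl fun i _ => ?_
  rw [Finset.sum_comm]
  refine Finset.sum_congr rfl fun j _ => ?_
  have h : ψ (κ i) * he.lift x (b i) * (ψ (κ j) * he.lift y (b j)) =
      ψ (κ i * κ j) * (he.lift x (b i) * he.lift y (b j)) := by rw [map_mul]; ring
  rw [h, ← hκ.1, map_sum, Finset.sum_mul]
  refine Finset.sum_congr rfl fun k _ => ?_
  rw [map_mul, RingHom.comp_apply]
  ring

theorem IsChar.charVal_zero {κ : I → S} (hκ : he.IsChar b φ κ) {T : Type u} [CommRing T]
    (ψ : S →+* T) : he.charVal b κ ψ (0 : G.obj T (ψ.comp φ)) = 1 := by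
  rw [charVal, ← map_one ψ, ← hκ.2, map_sum]
  refine Finset.sum_congr rfl fun k _ => ?_
  rw [he.lift_zero_apply, map_mul, RingHom.comp_apply, mul_comm]

theorem charVal_map (κ : I → S) {T T' : Type u} [CommRing T] [CommRing T'] (ψ : S →+* T)
    (f : T →+* T') (x : G.obj T (ψ.comp φ)) :
    he.charVal b κ (f.comp ψ) (G.map f (RingHom.comp_assoc _ _ _).symm x) =
      f (he.charVal b κ ψ x) := by
  rw [charVal, charVal, map_sum]
  refine Finset.sum_congr rfl fun i _ => ?_
  rw [he.lift_naturality, map_mul]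
  rfl

/-- For comparing characters after base change: the two points live over base maps that need not be
definitionally equal, so they are compared through the ring homomorphisms they classify. -/
theorem charVal_congr (κ : I → S) {T : Type u} [CommRing T] {φ : R →+* S} (ψ : S →+* T)
    {κ' : I → T} {θ : R →+* T} (hκ : ∀ i, ψ (κ i) = κ' i)
    {T' : Type u} [CommRing T'] (ψ' : T →+* T') (x : G.obj T' (ψ'.comp θ))
    (y : G.obj T' ((ψ'.comp ψ).comp φ)) (hxy : he.lift x = he.lift y) :
    he.charVal b κ (ψ'.comp ψ) y = he.charVal b κ' ψ' x := by
  rw [charVal, charVal]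
  refine Finset.sum_congr rfl fun i _ => ?_
  rw [hxy, RingHom.comp_apply, hκ]

/-- The character with given coordinates. -/
noncomputable def IsChar.toHom {κ : I → S} (hκ : he.IsChar b φ κ) :
    Hom (G.baseChange φ) (Gm S) where
  app T _ ψ :=
    { toFun := fun x => Additive.ofMul
        { val := he.charVal b κ ψ x
          inv := he.charVal b κ ψ (-x : G.obj T (ψ.comp φ))
          val_inv := ((hκ.charVal_add he ψ x _).symm.trans
            (congrArg _ (add_neg_cancel (G := G.obj T (ψ.comp φ)) x))).trans (hκ.charVal_zero he ψ)
          inv_val := ((hκ.charVal_add he ψ _ x).symm.trans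
            (congrArg _ (neg_add_cancel (G := G.obj T (ψ.comp φ)) x))).trans
              (hκ.charVal_zero he ψ) }
      map_zero' := Units.ext (hκ.charVal_zero he ψ)
      map_add' := fun x y => Units.ext (hκ.charVal_add he ψ x y) }
  naturality {T T'} _ _ {ψ ψ'} f hf x := Units.ext (by
    subst hf
    exact he.charVal_map κ ψ f x)

/-- The underlying ring element of an element of `𝔾_m`. -/
def unitVal {T : Type u} [CommRing T] (z : Additive Tˣ) : T := ((z.toMul : Tˣ) : T)

/-- The value of a character at a point, as a ring element. -/
def charApp (α : Hom (G.baseChange φ) (Gm S)) {T : Type u} [CommRing T] (ψ : S →+* T)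
    (x : G.obj T (ψ.comp φ)) : T := unitVal (α.app T ψ x)

theorem charApp_ext {α β : Hom (G.baseChange φ) (Gm S)}
    (h : ∀ (T : Type u) [CommRing T] (ψ : S →+* T) (x : G.obj T (ψ.comp φ)),
      charApp α ψ x = charApp β ψ x) : α = β :=
  Hom.ext (funext fun T => funext fun _ => funext fun ψ => DFunLike.ext _ _ fun x =>
    Units.ext (h T ψ x))

theorem charApp_add (α : Hom (G.baseChange φ) (Gm S)) {T : Type u} [CommRing T] (ψ : S →+* T)
    (x y : G.obj T (ψ.comp φ)) : charApp α ψ (x + y) = charApp α ψ x * charApp α ψ y :=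
  congrArg (unitVal (T := T)) (map_add (α.app T ψ) x y)

theorem charApp_zero (α : Hom (G.baseChange φ) (Gm S)) {T : Type u} [CommRing T] (ψ : S →+* T) :
    charApp α ψ (0 : G.obj T (ψ.comp φ)) = 1 :=
  congrArg (unitVal (T := T)) (map_zero (α.app T ψ))

theorem charApp_map (α : Hom (G.baseChange φ) (Gm S)) {T T' : Type u} [CommRing T] [CommRing T']
    (ψ : S →+* T) (ψ' : S →+* T') (f : T →+* T') (hf : f.comp ψ = ψ') (x : G.obj T (ψ.comp φ)) :
    charApp α ψ' (G.map f (by rw [← RingHom.comp_assoc, hf]) x) = f (charApp α ψ x) :=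
  congrArg (unitVal (T := T')) (α.naturality (φ := ψ) (φ' := ψ') f hf x)

theorem IsChar.charApp_toHom {κ : I → S} (hκ : he.IsChar b φ κ) {T : Type u} [CommRing T]
    (ψ : S →+* T) (x : G.obj T (ψ.comp φ)) :
    charApp (hκ.toHom he) ψ x = he.charVal b κ ψ x := rfl

/-- The coordinates are those of the value of `α` at the universal point over `S ⊗ A`, since every
other point is a specialization of it. Multiplicativity at two independent universal points over `S
⊗ (A ⊗ A)`, together with the value at the zero point, makes the element group-like. -/
theorem exists_coords (α : Hom (G.baseChange φ) (Gm S)) :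
    ∃ κ : I → S, he.IsChar b φ κ ∧
      ∀ (T : Type u) [CommRing T] (ψ : S →+* T) (x : G.obj T (ψ.comp φ)),
        charApp α ψ x = he.charVal b κ ψ x := by
  letI := φ.toAlgebra
  let ψ₀ : S →+* S ⊗[R] A := Algebra.TensorProduct.includeLeftRingHom
  have hr : (Algebra.TensorProduct.includeRight : A →ₐ[R] S ⊗[R] A).toRingHom.comp
      (algebraMap R A) = ψ₀.comp φ := by
    ext r
    exact (Algebra.TensorProduct.includeRight : A →ₐ[R] S ⊗[R] A).commutes r
  let x₀ : G.obj (S ⊗[R] A) (ψ₀.comp φ) :=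
    G.map (Algebra.TensorProduct.includeRight : A →ₐ[R] S ⊗[R] A).toRingHom hr e
  let κ : I → S := fun i => (b.baseChange S).repr (charApp α ψ₀ x₀) i
  have hval : ∀ (T : Type u) [CommRing T] (ψ : S →+* T) (x : G.obj T (ψ.comp φ)),
        charApp α ψ x = he.charVal b κ ψ x := by
    intro T _ ψ x
    letI : Algebra S T := ψ.toAlgebra
    letI : Algebra R T := (ψ.comp φ).toAlgebra
    haveI : IsScalarTower R S T := IsScalarTower.of_algebraMap_eq fun _ => rfl
    let m : S ⊗[R] A →ₐ[S] T := Algebra.TensorProduct.lift (Algebra.ofId S T)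
      (he.liftₐ (B := T) x) (fun _ _ => Commute.all _ _)
    have hm : ∀ a, m (1 ⊗ₜ a) = he.lift x a := fun a => by
      rw [Algebra.TensorProduct.lift_tmul, map_one, one_mul]; rfl
    have hmψ : m.toRingHom.comp ψ₀ = ψ := by
      ext s
      change m (s ⊗ₜ 1) = ψ s
      rw [Algebra.TensorProduct.lift_tmul, map_one, mul_one]; rfl
    have hx : G.map (φ' := ψ.comp φ) m.toRingHom (by rw [← RingHom.comp_assoc, hmψ]) x₀ = x := by
      rw [G.map_map]
      conv_rhs => rw [← he.map_lift x]
      congr 1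
      simp only [show m.toRingHom.comp (Algebra.TensorProduct.includeRight :
        A →ₐ[R] S ⊗[R] A).toRingHom = he.lift x from RingHom.ext hm]
    have h1 : charApp α ψ x = m (charApp α ψ₀ x₀) :=
      (congrArg (charApp α ψ) hx.symm).trans (charApp_map α ψ₀ ψ m.toRingHom hmψ x₀)
    rw [h1, ← (b.baseChange S).sum_repr (charApp α ψ₀ x₀), map_sum]
    refine Finset.sum_congr rfl fun i _ => ?_
    rw [map_smul, Module.Basis.baseChange_apply, hm, Algebra.smul_def]
    rfl
  refine ⟨κ, ⟨fun i j => ?_, ?_⟩, hval⟩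
  · let ψ₁ : S →+* S ⊗[R] (A ⊗[R] A) := Algebra.TensorProduct.includeLeftRingHom
    let r : A ⊗[R] A →ₐ[R] S ⊗[R] (A ⊗[R] A) := Algebra.TensorProduct.includeRight
    have hr1 : ∀ f : A →ₐ[R] A ⊗[R] A,
        (r.comp f).toRingHom.comp (algebraMap R A) = ψ₁.comp φ := by
      intro f
      ext a
      exact (r.comp f).commutes a
    let x₁ : G.obj (S ⊗[R] (A ⊗[R] A)) (ψ₁.comp φ) :=
      G.map _ (hr1 Algebra.TensorProduct.includeLeft) e
    let x₂ : G.obj (S ⊗[R] (A ⊗[R] A)) (ψ₁.comp φ) :=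
      G.map _ (hr1 Algebra.TensorProduct.includeRight) e
    have h := charApp_add α ψ₁ x₁ x₂
    rw [hval, hval, hval] at h
    simp only [charVal, he.lift_add_basis b, x₁, x₂, he.lift_map] at h
    -- Comparing coefficients of `b i ⊗ b j` yields the first condition of `IsChar`.
    have hb := congrArg (fun z => ((b.tensorProduct b).baseChange S).repr z (i, j)) h
    have e1 : ∀ k, ψ₁ (κ k) * ∑ i, ∑ j, (ψ₁.comp φ) (he.cst b k i j) *
        ((r.comp Algebra.TensorProduct.includeLeft).toRingHom (b i) *
          (r.comp Algebra.TensorProduct.includeRight).toRingHom (b j)) =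
        ∑ i, ∑ j, (φ (he.cst b k i j) * κ k) • (((b.tensorProduct b).baseChange S) (i, j)) := by
      intro k
      rw [Finset.mul_sum]
      refine Finset.sum_congr rfl fun i _ => ?_
      rw [Finset.mul_sum]
      refine Finset.sum_congr rfl fun j _ => ?_
      rw [Module.Basis.baseChange_apply, Module.Basis.tensorProduct_apply]
      change (κ k ⊗ₜ[R] (1 : A ⊗[R] A)) * ((φ (he.cst b k i j) ⊗ₜ[R] (1 : A ⊗[R] A)) *
        ((1 : S) ⊗ₜ[R] (b i ⊗ₜ[R] (1 : A)) * (1 : S) ⊗ₜ[R] ((1 : A) ⊗ₜ[R] b j))) = _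
      simp only [Algebra.TensorProduct.tmul_mul_tmul, one_mul, mul_one, TensorProduct.smul_tmul',
        smul_eq_mul]
      rw [mul_comm]
    have e2 : (∑ i, ψ₁ (κ i) * (r.comp Algebra.TensorProduct.includeLeft).toRingHom (b i)) *
        (∑ j, ψ₁ (κ j) * (r.comp Algebra.TensorProduct.includeRight).toRingHom (b j)) =
        ∑ i, ∑ j, (κ i * κ j) • (((b.tensorProduct b).baseChange S) (i, j)) := by
      rw [Finset.sum_mul_sum]
      refine Finset.sum_congr rfl fun i _ => Finset.sum_congr rfl fun j _ => ?_
      rw [Module.Basis.baseChange_apply, Module.Basis.tensorProduct_apply]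
      change (κ i ⊗ₜ[R] (1 : A ⊗[R] A)) * ((1 : S) ⊗ₜ[R] (b i ⊗ₜ[R] (1 : A))) *
        ((κ j ⊗ₜ[R] (1 : A ⊗[R] A)) * ((1 : S) ⊗ₜ[R] ((1 : A) ⊗ₜ[R] b j))) = _
      simp only [Algebra.TensorProduct.tmul_mul_tmul, one_mul, mul_one, TensorProduct.smul_tmul',
        smul_eq_mul]
    have e3 : ∀ c : I → I → S, ((b.tensorProduct b).baseChange S).repr
        (∑ i, ∑ j, c i j • (((b.tensorProduct b).baseChange S) (i, j))) (i, j) = c i j := by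
      intro c
      rw [← Fintype.sum_prod_type' (f := fun i j =>
        c i j • (((b.tensorProduct b).baseChange S) (i, j)))]
      exact ((b.tensorProduct b).baseChange S).repr_sum_self (fun q => c q.1 q.2) ▸ rfl
    rw [Finset.sum_congr rfl fun k _ => e1 k, e2, e3, Finset.sum_comm] at hb
    rw [← hb]
    rw [Finset.sum_congr rfl fun i _ => Finset.sum_comm]
    simp only [← Finset.sum_smul]
    exact (e3 fun i j => ∑ k, φ (he.cst b k i j) * κ k).symm
  · have h := hval S (RingHom.id S) 0
    rw [charApp_zero α (RingHom.id S), charVal] at h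
    rw [h]
    refine Finset.sum_congr rfl fun i _ => ?_
    rw [he.lift_zero_apply, mul_comm]
    rfl

/-- At the universal point over `S ⊗ A`, the value of a character is the combination of the
base-changed basis with its coordinates as coefficients. -/
theorem coords_unique {κ κ' : I → S}
    (h : ∀ (T : Type u) [CommRing T] (ψ : S →+* T) (x : G.obj T (ψ.comp φ)),
      he.charVal b κ ψ x = he.charVal b κ' ψ x) : κ = κ' := by
  letI := φ.toAlgebra
  let ψ₀ : S →+* S ⊗[R] A := Algebra.TensorProduct.includeLeftRingHom
  let r : A →ₐ[R] S ⊗[R] A := Algebra.TensorProduct.includeRight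
  have hr : (r : A →+* S ⊗[R] A).comp (algebraMap R A) = ψ₀.comp φ := by
    ext a
    exact r.commutes a
  have key : ∀ κ : I → S, he.charVal b κ ψ₀ (G.map (r : A →+* S ⊗[R] A) hr e) =
      ∑ i, κ i • b.baseChange S i := by
    intro κ
    rw [charVal, he.lift_map]
    refine Finset.sum_congr rfl fun i _ => ?_
    rw [Module.Basis.baseChange_apply]
    change (κ i ⊗ₜ[R] (1 : A)) * ((1 : S) ⊗ₜ[R] b i) = _
    rw [Algebra.TensorProduct.tmul_mul_tmul, TensorProduct.smul_tmul', one_mul, mul_one,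
      smul_eq_mul, mul_one]
  have h1 := h _ ψ₀ (G.map (r : A →+* S ⊗[R] A) hr e)
  rw [key, key] at h1
  have h2 := congrArg (fun z => ⇑((b.baseChange S).repr z)) h1
  simpa only [Module.Basis.repr_sum_self] using h2

theorem isChar_of_charApp (α : Hom (G.baseChange φ) (Gm S)) {κ : I → S}
    (h : ∀ (T : Type u) [CommRing T] (ψ : S →+* T) (x : G.obj T (ψ.comp φ)),
        charApp α ψ x = he.charVal b κ ψ x) : he.IsChar b φ κ := by
  obtain ⟨κ', hκ', h'⟩ := he.exists_coords (b := b) α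
  have := he.coords_unique (b := b) (κ := κ) (κ' := κ') fun T _ ψ x => by rw [← h, h']
  rwa [this]

end Coordinates

end IsUniversal

end Representable

end GroupFunctor

namespace GroupFunctor

namespace IsUniversal

/-! ### The convolution algebra of linear forms represents the Cartier dual. -/

section FunDual

variable {R : Type u} [CommRing R] {G : GroupFunctor.{u, v} R} {A : Type u} [CommRing A]
  [Algebra R A] {e : G.obj A (algebraMap R A)} (he : G.IsUniversal e)
  (S : Type u) [CommRing S] [Algebra R S]

/-- The `S`-valued linear forms on the ring of functions, with the convolution product. -/
def FunDual (_ : G.IsUniversal e) (S : Type u) [CommRing S] [Algebra R S] : Type u :=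
  WithConv (A →ₗ[R] S)

/-- Cocommutativity of `A` makes convolution commutative. The coalgebra structure depends on `he`,
so it is only introduced locally. -/
noncomputable instance : CommRing (he.FunDual S) :=
  letI := he.coalgebra
  letI := he.isCocomm
  (LinearMap.convCommRing : CommRing (WithConv (A →ₗ[R] S)))

noncomputable instance : Algebra S (he.FunDual S) :=
  letI := he.coalgebra
  letI := he.isCocomm
  (LinearMap.convAlgebra : Algebra S (WithConv (A →ₗ[R] S)))

variable {S}

/-- The linear form underlying an element of `FunDual`. -/
def FunDual.form (f : he.FunDual S) : A →ₗ[R] S := WithConv.ofConv f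

/-- A linear form as an element of `FunDual`. -/
def FunDual.ofForm (f : A →ₗ[R] S) : he.FunDual S := WithConv.toConv f

theorem FunDual.form_ofForm (f : A →ₗ[R] S) : form he (ofForm he f) = f := rfl

theorem FunDual.form_add (f g : he.FunDual S) : form he (f + g) = form he f + form he g := rfl

theorem FunDual.form_zero : form he (0 : he.FunDual S) = 0 := rfl

theorem FunDual.form_sum {ι : Type*} (s : Finset ι) (f : ι → he.FunDual S) (a : A) :
    form he (∑ i ∈ s, f i) a = ∑ i ∈ s, form he (f i) a := by
  classical
  induction s using Finset.induction_on with
  | empty => rfl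
  | insert i s hi ih =>
    rw [Finset.sum_insert hi, Finset.sum_insert hi, form_add, LinearMap.add_apply, ih]

theorem FunDual.form_one (a : A) :
    form he (1 : he.FunDual S) a = algebraMap R S (he.counit a) := rfl

theorem FunDual.form_algebraMap_mul (s : S) (f : he.FunDual S) (a : A) :
    form he (algebraMap S (he.FunDual S) s * f) a = s * form he f a := by
  rw [← Algebra.smul_def]; rfl

variable {I : Type*} [Fintype I] {b : Module.Basis I R A}

theorem FunDual.ext_basis (b : Module.Basis I R A) {f g : he.FunDual S}
    (h : ∀ i, form he f (b i) = form he g (b i)) : f = g :=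
  WithConv.ofConv_injective (b.ext h)

theorem FunDual.form_mul (f g : he.FunDual S) (k : I) : form he (f * g) (b k) =
    ∑ i, ∑ j, algebraMap R S (he.cst b k i j) * (form he f (b i) * form he g (b j)) := by
  change LinearMap.mul' R S (TensorProduct.map (form he f) (form he g) (he.comul (b k))) = _
  rw [he.comul_basis b, map_sum, map_sum]
  refine Finset.sum_congr rfl fun i _ => ?_
  rw [map_sum, map_sum]
  refine Finset.sum_congr rfl fun j _ => ?_
  rw [map_smul, map_smul, TensorProduct.map_tmul, LinearMap.mul'_apply, Algebra.smul_def]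

variable (b S)

/-- The dual basis. -/
noncomputable def FunDual.dualBasis (i : I) : he.FunDual S :=
  ofForm he (Algebra.linearMap R S ∘ₗ b.coord i)

theorem FunDual.form_dualBasis [DecidableEq I] (i j : I) :
    form he (dualBasis he S b i) (b j) = if i = j then 1 else 0 := by
  rw [dualBasis, form_ofForm, LinearMap.comp_apply, Module.Basis.coord_apply,
    Module.Basis.repr_self, Finsupp.single_apply, Algebra.linearMap_apply]
  split_ifs with h1 h2 h2
  · exact map_one _
  · exact absurd h1.symm h2
  · exact absurd h2.symm h1
  · exact map_zero _

/-- The canonical element `∑ b_i^* ⊗ b_i` is group-like because the convolution product has the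
structure constants of the comultiplication. -/
theorem FunDual.isChar_dualBasis :
    he.IsChar b ((algebraMap S (he.FunDual S)).comp (algebraMap R S)) (dualBasis he S b) := by
  classical
  constructor
  · intro i j
    refine ext_basis he b fun l => ?_
    rw [form_sum, form_mul (b := b)]
    simp only [RingHom.comp_apply, form_algebraMap_mul, form_dualBasis, mul_ite, mul_one, mul_zero,
      Finset.sum_ite_eq', Finset.sum_ite_eq, Finset.mem_univ, if_true]
  · refine ext_basis he b fun l => ?_
    rw [form_sum, form_one]
    simp only [RingHom.comp_apply, form_algebraMap_mul, form_dualBasis, mul_ite, mul_one, mul_zero,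
      Finset.sum_ite_eq', Finset.mem_univ, if_true]

variable {b S}

/-- A character over `T` defines a homomorphism from `FunDual`. -/
noncomputable def IsChar.eval {T : Type u} [CommRing T] {ψ : S →+* T} {κ : I → T}
    (hκ : he.IsChar b (ψ.comp (algebraMap R S)) κ) : he.FunDual S →+* T where
  toFun f := ∑ i, ψ (FunDual.form he f (b i)) * κ i
  map_one' := by
    simp only [FunDual.form_one]
    exact hκ.2
  map_zero' := by simp [FunDual.form_zero]
  map_add' f g := by
    simp only [FunDual.form_add, LinearMap.add_apply, map_add, add_mul, Finset.sum_add_distrib]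
  map_mul' f g := by
    have h : ∀ k, ψ (FunDual.form he (f * g) (b k)) * κ k = ∑ i, ∑ j,
        ((ψ.comp (algebraMap R S)) (he.cst b k i j) * κ k) *
          (ψ (FunDual.form he f (b i)) * ψ (FunDual.form he g (b j))) := by
      intro k
      rw [FunDual.form_mul, map_sum, Finset.sum_mul]
      refine Finset.sum_congr rfl fun i _ => ?_
      rw [map_sum, Finset.sum_mul]
      refine Finset.sum_congr rfl fun j _ => ?_
      rw [map_mul, map_mul, RingHom.comp_apply]
      ring
    rw [Finset.sum_congr rfl fun k _ => h k, Finset.sum_comm, Finset.sum_mul_sum]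
    refine Finset.sum_congr rfl fun i _ => ?_
    rw [Finset.sum_comm]
    refine Finset.sum_congr rfl fun j _ => ?_
    rw [← Finset.sum_mul, hκ.1]
    ring

theorem IsChar.eval_dualBasis {T : Type u} [CommRing T] {ψ : S →+* T} {κ : I → T}
    (hκ : he.IsChar b (ψ.comp (algebraMap R S)) κ) (i : I) :
    IsChar.eval he hκ (FunDual.dualBasis he S b i) = κ i := by
  classical
  change ∑ j, ψ (FunDual.form he (FunDual.dualBasis he S b i) (b j)) * κ j = κ i
  simp [FunDual.form_dualBasis]

theorem IsChar.eval_comp_algebraMap {T : Type u} [CommRing T] {ψ : S →+* T} {κ : I → T}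
    (hκ : he.IsChar b (ψ.comp (algebraMap R S)) κ) :
    (IsChar.eval he hκ).comp (algebraMap S (he.FunDual S)) = ψ := by
  ext s
  rw [RingHom.comp_apply, ← mul_one (algebraMap S (he.FunDual S) s), map_mul, map_one, mul_one]
  change ∑ j, ψ (FunDual.form he (algebraMap S (he.FunDual S) s) (b j)) * κ j = ψ s
  have h : ∀ j, ψ (FunDual.form he (algebraMap S (he.FunDual S) s) (b j)) * κ j =
      ψ s * ((ψ.comp (algebraMap R S)) (he.counit (b j)) * κ j) := by
    intro j
    rw [← mul_one (algebraMap S (he.FunDual S) s), FunDual.form_algebraMap_mul, map_mul,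
      FunDual.form_one, mul_assoc]
    rfl
  rw [Finset.sum_congr rfl fun j _ => h j, ← Finset.mul_sum, hκ.2, mul_one]

/-- The universal character of `G_S`. -/
noncomputable def FunDual.univ (S : Type u) [CommRing S] [Algebra R S] (b : Module.Basis I R A) :
    Hom (G.baseChange ((algebraMap S (he.FunDual S)).comp (algebraMap R S))) (Gm (he.FunDual S)) :=
  (FunDual.isChar_dualBasis he S b).toHom he

/-- Every character is obtained from the universal one. -/
theorem cartierDual_map_univ {T : Type u} [CommRing T] {ψ : S →+* T}
    (α : Hom (G.baseChange (ψ.comp (algebraMap R S))) (Gm T)) {κ : I → T}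
    (hκ : he.IsChar b (ψ.comp (algebraMap R S)) κ)
    (hα : ∀ (T' : Type u) [CommRing T'] (ψ' : T →+* T')
      (x : G.obj T' (ψ'.comp (ψ.comp (algebraMap R S)))), charApp α ψ' x = he.charVal b κ ψ' x) :
    G.cartierDual.map (φ := (algebraMap S (he.FunDual S)).comp (algebraMap R S))
      (φ' := ψ.comp (algebraMap R S)) (IsChar.eval he hκ)
      (by rw [← RingHom.comp_assoc, IsChar.eval_comp_algebraMap]) (FunDual.univ he S b) = α := by
  refine charApp_ext fun T' _ ψ' x => ?_
  rw [hα]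
  refine he.charVal_congr _ _
    (fun i => IsChar.eval_dualBasis he hκ i) ψ' x _ ?_
  exact ((he.lift_naturality (RingHom.id T') _ x).trans (RingHom.id_comp _)).symm

/-- An `S`-point of the bidual is determined by its value on the universal character. -/
theorem bidual_app {β : Hom (G.cartierDual.baseChange (algebraMap R S)) (Gm S)} {τ : he.FunDual S}
    (hτ : unitVal (β.app (he.FunDual S) (algebraMap S (he.FunDual S)) (FunDual.univ he S b)) = τ)
    {T : Type u} [CommRing T] {ψ : S →+* T}
    (α : Hom (G.baseChange (ψ.comp (algebraMap R S))) (Gm T)) {κ : I → T}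
    (hα : ∀ (T' : Type u) [CommRing T'] (ψ' : T →+* T')
      (x : G.obj T' (ψ'.comp (ψ.comp (algebraMap R S)))), charApp α ψ' x = he.charVal b κ ψ' x) :
    unitVal (T := T) (β.app T ψ α) = ∑ i, ψ (FunDual.form he τ (b i)) * κ i := by
  have hκ := he.isChar_of_charApp α hα
  have h1 := he.cartierDual_map_univ α hκ hα
  have h2 := β.naturality (φ := algebraMap S (he.FunDual S)) (φ' := ψ) (IsChar.eval he hκ)
    (IsChar.eval_comp_algebraMap he hκ) (FunDual.univ he S b)
  refine (congrArg (fun α => unitVal (T := T) (β.app T ψ α)) h1).symm.trans ?_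
  refine (congrArg (unitVal (T := T)) h2).trans ?_
  rw [← hτ]
  rfl

variable (S) in
theorem unitVal_biduality (x : G.obj S (algebraMap R S)) {T : Type u} [CommRing T] (ψ : S →+* T)
    (α : Hom (G.baseChange (ψ.comp (algebraMap R S))) (Gm T)) :
    unitVal (T := T) (((G.biduality.app S (algebraMap R S) x : Hom _ _)).app T ψ α) =
      charApp α (RingHom.id T) (G.map ψ rfl x) := rfl

/-- The value of the bidual point of `x` on the universal character is an element of `FunDual`; as a
linear form on `A` it is the homomorphism classifying `x`. -/
theorem biduality_injective (he : G.IsUniversal e) (b : Module.Basis I R A) :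
    Function.Injective (G.biduality.app S (algebraMap R S)) := by
  classical
  intro x y hxy
  have h : ∀ z : G.obj S (algebraMap R S), ∀ i, FunDual.form he
      (charApp (FunDual.univ he S b) (RingHom.id _)
        (G.map (algebraMap S (he.FunDual S)) rfl z)) (b i) = he.lift z (b i) := by
    intro z i
    rw [FunDual.univ, IsChar.charApp_toHom, charVal, FunDual.form_sum]
    have h1 : ∀ j, FunDual.form he ((RingHom.id _) (FunDual.dualBasis he S b j) *
        he.lift (G.map (algebraMap S (he.FunDual S)) rfl z) (b j)) (b i) =
        he.lift z (b j) * if j = i then 1 else 0 := by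
      intro j
      rw [he.lift_naturality, mul_comm, RingHom.comp_apply, FunDual.form_algebraMap_mul,
        RingHom.id_apply, FunDual.form_dualBasis]
    refine (Finset.sum_congr rfl fun j _ => h1 j).trans ?_
    simp
  apply he.lift_injective
  have h2 : he.liftₐ x = he.liftₐ y := by
    apply AlgHom.toLinearMap_injective
    refine b.ext fun i => ?_
    have h3 := congrArg (fun β : Hom (G.cartierDual.baseChange (algebraMap R S)) (Gm S) =>
      FunDual.form he (unitVal (β.app (he.FunDual S) (algebraMap S (he.FunDual S))
        (FunDual.univ he S b))) (b i)) hxy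
    exact ((h x i).symm.trans h3).trans (h y i)
  exact congrArg (fun f : A →ₐ[R] S => (f : A →+* S)) h2

theorem sum_coords_mul {S C D : Type*} [CommRing S] [CommRing C] [CommRing D] (f : S →+* C)
    (g : C →+* D) (u : I → C) (v : I → D) (t : I → S) (m : I → I → I → S) :
    ∑ k, g (f (t k)) * ∑ i, ∑ j, g (f (m i j k)) * (g (u i) * v j) =
      ∑ i, ∑ j, g (f (∑ k, m i j k * t k) * u i) * v j := by
  simp only [Finset.mul_sum]
  rw [Finset.sum_comm]
  refine Finset.sum_congr rfl fun i _ => ?_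
  rw [Finset.sum_comm]
  refine Finset.sum_congr rfl fun j _ => ?_
  rw [map_sum, Finset.sum_mul, map_sum, Finset.sum_mul]
  refine Finset.sum_congr rfl fun k _ => ?_
  simp only [map_mul]
  ring

theorem sum_mul_sum_coords {S C D : Type*} [CommRing S] [CommRing C] [CommRing D] (f : S →+* C)
    (g : C →+* D) (u : I → C) (v : I → D) (t t' : I → S) :
    (∑ i, g (f (t i)) * g (u i)) * ∑ j, g (f (t' j)) * v j =
      ∑ i, ∑ j, g (f (t i * t' j) * u i) * v j := by
  rw [Finset.sum_mul_sum]
  refine Finset.sum_congr rfl fun i _ => Finset.sum_congr rfl fun j _ => ?_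
  simp only [map_mul]
  ring

/-- The form of a sum of products of the two sets of universal coordinates. -/
theorem FunDual.form_form_sum [Algebra R (he.FunDual S)] (c : I → I → S) (i j : I) :
    form he (form he (∑ i, ∑ j, algebraMap (he.FunDual S) (he.FunDual (he.FunDual S))
      (algebraMap S (he.FunDual S) (c i j) * dualBasis he S b i) *
        dualBasis he (he.FunDual S) b j) (b j)) (b i) = c i j := by
  classical
  simp only [form_sum, form_algebraMap_mul, form_dualBasis, mul_ite, mul_one, mul_zero,
    Finset.sum_ite_eq', Finset.mem_univ, if_true]

/-- A point `β` of the bidual is determined by its value `τ` on the universal character, which is a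
linear form on `A`. That `β` respects addition of characters makes this form a ring homomorphism,
hence a point of `G`. -/
theorem biduality_surjective (he : G.IsUniversal e) (b : Module.Basis I R A) :
    Function.Surjective (G.biduality.app S (algebraMap R S)) := by
  classical
  intro β
  change Hom (G.cartierDual.baseChange (algebraMap R S)) (Gm S) at β
  obtain ⟨τ, hτ⟩ : ∃ τ : he.FunDual S, unitVal (β.app (he.FunDual S)
    (algebraMap S (he.FunDual S)) (FunDual.univ he S b)) = τ := ⟨_, rfl⟩
  let t : A →ₗ[R] S := FunDual.form he τ
  have hsum : ∀ a, t a = ∑ k, algebraMap R S (b.repr a k) * t (b k) := by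
    intro a
    conv_lhs => rw [← b.sum_repr a, map_sum]
    exact Finset.sum_congr rfl fun k _ => by rw [map_smul, Algebra.smul_def]
  -- The coordinates of `1 ∈ A` are coordinates of the trivial character, on which `β` takes the
  -- value `1`.
  have hone : t 1 = 1 := by
    have h1 := he.bidual_app (b := b) hτ (ψ := RingHom.id S) (α := 0)
      (κ := fun i => algebraMap R S (b.repr 1 i)) fun T' _ ψ' x => by
        have hx : (he.lift x) 1 = 1 := map_one _
        rw [← b.sum_repr (1 : A), map_sum] at hx
        refine Eq.trans hx.symm (Finset.sum_congr rfl fun i _ => ?_)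
        rw [Algebra.smul_def, RingHom.map_mul, ← RingHom.comp_apply (he.lift x), he.lift_comp]
        rfl
    have h2 : unitVal (T := S) (β.app S (RingHom.id S) 0) = 1 :=
      congrArg (unitVal (T := S)) (map_zero (β.app S (RingHom.id S)))
    rw [hsum, ← h2]
    refine Eq.trans ?_ h1.symm
    exact Finset.sum_congr rfl fun i _ => mul_comm _ _
  -- Additivity of `β` is applied to the sum of two independent universal characters, defined over
  -- the iterated convolution algebra.
  have hmul : ∀ i j, t (b i * b j) = t (b i) * t (b j) := by
    intro i j
    letI : Algebra R (he.FunDual S) :=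
      ((algebraMap S (he.FunDual S)).comp (algebraMap R S)).toAlgebra
    let ψ : S →+* (he.FunDual (he.FunDual S)) := (algebraMap (he.FunDual S) (he.FunDual (he.FunDual S))).comp (algebraMap S (he.FunDual S))
    let α₁ : Hom (G.baseChange (ψ.comp (algebraMap R S))) (Gm (he.FunDual (he.FunDual S))) :=
      G.cartierDual.map (φ := (algebraMap S (he.FunDual S)).comp (algebraMap R S)) (algebraMap (he.FunDual S) (he.FunDual (he.FunDual S))) rfl
        (FunDual.univ he S b)
    let α₂ : Hom (G.baseChange (ψ.comp (algebraMap R S))) (Gm (he.FunDual (he.FunDual S))) := FunDual.univ he (he.FunDual S) b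
    let κ₁ : I → (he.FunDual (he.FunDual S)) := fun i => algebraMap (he.FunDual S) (he.FunDual (he.FunDual S)) (FunDual.dualBasis he S b i)
    let κ₂ : I → (he.FunDual (he.FunDual S)) := FunDual.dualBasis he (he.FunDual S) b
    have hα₁ : ∀ (T' : Type u) [CommRing T'] (ψ' : (he.FunDual (he.FunDual S)) →+* T')
        (x : G.obj T' (ψ'.comp (ψ.comp (algebraMap R S)))),
        charApp α₁ ψ' x = he.charVal b κ₁ ψ' x := by
      intro T' _ ψ' x
      exact he.charVal_congr _ _ (fun i => rfl) ψ' x _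
        ((he.lift_naturality (RingHom.id T') _ x).trans (RingHom.id_comp _)).symm
    have hα₂ : ∀ (T' : Type u) [CommRing T'] (ψ' : (he.FunDual (he.FunDual S)) →+* T')
        (x : G.obj T' (ψ'.comp (ψ.comp (algebraMap R S)))),
        charApp α₂ ψ' x = he.charVal b κ₂ ψ' x := fun T' _ ψ' x => rfl
    -- Adding characters multiplies group-like elements, so the structure constants of
    -- multiplication in `A` enter here.
    let κ : I → (he.FunDual (he.FunDual S)) := fun k => ∑ i, ∑ j,
      ψ (algebraMap R S (b.repr (b i * b j) k)) * (κ₁ i * κ₂ j)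
    have hα : ∀ (T' : Type u) [CommRing T'] (ψ' : (he.FunDual (he.FunDual S)) →+* T')
        (x : G.obj T' (ψ'.comp (ψ.comp (algebraMap R S)))),
        charApp (α₁ + α₂) ψ' x = he.charVal b κ ψ' x := by
      intro T' _ ψ' x
      have h1 : charApp (α₁ + α₂) ψ' x = charApp α₁ ψ' x * charApp α₂ ψ' x := rfl
      rw [h1, hα₁, hα₂, charVal, charVal, charVal, Finset.sum_mul_sum]
      have h2 : ∀ k, ψ' (κ k) * he.lift x (b k) = ∑ i, ∑ j, (ψ' (κ₁ i) * ψ' (κ₂ j)) *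
          (ψ' (ψ (algebraMap R S (b.repr (b i * b j) k))) * he.lift x (b k)) := by
        intro k
        simp only [κ, map_sum, Finset.sum_mul, map_mul]
        refine Finset.sum_congr rfl fun i _ => Finset.sum_congr rfl fun j _ => ?_
        ring
      rw [Finset.sum_congr rfl fun k _ => h2 k]
      conv_rhs => rw [Finset.sum_comm]
      refine Finset.sum_congr rfl fun i _ => ?_
      conv_rhs => rw [Finset.sum_comm]
      refine Finset.sum_congr rfl fun j _ => ?_
      have h3 : ∑ k, ψ' (ψ (algebraMap R S (b.repr (b i * b j) k))) * he.lift x (b k) =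
          he.lift x (b i) * he.lift x (b j) := by
        rw [← map_mul (he.lift x)]
        conv_rhs => rw [← b.sum_repr (b i * b j), map_sum]
        refine Finset.sum_congr rfl fun k _ => ?_
        rw [Algebra.smul_def, RingHom.map_mul, ← RingHom.comp_apply (he.lift x), he.lift_comp]
        rfl
      rw [← Finset.mul_sum, h3]
      ring
    have e1 := he.bidual_app (b := b) hτ (ψ := ψ) α₁ hα₁
    have e2 := he.bidual_app (b := b) hτ (ψ := ψ) α₂ hα₂
    have e3 := he.bidual_app (b := b) hτ (ψ := ψ) (α₁ + α₂) hα
    have e4 : unitVal (T := (he.FunDual (he.FunDual S))) (β.app (he.FunDual (he.FunDual S)) ψ (α₁ + α₂)) =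
        unitVal (T := (he.FunDual (he.FunDual S))) (β.app (he.FunDual (he.FunDual S)) ψ α₁) * unitVal (T := (he.FunDual (he.FunDual S))) (β.app (he.FunDual (he.FunDual S)) ψ α₂) :=
      congrArg (unitVal (T := (he.FunDual (he.FunDual S)))) (map_add (β.app (he.FunDual (he.FunDual S)) ψ) α₁ α₂)
    rw [e1, e2, e3] at e4
    have e7 := ((sum_coords_mul (algebraMap S (he.FunDual S))
      (algebraMap (he.FunDual S) (he.FunDual (he.FunDual S))) (FunDual.dualBasis he S b)
      (FunDual.dualBasis he (he.FunDual S) b) (fun k => t (b k))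
      (fun i j k => algebraMap R S (b.repr (b i * b j) k))).symm.trans e4).trans
      (sum_mul_sum_coords _ _ _ _ _ _)
    simp only [← hsum] at e7
    -- The products of the two dual bases are independent over `S`; applying both layers of forms
    -- extracts the coefficient at `(i, j)`.
    have e8 := congrArg (fun z => FunDual.form he (FunDual.form he z (b j)) (b i)) e7
    exact ((FunDual.form_form_sum he (b := b) (fun i j => t (b i * b j)) i j).symm.trans e8).trans
      (FunDual.form_form_sum he (b := b) (fun i j => t (b i) * t (b j)) i j)
  let f : A →ₐ[R] S := AlgHom.ofLinearMap t hone (by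
    have h := LinearMap.ext_iff₂.mp (b.ext fun i => b.ext fun j => hmul i j :
      (LinearMap.mul R A).compr₂ t = (LinearMap.mul R S).compl₁₂ t t)
    exact h)
  have hf : he.lift (G.map (f : A →+* S) f.comp_algebraMap e) = f := he.lift_map _ _
  refine ⟨G.map (f : A →+* S) f.comp_algebraMap e, ?_⟩
  refine Hom.ext (funext fun T => funext fun _ => funext fun ψ => DFunLike.ext _ _ fun α => ?_)
  change Hom (G.baseChange (ψ.comp (algebraMap R S))) (Gm T) at α
  refine Units.ext ?_
  obtain ⟨κ, hκ, hα⟩ := he.exists_coords (b := b) α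
  refine (unitVal_biduality S _ ψ α).trans (Eq.trans ?_
    (he.bidual_app (b := b) hτ (ψ := ψ) α hα).symm)
  rw [hα, charVal]
  refine Finset.sum_congr rfl fun i _ => ?_
  rw [he.lift_naturality, hf, mul_comm]
  rfl

end FunDual

theorem biduality_bijective {R : Type u} [CommRing R] {G : GroupFunctor.{u, v} R} {A : Type u}
    [CommRing A] [Algebra R A] {e : G.obj A (algebraMap R A)} (he : G.IsUniversal e)
    [Module.Free R A] [Module.Finite R A] {S : Type u} [CommRing S] (φ : R →+* S) :
    Function.Bijective (G.biduality.app S φ) := by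
  letI := φ.toAlgebra
  exact ⟨he.biduality_injective (S := S) (Module.Free.chooseBasis R A),
    he.biduality_surjective (S := S) (Module.Free.chooseBasis R A)⟩

end IsUniversal

end GroupFunctor

/-! ### The action of the Dieudonné–Cartier ring on Witt vectors -/

section Action

variable {p : ℕ} [Fact p.Prime] {n : ℕ} {R : Type u} [CommRing R]

namespace DRing

theorem induction {C : DRing p n R → Prop} (hw : ∀ a, C (ofW p n R a)) (hF : C (F p n R))
    (hV : C (V p n R)) (hadd : ∀ x y, C x → C y → C (x + y))
    (hmul : ∀ x y, C x → C y → C (x * y)) (d : DRing p n R) : C d := by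
  obtain ⟨x, rfl⟩ := RingQuot.mkRingHom_surjective (DRel p n R) d
  change C (mk p n R x)
  induction x using FreeAlgebra.induction with
  | grade0 r =>
    have h : mk p n R (algebraMap ℤ _ r) = ofW p n R (r : TruncatedWittVector p n R) := by
      rw [map_intCast]
      exact map_intCast (mk p n R) r
    rw [h]; exact hw _
  | grade1 x =>
    cases x with
    | w a => exact hw a
    | F => exact hF
    | V => exact hV
  | mul a b ha hb => rw [map_mul]; exact hmul _ _ ha hb
  | add a b ha hb => rw [map_add]; exact hadd _ _ ha hb

section Lift

variable {A : Type*} [Ring A] (w : TruncatedWittVector p n R →+* A) (f v : A)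
    (h1 : v ^ n = 0) (h2 : f * v = p) (h3 : ∀ a, f * w a = w (frob p n a) * f)
    (h4 : ∀ a, w a * v = v * w (frob p n a)) (h5 : ∀ a, v * w a * f = w (vers p n a))

theorem lift_ofW (a : TruncatedWittVector p n R) :
    lift p n R w f v h1 h2 h3 h4 h5 (ofW p n R a) = w a := by
  refine (RingQuot.lift_mkRingHom_apply _ _ _).trans ?_
  exact FreeAlgebra.lift_ι_apply _ _

theorem lift_F : lift p n R w f v h1 h2 h3 h4 h5 (F p n R) = f := by
  refine (RingQuot.lift_mkRingHom_apply _ _ _).trans ?_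
  exact FreeAlgebra.lift_ι_apply _ _

theorem lift_V : lift p n R w f v h1 h2 h3 h4 h5 (V p n R) = v := by
  refine (RingQuot.lift_mkRingHom_apply _ _ _).trans ?_
  exact FreeAlgebra.lift_ι_apply _ _

end Lift

variable [Algebra (ZMod p) R]

/-- The defining relations reduce this to `V(1) = p` in `W_n(R)`, which uses characteristic `p`; the
zero ring is treated apart since it has no characteristic `p` structure. -/
theorem V_mul_F : V p n R * F p n R = p := by
  have h := V_mul_ofW_mul_F p n R 1
  have h1 : vers p n (1 : TruncatedWittVector p n R) = p := by
    have h2 := frob_vers p n (natCast_eq_zero p R) (1 : TruncatedWittVector p n R)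
    obtain ⟨X, hX⟩ := WittVector.truncate_surjective p n R 1
    have hc : CharP R p ∨ Subsingleton R := by
      rcases subsingleton_or_nontrivial R with h | h
      · exact Or.inr h
      · exact Or.inl (charP_of_injective_algebraMap (algebraMap (ZMod p) R).injective p)
    rcases hc with hc | hc
    · rw [← map_one (WittVector.truncate (p := p) (R := R) n), vers_truncate]
      rw [← map_one (WittVector.frobenius (p := p) (R := R)), WittVector.verschiebung_frobenius,
        one_mul, map_natCast]
    · ext i
      exact Subsingleton.elim _ _
  rw [h1, map_natCast, map_one, mul_one] at h
  exact h

variable (p n R)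

/-- The endomorphism of `𝔇_{n,R}` with `F ↦ F`, `V ↦ V`, `a ↦ F(a)`. -/
noncomputable def sigma : DRing p n R →+* DRing p n R :=
  have h0 := natCast_eq_zero p R
  lift p n R ((ofW p n R).comp (frobHom p n h0)) (F p n R) (V p n R) (V_pow p n R) (F_mul_V p n R)
    (fun a => F_mul_ofW p n R _) (fun a => ofW_mul_V p n R _) (fun a => by
      change V p n R * ofW p n R (frob p n a) * F p n R = ofW p n R (frob p n (vers p n a))
      rw [← ofW_mul_V, mul_assoc, V_mul_F, frob_vers p n h0, map_mul, map_natCast, Nat.cast_comm])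

theorem sigma_ofW (a : TruncatedWittVector p n R) :
    sigma p n R (ofW p n R a) = ofW p n R (frob p n a) := by
  unfold sigma
  exact lift_ofW _ _ _ _ _ _ _ _ _

theorem sigma_F : sigma p n R (F p n R) = F p n R := by
  unfold sigma
  exact lift_F _ _ _ _ _ _ _ _

theorem sigma_V : sigma p n R (V p n R) = V p n R := by
  unfold sigma
  exact lift_V _ _ _ _ _ _ _ _

variable {p n R}

/-- Moving elements past `V` costs only a twist by `sigma`. Consequently `V ^ k 𝔇` is a two-sided
ideal, and the filtration by powers of `V` is compatible with all operators in `𝔇`. -/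
theorem mul_V (d : DRing p n R) : d * V p n R = V p n R * sigma p n R d := by
  induction d using DRing.induction with
  | hw a => rw [sigma_ofW, ofW_mul_V]
  | hF => rw [sigma_F, F_mul_V, V_mul_F]
  | hV => rw [sigma_V]
  | hadd x y hx hy => rw [add_mul, hx, hy, map_add, mul_add]
  | hmul x y hx hy => rw [mul_assoc, hy, ← mul_assoc, hx, map_mul, mul_assoc]

theorem mul_V_pow (d : DRing p n R) (k : ℕ) :
    d * V p n R ^ k = V p n R ^ k * (sigma p n R)^[k] d := by
  induction k generalizing d with
  | zero => simp
  | succ k ih =>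
    rw [pow_succ', ← mul_assoc, mul_V, mul_assoc, ih, ← mul_assoc, Function.iterate_succ_apply]

end DRing

variable [Algebra (ZMod p) R] {S : Type u} [CommRing S]

variable (p) in
theorem natCast_eq_zero_of_ringHom (φ : R →+* S) : (p : S) = 0 := by
  rw [← map_natCast φ, natCast_eq_zero, map_zero]

variable (p n) in
/-- The action of `𝔇_{n,R}` on `W_n(S)`. -/
noncomputable def wact (φ : R →+* S) : DRing p n R →+* AddMonoid.End (TruncatedWittVector p n S) :=
  have hS := natCast_eq_zero_of_ringHom p φ
  DRing.lift p n R
    { toFun := fun a => AddMonoidHom.mulLeft (wittMap p n φ a)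
      map_one' := by ext x : 1; change wittMap p n φ 1 * x = x; rw [map_one, one_mul]
      map_mul' := fun a b => by
        ext x : 1
        change wittMap p n φ (a * b) * x = wittMap p n φ a * (wittMap p n φ b * x)
        rw [map_mul, mul_assoc]
      map_zero' := by ext x : 1; change wittMap p n φ 0 * x = 0; rw [map_zero, zero_mul]
      map_add' := fun a b => by
        ext x : 1
        change wittMap p n φ (a + b) * x = wittMap p n φ a * x + wittMap p n φ b * x
        rw [map_add, add_mul] }
    (frobHom p n hS).toAddMonoidHom (versHom p n)
    (by
      have key : ∀ (k : ℕ) (x : TruncatedWittVector p n S),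
          ((show AddMonoid.End (TruncatedWittVector p n S) from versHom p n) ^ k) x =
            (vers p n)^[k] x := by
        intro k
        induction k with
        | zero => intros; rfl
        | succ k ih =>
          intro x
          rw [pow_succ, Function.iterate_succ_apply]
          exact ih _
      ext x : 1
      exact (key n x).trans (vers_iterate p n x))
    (by
      ext x : 1
      refine (frob_vers p n hS x).trans ?_
      rw [← nsmul_eq_mul]
      rfl)
    (fun a => by
      ext x : 1
      refine (map_mul (frobHom p n hS) (wittMap p n φ a) x).trans ?_
      exact congrArg (· * frob p n x) (wittMap_frob p n φ a).symm)
    (fun a => by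
      ext x : 1
      change wittMap p n φ a * vers p n x = vers p n (wittMap p n φ (frob p n a) * x)
      rw [wittMap_frob, mul_comm, mul_comm (frob p n _), vers_mul_frob p n hS])
    (fun a => by
      ext x : 1
      change vers p n (wittMap p n φ a * frob p n x) = wittMap p n φ (vers p n a) * x
      rw [wittMap_vers, vers_mul_frob p n hS])

theorem wact_ofW (φ : R →+* S) (a : TruncatedWittVector p n R) (x : TruncatedWittVector p n S) :
    wact p n φ (DRing.ofW p n R a) x = wittMap p n φ a * x := by
  unfold wact
  exact DFunLike.congr_fun (DRing.lift_ofW _ _ _ _ _ _ _ _ _) x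

theorem wact_F (φ : R →+* S) (x : TruncatedWittVector p n S) :
    wact p n φ (DRing.F p n R) x = frob p n x := by
  unfold wact
  exact DFunLike.congr_fun (DRing.lift_F _ _ _ _ _ _ _ _) x

theorem wact_V (φ : R →+* S) (x : TruncatedWittVector p n S) :
    wact p n φ (DRing.V p n R) x = vers p n x := by
  unfold wact
  exact DFunLike.congr_fun (DRing.lift_V _ _ _ _ _ _ _ _) x

theorem wact_mul (φ : R →+* S) (d d' : DRing p n R) (x : TruncatedWittVector p n S) :
    wact p n φ (d * d') x = wact p n φ d (wact p n φ d' x) := by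
  rw [map_mul]; rfl

theorem wact_add (φ : R →+* S) (d d' : DRing p n R) (x : TruncatedWittVector p n S) :
    wact p n φ (d + d') x = wact p n φ d x + wact p n φ d' x := by
  rw [map_add]; rfl

theorem wact_V_pow (φ : R →+* S) (k : ℕ) (x : TruncatedWittVector p n S) :
    wact p n φ (DRing.V p n R ^ k) x = (vers p n)^[k] x := by
  induction k generalizing x with
  | zero => rw [pow_zero, map_one]; rfl
  | succ k ih => rw [pow_succ, wact_mul, wact_V, ih, Function.iterate_succ_apply]

theorem wittMap_wact {T : Type u} [CommRing T] (φ : R →+* S) (f : S →+* T) {φ' : R →+* T}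
    (hf : f.comp φ = φ') (d : DRing p n R) (x : TruncatedWittVector p n S) :
    wittMap p n f (wact p n φ d x) = wact p n φ' d (wittMap p n f x) := by
  subst hf
  induction d using DRing.induction generalizing x with
  | hw a => rw [wact_ofW, wact_ofW, map_mul, wittMap_comp]
  | hF => rw [wact_F, wact_F, wittMap_frob]
  | hV => rw [wact_V, wact_V, wittMap_vers]
  | hadd d d' h h' => rw [wact_add, wact_add, map_add, h, h']
  | hmul d d' h h' => rw [wact_mul, wact_mul, h, h']

theorem Hom_smul_val {G : GroupFunctor.{u, v} R} (d : DRing p n R)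
    (f : GroupFunctor.Hom G (GroupFunctor.witt p n R)) {S : Type u} [CommRing S] (φ : R →+* S)
    (x : G.obj S φ) : (d • f).val φ x = wact p n φ d (f.val φ x) := by
  induction d using DRing.induction generalizing f with
  | hw a =>
    rw [wact_ofW]
    have h : (DRing.ofW p n R a • f) = GroupFunctor.wittSMul p n G a f := by
      change GroupFunctor.wittAction p n G _ _ f = _
      unfold GroupFunctor.wittAction
      exact DFunLike.congr_fun (DRing.lift_ofW _ _ _ _ _ _ _ _ _) f
    rw [h]; rfl
  | hF =>
    rw [wact_F]
    have h : (DRing.F p n R • f) = GroupFunctor.wittF p n G (natCast_eq_zero p R) f := by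
      change GroupFunctor.wittAction p n G _ _ f = _
      unfold GroupFunctor.wittAction
      exact DFunLike.congr_fun (DRing.lift_F _ _ _ _ _ _ _ _) f
    rw [h]; rfl
  | hV =>
    rw [wact_V]
    have h : (DRing.V p n R • f) = GroupFunctor.wittV p n G f := by
      change GroupFunctor.wittAction p n G _ _ f = _
      unfold GroupFunctor.wittAction
      exact DFunLike.congr_fun (DRing.lift_V _ _ _ _ _ _ _ _) f
    rw [h]; rfl
  | hadd d d' h h' => rw [add_smul, wact_add, ← h, ← h']; rfl
  | hmul d d' h h' => rw [mul_smul, wact_mul, ← h', h]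

end Action

/-! ### The `V`-filtration on truncated Witt vectors. -/

section Filtration

variable {p : ℕ} [Fact p.Prime] {n : ℕ} {S : Type u} [CommRing S]

theorem vers_iterate_truncate (k : ℕ) (X : WittVector p S) :
    (vers p n)^[k] (WittVector.truncate n X) =
      WittVector.truncate n (WittVector.verschiebung^[k] X) := by
  induction k with
  | zero => rfl
  | succ k ih => rw [Function.iterate_succ_apply', ih, vers_truncate, Function.iterate_succ_apply']

theorem coeff_vers_iterate_of_lt (k : ℕ) (x : TruncatedWittVector p n S) (i : Fin n) (hi : i.1 < k) :
    ((vers p n)^[k] x).coeff i = 0 := by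
  obtain ⟨X, rfl⟩ := WittVector.truncate_surjective p n S x
  rw [vers_iterate_truncate, WittVector.coeff_truncate,
    WittVector.iterate_verschiebung_coeff_eq_zero _ hi]

theorem coeff_vers_iterate_add (k : ℕ) (x : TruncatedWittVector p n S) (i j : Fin n)
    (h : i.1 = j.1 + k) : ((vers p n)^[k] x).coeff i = x.coeff j := by
  obtain ⟨X, rfl⟩ := WittVector.truncate_surjective p n S x
  rw [vers_iterate_truncate, WittVector.coeff_truncate, h, WittVector.iterate_verschiebung_coeff,
    WittVector.coeff_truncate]

theorem WittVector_eq_iterate_verschiebung (k : ℕ) (X : WittVector p S)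
    (h : ∀ i < k, X.coeff i = 0) :
    X = WittVector.verschiebung^[k] (WittVector.mk p fun i => X.coeff (i + k)) := by
  ext i
  rcases lt_or_ge i k with hi | hi
  · rw [h i hi, WittVector.iterate_verschiebung_coeff_eq_zero _ hi]
  · obtain ⟨j, rfl⟩ := Nat.exists_eq_add_of_le' hi
    rw [WittVector.iterate_verschiebung_coeff]
    rfl

theorem exists_vers_iterate (k : ℕ) (x : TruncatedWittVector p n S)
    (h : ∀ i : Fin n, i.1 < k → x.coeff i = 0) : ∃ y, x = (vers p n)^[k] y := by
  refine ⟨WittVector.truncate n (WittVector.mk p fun i => x.out.coeff (i + k)), ?_⟩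
  rw [vers_iterate_truncate]
  conv_lhs => rw [← TruncatedWittVector.truncateFun_out x]
  change WittVector.truncate n x.out = _
  by_cases hk : k ≤ n
  · rw [← WittVector_eq_iterate_verschiebung k]
    intro i hi
    have := TruncatedWittVector.coeff_out x ⟨i, lt_of_lt_of_le hi hk⟩
    exact this.trans (h _ hi)
  · ext i
    have hi : i.1 < k := lt_of_lt_of_le i.2 (not_le.mp hk).le
    rw [WittVector.coeff_truncate, WittVector.coeff_truncate, TruncatedWittVector.coeff_out, h i hi,
      WittVector.iterate_verschiebung_coeff_eq_zero _ hi]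

/-- Split `x` at index `k`. The initial part has support disjoint from everything in `V ^ k W`, so
no carries occur there; the rest is a sum inside `V ^ k W`, whose component `k` is the zeroth
component of a sum of Witt vectors. -/
theorem coeff_add_vers_iterate (k : ℕ) (x y : TruncatedWittVector p n S) (i : Fin n) (hi : i.1 ≤ k) :
    (x + (vers p n)^[k] y).coeff i = x.coeff i + ((vers p n)^[k] y).coeff i := by
  obtain ⟨X, rfl⟩ := WittVector.truncate_surjective p n S x
  obtain ⟨Y, rfl⟩ := WittVector.truncate_surjective p n S y
  rw [vers_iterate_truncate, ← map_add, WittVector.coeff_truncate, WittVector.coeff_truncate,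
    WittVector.coeff_truncate]
  obtain ⟨X', hX'⟩ : ∃ X', WittVector.tail k X = WittVector.verschiebung^[k] X' :=
    ⟨_, WittVector_eq_iterate_verschiebung k _ fun i hi => by
      rw [WittVector.tail, WittVector.select, WittVector.coeff_mk, if_neg (by omega)]⟩
  have hV : ∀ A B : WittVector p S, WittVector.verschiebung^[k] (A + B) =
      WittVector.verschiebung^[k] A + WittVector.verschiebung^[k] B := fun A B => by
    rw [iterate_map_add]
  have hdis : ∀ Z : WittVector p S, (WittVector.init k X + WittVector.verschiebung^[k] Z).coeff i =
      (WittVector.init k X).coeff i + (WittVector.verschiebung^[k] Z).coeff i := fun Z => by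
    apply WittVector.coeff_add_of_disjoint
    intro m
    rcases lt_or_ge m k with hm | hm
    · exact Or.inr (WittVector.iterate_verschiebung_coeff_eq_zero _ hm)
    · left
      rw [WittVector.init, WittVector.select, WittVector.coeff_mk, if_neg (by omega)]
  have hX : X = WittVector.init k X + WittVector.verschiebung^[k] X' := by
    rw [← hX', WittVector.init_add_tail]
  conv_lhs => rw [hX, add_assoc, ← hV, hdis]
  conv_rhs => rw [hX, hdis]
  rw [add_assoc]
  congr 1
  rcases hi.lt_or_eq with h | h
  · simp only [WittVector.iterate_verschiebung_coeff_eq_zero _ h, add_zero]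
  · have h' : (i : ℕ) = 0 + k := by rw [h, zero_add]
    rw [h', WittVector.iterate_verschiebung_coeff, WittVector.iterate_verschiebung_coeff,
      WittVector.iterate_verschiebung_coeff, WittVector.add_coeff_zero]

theorem coeff_zero_mul [NeZero n] (x y : TruncatedWittVector p n S) :
    (x * y).coeff 0 = x.coeff 0 * y.coeff 0 := map_mul (proj p n S) x y

theorem coeff_zero_add [NeZero n] (x y : TruncatedWittVector p n S) :
    (x + y).coeff 0 = x.coeff 0 + y.coeff 0 := map_add (proj p n S) x y

theorem coeff_zero_sum [NeZero n] {ι : Type*} (s : Finset ι) (x : ι → TruncatedWittVector p n S) :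
    (∑ i ∈ s, x i).coeff 0 = ∑ i ∈ s, (x i).coeff 0 := map_sum (proj p n S) x s

theorem coeff_zero_vers [NeZero n] (x : TruncatedWittVector p n S) : (vers p n x).coeff 0 = 0 :=
  coeff_vers_iterate_of_lt 1 x 0 Nat.one_pos

theorem coeff_frob_iterate (k : ℕ) (x : TruncatedWittVector p n S) (i : Fin n) :
    ((frob p n)^[k] x).coeff i = x.coeff i ^ p ^ k := by
  induction k with
  | zero => simp
  | succ k ih =>
    rw [Function.iterate_succ_apply', frob, TruncatedWittVector.coeff_mk, ih, ← pow_mul, pow_succ]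

end Filtration

/-! ### The group scheme of solutions of `F X = δ X` -/

section Sol

open MvPolynomial

variable {p : ℕ} [Fact p.Prime] {n : ℕ} {R : Type u} [CommRing R] [Algebra (ZMod p) R]
  {ι : Type} [Fintype ι] (δ : ι → ι → DRing p n R)

/-- The vector `δ Y`. -/
noncomputable def rhs {S : Type u} [CommRing S] (φ : R →+* S) (Y : ι → TruncatedWittVector p n S)
    (j : ι) : TruncatedWittVector p n S := ∑ i, wact p n φ (δ j i) (Y i)

theorem wittMap_rhs {S T : Type u} [CommRing S] [CommRing T] {φ : R →+* S} {φ' : R →+* T}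
    (f : S →+* T) (hf : f.comp φ = φ') (Y : ι → TruncatedWittVector p n S) (j : ι) :
    wittMap p n f (rhs δ φ Y j) = rhs δ φ' (fun i => wittMap p n f (Y i)) j := by
  simp only [rhs, map_sum, wittMap_wact φ f hf]

theorem rhs_add {S : Type u} [CommRing S] (φ : R →+* S) (Y Z : ι → TruncatedWittVector p n S)
    (j : ι) : rhs δ φ (Y + Z) j = rhs δ φ Y j + rhs δ φ Z j := by
  simp only [rhs, Pi.add_apply, map_add, Finset.sum_add_distrib]

theorem rhs_zero {S : Type u} [CommRing S] (φ : R →+* S) (j : ι) :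
    rhs δ φ (0 : ι → TruncatedWittVector p n S) j = 0 := by
  simp only [rhs, Pi.zero_apply, map_zero, Finset.sum_const_zero]

theorem rhs_neg {S : Type u} [CommRing S] (φ : R →+* S) (Y : ι → TruncatedWittVector p n S)
    (j : ι) : rhs δ φ (-Y) j = -rhs δ φ Y j := by
  simp only [rhs, Pi.neg_apply, map_neg, Finset.sum_neg_distrib]

/-- Moving `V ^ k` to the left of the matrix twists its entries. Hence `V ^ k` relates the solutions
for the twisted matrix to those for `δ`. -/
theorem rhs_vers_iterate {S : Type u} [CommRing S] (φ : R →+* S) (k : ℕ)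
    (Y : ι → TruncatedWittVector p n S) (j : ι) :
    rhs δ φ (fun i => (vers p n)^[k] (Y i)) j =
      (vers p n)^[k] (rhs (fun j i => (DRing.sigma p n R)^[k] (δ j i)) φ Y j) := by
  have h : ∀ x : TruncatedWittVector p n S, (vers p n)^[k] x =
      wact p n φ (DRing.V p n R ^ k) x := fun x => (wact_V_pow φ k x).symm
  simp only [rhs, h, map_sum, ← wact_mul, DRing.mul_V_pow]

/-- The solutions of `F X = δ X` in Witt vectors. -/
noncomputable def solPoints {S : Type u} [CommRing S] (φ : R →+* S) :
    AddSubgroup (ι → TruncatedWittVector p n S) where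
  carrier := {X | ∀ j, frob p n (X j) = rhs δ φ X j}
  zero_mem' j := (map_zero (frobHom p n (natCast_eq_zero_of_ringHom p φ))).trans
    (rhs_zero δ φ j).symm
  add_mem' {X Y} hX hY j := by
    rw [rhs_add, ← hX j, ← hY j]
    exact map_add (frobHom p n (natCast_eq_zero_of_ringHom p φ)) (X j) (Y j)
  neg_mem' {X} hX j := by
    rw [rhs_neg, ← hX j]
    exact map_neg (frobHom p n (natCast_eq_zero_of_ringHom p φ)) (X j)

theorem wittMap_mem_solPoints {S T : Type u} [CommRing S] [CommRing T] {φ : R →+* S}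
    {φ' : R →+* T} (f : S →+* T) (hf : f.comp φ = φ') {X : ι → TruncatedWittVector p n S}
    (hX : X ∈ solPoints δ φ) : (fun i => wittMap p n f (X i)) ∈ solPoints δ φ' := fun j => by
  rw [← wittMap_rhs δ f hf, ← wittMap_frob, hX j]

/-- The group scheme of solutions of `F X = δ X`. -/
noncomputable abbrev sol : GroupFunctor.{u, u} R where
  obj _ _ φ := solPoints δ φ
  addCommGroup _ _ _ := inferInstance
  map {_ _} _ _ {_ _} f hf :=
    { toFun := fun X => ⟨fun i => wittMap p n f (X.1 i), wittMap_mem_solPoints δ f hf X.2⟩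
      map_zero' := Subtype.ext (funext fun _ => map_zero (wittMap p n f))
      map_add' := fun X Y => Subtype.ext (funext fun i => map_add (wittMap p n f) (X.1 i) (Y.1 i)) }
  map_id _ X := Subtype.ext (funext fun i => wittMap_id p n (X.1 i))
  map_map f _ g _ X := Subtype.ext (funext fun i => (wittMap_comp p n f g (X.1 i)).symm)

variable (p n R ι) in
/-- The generic vector. -/
noncomputable def gen (i : ι) : TruncatedWittVector p n (MvPolynomial (ι × Fin n) R) :=
  TruncatedWittVector.mk p fun k => X (i, k)

theorem coeff_gen (i : ι) (k : Fin n) : (gen p n R ι i).coeff k = X (i, k) :=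
  TruncatedWittVector.coeff_mk _ _

/-- Evaluation of polynomials at the components of a vector. -/
noncomputable def evalHom {S : Type u} [CommRing S] (φ : R →+* S)
    (Y : ι → TruncatedWittVector p n S) : MvPolynomial (ι × Fin n) R →+* S :=
  eval₂Hom φ fun ik => (Y ik.1).coeff ik.2

theorem evalHom_C {S : Type u} [CommRing S] (φ : R →+* S) (Y : ι → TruncatedWittVector p n S)
    (r : R) : evalHom φ Y (C r) = φ r := eval₂Hom_C _ _ _

theorem evalHom_comp_C {S : Type u} [CommRing S] (φ : R →+* S)
    (Y : ι → TruncatedWittVector p n S) : (evalHom φ Y).comp C = φ :=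
  RingHom.ext (evalHom_C φ Y)

theorem evalHom_X {S : Type u} [CommRing S] (φ : R →+* S) (Y : ι → TruncatedWittVector p n S)
    (ik : ι × Fin n) : evalHom φ Y (X ik) = (Y ik.1).coeff ik.2 := eval₂Hom_X' _ _ _

theorem wittMap_evalHom_gen {S : Type u} [CommRing S] (φ : R →+* S)
    (Y : ι → TruncatedWittVector p n S) (i : ι) : wittMap p n (evalHom φ Y) (gen p n R ι i) = Y i := by
  ext k
  rw [coeff_wittMap, coeff_gen, evalHom_X]

/-- The components of `δ X` for the generic vector `X`. -/
noncomputable def relPoly (jk : ι × Fin n) : MvPolynomial (ι × Fin n) R :=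
  (rhs δ C (gen p n R ι) jk.1).coeff jk.2

theorem evalHom_relPoly {S : Type u} [CommRing S] (φ : R →+* S) (Y : ι → TruncatedWittVector p n S)
    (jk : ι × Fin n) : evalHom φ Y (relPoly δ jk) = (rhs δ φ Y jk.1).coeff jk.2 := by
  rw [relPoly, ← coeff_wittMap, wittMap_rhs δ _ (evalHom_comp_C φ Y)]
  simp only [wittMap_evalHom_gen]

theorem mem_solPoints_iff {S : Type u} [CommRing S] {φ : R →+* S}
    {Y : ι → TruncatedWittVector p n S} :
    Y ∈ solPoints δ φ ↔ ∀ jk, evalHom φ Y (X jk ^ p - relPoly δ jk) = 0 := by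
  simp only [map_sub, map_pow, evalHom_X, evalHom_relPoly, sub_eq_zero]
  constructor
  · intro h jk
    rw [← h jk.1, frob, TruncatedWittVector.coeff_mk]
  · intro h j
    ext k
    rw [← h (j, k), frob, TruncatedWittVector.coeff_mk]

/-- The coordinate ring of `sol δ`. -/
abbrev SolRing : Type u := RelQuot p (relPoly δ)

/-- The universal solution. -/
noncomputable def solGen (i : ι) : TruncatedWittVector p n (SolRing δ) :=
  wittMap p n (Ideal.Quotient.mk _) (gen p n R ι i)

theorem evalHom_solGen : evalHom (algebraMap R (SolRing δ)) (solGen δ) =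
    Ideal.Quotient.mk (relIdeal p (relPoly δ)) := by
  refine MvPolynomial.ringHom_ext (fun r => ?_) fun ik => ?_
  · rw [evalHom_C]; rfl
  · rw [evalHom_X, solGen, coeff_wittMap, coeff_gen]

theorem solGen_mem : solGen δ ∈ solPoints δ (algebraMap R (SolRing δ)) := by
  rw [mem_solPoints_iff]
  intro jk
  rw [evalHom_solGen, Ideal.Quotient.eq_zero_iff_mem]
  exact Ideal.subset_span ⟨jk, rfl⟩

theorem relIdeal_le_ker {S : Type u} [CommRing S] {φ : R →+* S} {Y : ι → TruncatedWittVector p n S}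
    (hY : Y ∈ solPoints δ φ) : ∀ f ∈ relIdeal p (relPoly δ), evalHom φ Y f = 0 := by
  have h : relIdeal p (relPoly δ) ≤ RingHom.ker (evalHom φ Y) := by
    refine Ideal.span_le.mpr ?_
    rintro _ ⟨jk, rfl⟩
    exact (mem_solPoints_iff δ).mp hY jk
  exact fun f hf => h hf

theorem isUniversal_sol : (sol δ).IsUniversal
    (⟨solGen δ, solGen_mem δ⟩ : (sol δ).obj (SolRing δ) (algebraMap R (SolRing δ))) := by
  intro S _ φ Y
  have hc : (Ideal.Quotient.lift _ (evalHom φ Y.1) (relIdeal_le_ker δ Y.2)).comp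
      (algebraMap R (SolRing δ)) = φ := by
    ext r
    refine Eq.trans ?_ (evalHom_C φ Y.1 r)
    exact Ideal.Quotient.lift_mk (relIdeal p (relPoly δ)) (evalHom φ Y.1) (relIdeal_le_ker δ Y.2)
  refine ⟨Ideal.Quotient.lift _ (evalHom φ Y.1) (relIdeal_le_ker δ Y.2), ⟨hc, ?_⟩, ?_⟩
  · refine Subtype.ext (funext fun i => ?_)
    change wittMap p n _ (wittMap p n _ _) = Y.1 i
    rw [← wittMap_comp, Ideal.Quotient.lift_comp_mk, wittMap_evalHom_gen]
  · rintro f ⟨hf, hfe⟩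
    refine Ideal.Quotient.ringHom_ext (MvPolynomial.ringHom_ext (fun r => ?_) fun ik => ?_)
    · rw [Ideal.Quotient.lift_comp_mk, evalHom_C, ← hf]; rfl
    · rw [Ideal.Quotient.lift_comp_mk, evalHom_X, ← hfe]
      change _ = (wittMap p n f (wittMap p n _ (gen p n R ι ik.1))).coeff ik.2
      rw [coeff_wittMap, coeff_wittMap, coeff_gen]
      rfl

/-! #### The shape of the relations -/

variable [NeZero n]

/-- Every entry is the sum of an element of `W_n(R)` and an element of `V 𝔇`. -/
def IsVShape (δ : ι → ι → DRing p n R) (α : ι → ι → TruncatedWittVector p n R) : Prop :=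
  ∀ j i, ∃ d, δ j i = DRing.ofW p n R (α j i) + DRing.V p n R * d

variable {δ} {α : ι → ι → TruncatedWittVector p n R}

theorem IsVShape.coeff_zero_rhs (hδ : IsVShape δ α) {S : Type u} [CommRing S] (φ : R →+* S)
    (Y : ι → TruncatedWittVector p n S) (j : ι) :
    (rhs δ φ Y j).coeff 0 = ∑ i, φ ((α j i).coeff 0) * (Y i).coeff 0 := by
  rw [rhs, coeff_zero_sum]
  refine Finset.sum_congr rfl fun i _ => ?_
  obtain ⟨d, hd⟩ := hδ j i
  rw [hd, wact_add, coeff_zero_add, wact_ofW, coeff_zero_mul, coeff_wittMap, wact_mul, wact_V,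
    coeff_zero_vers, add_zero]

theorem IsVShape.sigma_iterate (hδ : IsVShape δ α) (k : ℕ) :
    IsVShape (fun j i => (DRing.sigma p n R)^[k] (δ j i)) fun j i => (frob p n)^[k] (α j i) := by
  induction k with
  | zero => exact hδ
  | succ k ih =>
    intro j i
    obtain ⟨d, hd⟩ := ih j i
    refine ⟨DRing.sigma p n R d, ?_⟩
    simp only [Function.iterate_succ_apply', hd, map_add, map_mul, DRing.sigma_V, DRing.sigma_ofW]

variable (p n) in
/-- Replace the components of index at least `k` by zero. -/
noncomputable def cut {S : Type*} [CommRing S] (k : ℕ) (x : TruncatedWittVector p n S) :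
    TruncatedWittVector p n S :=
  TruncatedWittVector.mk p fun i => if i.1 < k then x.coeff i else 0

theorem coeff_cut {S : Type*} [CommRing S] (k : ℕ) (x : TruncatedWittVector p n S) (i : Fin n) :
    (cut p n k x).coeff i = if i.1 < k then x.coeff i else 0 := TruncatedWittVector.coeff_mk _ _

theorem exists_eq_cut_add {S : Type*} [CommRing S] (k : ℕ) (x : TruncatedWittVector p n S) :
    ∃ y, x = cut p n k x + (vers p n)^[k] y := by
  obtain ⟨X, rfl⟩ := WittVector.truncate_surjective p n S x
  refine ⟨WittVector.truncate n (WittVector.mk p fun i => (WittVector.tail k X).coeff (i + k)), ?_⟩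
  rw [vers_iterate_truncate, ← WittVector_eq_iterate_verschiebung]
  · have h : cut p n k (WittVector.truncate n X) = WittVector.truncate n (WittVector.init k X) := by
      ext i
      rw [coeff_cut, WittVector.coeff_truncate, WittVector.coeff_truncate, WittVector.init,
        WittVector.select, WittVector.coeff_mk]
      split_ifs <;> rfl
    rw [h, ← map_add, WittVector.init_add_tail]
  · intro i hi
    rw [WittVector.tail, WittVector.select, WittVector.coeff_mk, if_neg (by omega)]

/-- Write `Y` as its part below level `k` plus `V ^ k U`. Then `δ V ^ k U = V ^ k σ^k(δ) U`
contributes the zeroth component of `σ^k(δ) U`, which depends only on the `W_n(R)`-parts of the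
entries and on the zeroth components of `U`, that is, the level `k` components of `Y`. -/
theorem IsVShape.coeff_rhs (hδ : IsVShape δ α) {S : Type u} [CommRing S] (φ : R →+* S)
    (Y : ι → TruncatedWittVector p n S) (j : ι) (k : Fin n) :
    (rhs δ φ Y j).coeff k = (rhs δ φ (fun i => cut p n k (Y i)) j).coeff k +
      ∑ i, φ ((α j i).coeff 0 ^ p ^ k.1) * (Y i).coeff k := by
  choose U hU using fun i => exists_eq_cut_add k.1 (Y i)
  have h1 : Y = (fun i => cut p n k (Y i)) + fun i => (vers p n)^[k] (U i) := funext hU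
  conv_lhs => rw [h1]
  rw [rhs_add, rhs_vers_iterate, coeff_add_vers_iterate _ _ _ _ le_rfl,
    coeff_vers_iterate_add k.1 _ k 0 (by simp), (hδ.sigma_iterate k.1).coeff_zero_rhs]
  congr 1
  refine Finset.sum_congr rfl fun i _ => ?_
  rw [coeff_frob_iterate]
  conv_rhs => rw [hU i]
  rw [coeff_add_vers_iterate _ _ _ _ le_rfl, coeff_vers_iterate_add k.1 _ k 0 (by simp), coeff_cut,
    if_neg (lt_irrefl _), zero_add]

/-- The multidegree of a monomial, where the variables are graded by their level. -/
noncomputable def levelDeg (ι : Type) [Fintype ι] (n : ℕ) :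
    (ι × Fin n →₀ ℕ) →+ Lex ((Fin n)ᵒᵈ → ℕ) where
  -- Dualizing the order on levels makes the highest level decisive in the lexicographic comparison.
  toFun e := toLex fun k => ∑ i, e (i, OrderDual.ofDual k)
  map_zero' := by simp only [Finsupp.coe_zero, Pi.zero_apply, Finset.sum_const_zero]; rfl
  map_add' e f := by
    simp only [Finsupp.coe_add, Pi.add_apply, Finset.sum_add_distrib]; rfl

theorem levelDeg_lt {e f : ι × Fin n →₀ ℕ} (k : Fin n)
    (h : ∀ k', k < k' → ∑ i, e (i, k') = ∑ i, f (i, k')) (hk : ∑ i, e (i, k) < ∑ i, f (i, k)) :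
    levelDeg ι n e < levelDeg ι n f :=
  ⟨OrderDual.toDual k, fun k' hk' => h (OrderDual.ofDual k') hk', hk⟩

theorem exists_relPoly_eq (hδ : IsVShape δ α) (jk : ι × Fin n) :
    ∃ q ∈ supported R {ik : ι × Fin n | ik.2 < jk.2}, relPoly δ jk =
      q + ∑ i, C ((α jk.1 i).coeff 0 ^ p ^ jk.2.1) * X (i, jk.2) := by
  -- The lower part is the relation evaluated at the generic vector with its components from level
  -- `k` on removed.
  refine ⟨evalHom C (fun i => cut p n jk.2.1 (gen p n R ι i)) (relPoly δ jk), ?_, ?_⟩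
  · induction relPoly δ jk using MvPolynomial.induction_on with
    | C a => rw [evalHom_C]; exact Subalgebra.algebraMap_mem _ a
    | add f g hf hg => rw [map_add]; exact Subalgebra.add_mem _ hf hg
    | mul_X f i hf =>
      rw [map_mul]
      refine Subalgebra.mul_mem _ hf ?_
      rw [evalHom_X, coeff_cut, coeff_gen]
      split_ifs with h
      · exact Algebra.subset_adjoin ⟨i, h, rfl⟩
      · exact Subalgebra.zero_mem _
  · rw [evalHom_relPoly]
    conv_lhs => rw [relPoly, hδ.coeff_rhs]
    simp only [coeff_gen]

/-- At level `k` the leading monomial `X_(j,k) ^ p` has degree `p`, whereas the terms of the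
relation have degree `0` or `1` there, and nothing of higher level occurs. -/
theorem relPoly_mem_lowPoly (hδ : IsVShape δ α) (jk : ι × Fin n) :
    relPoly δ jk ∈ lowPoly (levelDeg ι n) R (levelDeg ι n (Finsupp.single jk p)) := by
  classical
  have hp : 1 < p := (Fact.out : p.Prime).one_lt
  obtain ⟨j, k⟩ := jk
  obtain ⟨q, hq, h⟩ := exists_relPoly_eq hδ (j, k)
  have hs : ∀ i k', ∑ i', (Finsupp.single (i, k) 1 : ι × Fin n →₀ ℕ) (i', k') =
      if k = k' then 1 else 0 := fun i k' => by
    simp [Finsupp.single_apply, Prod.ext_iff, ite_and]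
  have hs' : ∀ k', ∑ i', (Finsupp.single (j, k) p : ι × Fin n →₀ ℕ) (i', k') =
      if k = k' then p else 0 := fun k' => by
    simp [Finsupp.single_apply, Prod.ext_iff, ite_and]
  rw [h]
  refine Submodule.add_mem _ ?_ (Submodule.sum_mem _ fun i _ => ?_)
  · rw [mem_lowPoly]
    intro e he
    have h0 : ∀ i k', k ≤ k' → e (i, k') = 0 := by
      intro i k' hk'
      by_contra hne
      have hv := mem_supported.mp hq (Finset.mem_coe.mpr
        ((mem_vars_iff_mem_support (i, k')).mpr ⟨e, he, Finsupp.mem_support_iff.mpr hne⟩))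
      exact absurd hv (not_lt.mpr hk')
    refine levelDeg_lt k (fun k' hk' => ?_) ?_
    · rw [hs', if_neg hk'.ne]
      exact Finset.sum_eq_zero fun i _ => h0 i k' hk'.le
    · rw [hs', if_pos rfl, Finset.sum_eq_zero fun i _ => h0 i k le_rfl]
      omega
  · rw [C_mul_X_eq_monomial]
    refine monomial_mem_lowPoly _ (levelDeg_lt k (fun k' hk' => ?_) ?_) _
    · rw [hs, hs', if_neg hk'.ne, if_neg hk'.ne]
    · rw [hs, hs', if_pos rfl, if_pos rfl]; exact hp

theorem biduality_sol_bijective (hδ : IsVShape δ α) {S : Type u} [CommRing S] (φ : R →+* S) :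
    Function.Bijective ((sol δ).biduality.app S φ) := by
  have hp : 0 < p := (Fact.out : p.Prime).pos
  haveI := free_relQuot hp (relPoly_mem_lowPoly hδ)
  haveI := finite_relQuot hp (relPoly_mem_lowPoly hδ)
  exact (isUniversal_sol δ).biduality_bijective φ

end Sol

/-! ### Substitutions, degrees and derivatives -/

section Subst

open MvPolynomial

variable {R I J : Type*} [CommRing R]

theorem degreeOf_X_le_ite {i j : I} {P : Prop} [Decidable P] (h : i = j → P) :
    degreeOf i (X j : MvPolynomial I R) ≤ if P then 1 else 0 := by
  classical
  rcases subsingleton_or_nontrivial R with _ | _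
  · rw [Subsingleton.elim (X j : MvPolynomial I R) 0, degreeOf_zero]; exact Nat.zero_le _
  · rw [degreeOf_X]
    split_ifs with h1 h2
    exacts [le_rfl, absurd (h h1) h2, Nat.zero_le _, le_rfl]

theorem mem_restrictDegree_iff_degreeOf {f : MvPolynomial I R} {d : ℕ} :
    f ∈ restrictDegree I R d ↔ ∀ i, degreeOf i f ≤ d := by
  simp only [mem_restrictDegree, degreeOf_le_iff]
  exact ⟨fun h i s hs => h s hs i, fun h s hs i => h i s hs⟩

/-- Substitutions in which each variable occurs in at most one place, and linearly, do not
increase partial degrees. -/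
theorem aeval_mem_restrictDegree [DecidableEq I] (g : I → MvPolynomial J R) (π : J → I)
    (h : ∀ v i, degreeOf v (g i) ≤ if i = π v then 1 else 0) {d : ℕ} {f : MvPolynomial I R}
    (hf : f ∈ restrictDegree I R d) : aeval g f ∈ restrictDegree J R d := by
  rw [mem_restrictDegree_iff_degreeOf]
  intro v
  rw [aeval_def, eval₂_eq]
  refine (degreeOf_sum_le _ _ _).trans (Finset.sup_le fun e he => ?_)
  refine (degreeOf_C_mul_le _ _ _).trans ((degreeOf_prod_le _ _ _).trans ?_)
  refine le_trans (b := ∑ i ∈ e.support, if i = π v then e i else 0)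
    (Finset.sum_le_sum fun i _ => ?_) ?_
  · refine (degreeOf_pow_le _ _ _).trans ?_
    refine (Nat.mul_le_mul_left _ (h v i)).trans ?_
    split_ifs <;> simp
  · rw [Finset.sum_ite_eq']
    split_ifs
    · exact (mem_restrictDegree _ f d).mp hf e he _
    · exact Nat.zero_le _

theorem aeval_mem_supported (g : I → MvPolynomial J R) {s : Set J} (h : ∀ i, g i ∈ supported R s)
    (f : MvPolynomial I R) : aeval g f ∈ supported R s := by
  induction f using MvPolynomial.induction_on with
  | C a => rw [aeval_C]; exact Subalgebra.algebraMap_mem _ a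
  | add f g hf hg => rw [map_add]; exact Subalgebra.add_mem _ hf hg
  | mul_X f i hf => rw [map_mul, aeval_X]; exact Subalgebra.mul_mem _ hf (h i)

/-- The chain rule, followed by a homomorphism `κ` that will set part of the variables to zero. -/
theorem map_pderiv_aeval [Fintype I] {B : Type*} [CommRing B] [Algebra R B]
    (g : I → MvPolynomial J R) (κ : MvPolynomial J R →ₐ[R] B) (v : J) (f : MvPolynomial I R) :
    κ (pderiv v (aeval g f)) = ∑ i, κ (aeval g (pderiv i f)) * κ (pderiv v (g i)) := by
  classical
  induction f using MvPolynomial.induction_on with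
  | C a => simp
  | add f g hf hg => simp only [map_add, hf, hg, add_mul, Finset.sum_add_distrib]
  | mul_X f i hf =>
    simp only [map_mul, aeval_X, pderiv_mul, map_add, hf, add_mul, Finset.sum_add_distrib]
    congr 1
    · rw [Finset.sum_mul]
      exact Finset.sum_congr rfl fun _ _ => by ring
    · rw [Finset.sum_eq_single i]
      · rw [pderiv_X_self, map_one, map_one, mul_one]
      · intro j _ hj
        rw [pderiv_X_of_ne hj.symm]; simp
      · intro h; exact absurd (Finset.mem_univ i) h

theorem aeval_aeval_of_forall_eq_zero {B : Type*} [CommRing B] [Algebra R B]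
    (g : I → MvPolynomial J R) (κ : MvPolynomial J R →ₐ[R] B) (h : ∀ i, κ (g i) = 0)
    (f : MvPolynomial I R) : κ (aeval g f) = algebraMap R B (constantCoeff f) := by
  rw [← AlgHom.comp_apply, comp_aeval]
  have h0 : (fun i => κ (g i)) = 0 := funext h
  rw [h0, aeval_zero]

/-- In a reduced polynomial the positive exponents are less than `p`, hence units in `R`, so
differentiation loses no monomial containing `v`. -/
theorem eq_of_pderiv_eq_C {p : ℕ} [Fact p.Prime] [Algebra (ZMod p) R] {f : MvPolynomial I R}
    (hf : f ∈ restrictDegree I R (p - 1)) {v : I} {s : R} (h : pderiv v f = C s) {e : I →₀ ℕ}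
    (he : e v ≠ 0) (hne : e ≠ Finsupp.single v 1) : coeff e f = 0 := by
  classical
  by_contra hc
  have hle := (mem_restrictDegree _ f _).mp hf e (mem_support_iff.mpr hc) v
  have h1 := coeff_pderiv (i := v) f (e - Finsupp.single v 1)
  have h2 : e - Finsupp.single v 1 + Finsupp.single v 1 = e :=
    tsub_add_cancel_of_le (Finsupp.single_le_iff.mpr (Nat.one_le_iff_ne_zero.mpr he))
  have h3 : (0 : I →₀ ℕ) ≠ e - Finsupp.single v 1 := fun h0 => hne (by
    rw [← h2, ← h0, zero_add])
  rw [h2, h, coeff_C, if_neg h3] at h1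
  have h4 : (((e - Finsupp.single v 1 : I →₀ ℕ) v : ℕ) : R) + 1 = (e v : R) := by
    rw [Finsupp.tsub_apply, Finsupp.single_eq_same, ← Nat.cast_add_one, Nat.sub_add_cancel
      (Nat.one_le_iff_ne_zero.mpr he)]
  rw [h4] at h1
  have hu : IsUnit (e v : R) := by
    rw [← map_natCast (algebraMap (ZMod p) R)]
    refine IsUnit.map _ (isUnit_iff_ne_zero.mpr fun h0 => ?_)
    rw [ZMod.natCast_eq_zero_iff] at h0
    have hp := (Fact.out : p.Prime).pos
    exact absurd (Nat.le_of_dvd (Nat.pos_of_ne_zero he) h0) (by omega)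
  exact hc (hu.mul_left_eq_zero.mp h1.symm)

end Subst

/-! ### The first carry in the addition of Witt vectors -/

section Carry

variable (p : ℕ) [hp : Fact p.Prime]

/-- The polynomial `((x ^ p + y ^ p) - (x + y) ^ p) / p`. -/
def carry {S : Type*} [CommRing S] (x y : S) : S :=
  -∑ k ∈ Finset.Ioo 0 p, x ^ k * y ^ (p - k) * ((p.choose k / p : ℕ) : S)

theorem map_carry {S T : Type*} [CommRing S] [CommRing T] (f : S →+* T) (x y : S) :
    f (carry p x y) = carry p (f x) (f y) := by
  simp only [carry, map_neg, map_sum, map_mul, map_pow, map_natCast]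

/-- Over a polynomial ring over `ℤ` one may compare first ghost components and cancel `p`; the
general case is a specialization of the generic one. -/
theorem WittVector_coeff_one_add {S : Type*} [CommRing S] (x y : WittVector p S) :
    (x + y).coeff 1 = x.coeff 1 + y.coeff 1 + carry p (x.coeff 0) (y.coeff 0) := by
  have key : ∀ a b : WittVector p (MvPolynomial (Fin 2 × ℕ) ℤ),
      (a + b).coeff 1 = a.coeff 1 + b.coeff 1 + carry p (a.coeff 0) (b.coeff 0) := by
    intro a b
    have h := map_add (WittVector.ghostComponent (p := p) (R := MvPolynomial (Fin 2 × ℕ) ℤ) 1) a b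
    have hg : ∀ x : WittVector p (MvPolynomial (Fin 2 × ℕ) ℤ),
        WittVector.ghostComponent 1 x = p * x.coeff 1 + x.coeff 0 ^ p := fun x => by
      rw [WittVector.ghostComponent_apply, wittPolynomial_one]
      simp
    rw [hg, hg, hg, WittVector.add_coeff_zero, add_pow_prime_eq' hp.out] at h
    have hp0 : (p : MvPolynomial (Fin 2 × ℕ) ℤ) ≠ 0 := Nat.cast_ne_zero.mpr hp.out.ne_zero
    refine mul_left_cancel₀ hp0 ?_
    rw [carry]
    linear_combination h
  let g : Fin 2 → WittVector p (MvPolynomial (Fin 2 × ℕ) ℤ) := fun i =>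
    WittVector.mk p fun k => MvPolynomial.X (i, k)
  let f : MvPolynomial (Fin 2 × ℕ) ℤ →+* S :=
    MvPolynomial.eval₂Hom (Int.castRingHom S) fun ik => (![x, y] ik.1).coeff ik.2
  have hf : ∀ i, WittVector.map f (g i) = ![x, y] i := fun i => by
    ext k
    rw [WittVector.map_coeff, WittVector.coeff_mk]
    exact MvPolynomial.eval₂Hom_X' _ _ _
  have hx := hf 0
  have hy := hf 1
  simp only [Matrix.cons_val_zero, Matrix.cons_val_one] at hx hy
  rw [← hx, ← hy, ← map_add, WittVector.map_coeff, key]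
  simp only [WittVector.map_coeff, map_add, map_carry]

variable {p} {n : ℕ}

theorem coeff_one_add {S : Type*} [CommRing S] [NeZero n] (x y : TruncatedWittVector p n S) (i : Fin n)
    (hi : i.1 = 1) :
    (x + y).coeff i = x.coeff i + y.coeff i + carry p (x.coeff 0) (y.coeff 0) := by
  obtain ⟨X, rfl⟩ := WittVector.truncate_surjective p n S x
  obtain ⟨Y, rfl⟩ := WittVector.truncate_surjective p n S y
  rw [← map_add]
  simp only [WittVector.coeff_truncate, hi, Fin.coe_ofNat_eq_mod, Nat.zero_mod, WittVector_coeff_one_add]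

open MvPolynomial in
-- The pure `p`-th powers cancel in the carry, so both exponents in each of its terms lie strictly
-- between `0` and `p`.
theorem carry_mem_restrictDegree {R J : Type*} [CommRing R] {v w : J} (hvw : v ≠ w) :
    carry p (X v : MvPolynomial J R) (X w) ∈ restrictDegree J R (p - 1) := by
  classical
  refine Submodule.neg_mem _ (Submodule.sum_mem _ fun k hk => ?_)
  obtain ⟨h1, h2⟩ := Finset.mem_Ioo.mp hk
  have h : (X v : MvPolynomial J R) ^ k * X w ^ (p - k) * ((p.choose k / p : ℕ) : MvPolynomial J R) =
      monomial (Finsupp.single v k + Finsupp.single w (p - k)) ((p.choose k / p : ℕ) : R) := by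
    rw [X_pow_eq_monomial, X_pow_eq_monomial, monomial_mul, ← map_natCast C, mul_comm,
      C_mul_monomial, one_mul, mul_one]
  rw [h, mem_restrictDegree]
  intro s hs i
  rw [Finset.mem_singleton.mp (support_monomial_subset hs), Finsupp.add_apply,
    Finsupp.single_apply, Finsupp.single_apply]
  split_ifs with h3 h4 h4
  · exact absurd (h3.trans h4.symm) hvw
  all_goals omega

open MvPolynomial in
-- After the second variable is set to zero, only the term linear in it survives; its coefficient is
-- `p.choose (p - 1) / p = 1`.
theorem map_pderiv_carry {R J B : Type*} [CommRing R] [CommRing B] [Algebra R B] {v w : J}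
    (hvw : v ≠ w) (κ : MvPolynomial J R →ₐ[R] B) (hw : κ (X w) = 0) :
    κ (pderiv w (carry p (X v) (X w))) = -κ (X v) ^ (p - 1) := by
  have h1 := hp.out.one_lt
  simp only [carry, map_neg, map_sum]
  congr 1
  rw [Finset.sum_eq_single (p - 1)]
  · have h2 : p - (p - 1) = 1 := by omega
    have h3 : p.choose (p - 1) / p = 1 := by
      rw [Nat.choose_symm_of_eq_add (by omega : p = (p - 1) + 1), Nat.choose_one_right,
        Nat.div_self hp.out.pos]
    rw [h2, h3, pow_one, Nat.cast_one, mul_one, pderiv_mul, pderiv_pow, pderiv_X_of_ne hvw,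
      pderiv_X_self]
    simp
  · intro k hk hne
    obtain ⟨h3, h4⟩ := Finset.mem_Ioo.mp hk
    have h5 : p - k - 1 ≠ 0 := by omega
    rw [← map_natCast C, mul_comm, pderiv_C_mul, pderiv_mul, pderiv_pow, pderiv_pow,
      pderiv_X_of_ne hvw, pderiv_X_self]
    simp [hw, h5]
  · intro h
    exact absurd (Finset.mem_Ioo.mpr ⟨by omega, by omega⟩) h

end Carry

/-! ### Additive functions on the group of solutions -/

section Primitive

open MvPolynomial

variable {p : ℕ} [Fact p.Prime] {n : ℕ} [NeZero n] {R : Type u} [CommRing R] [Algebra (ZMod p) R]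
  {ι : Type} [Fintype ι] {δ : ι → ι → DRing p n R} {α : ι → ι → TruncatedWittVector p n R}

/-- The universal solution is one of the solutions, and reduced polynomials inject into the
coordinate ring. This turns identities on points into identities of polynomials, which can be
differentiated. -/
theorem eq_zero_of_forall_evalHom (hδ : IsVShape δ α) {f : MvPolynomial (ι × Fin n) R}
    (hf : f ∈ restrictDegree (ι × Fin n) R (p - 1))
    (h : ∀ (S : Type u) [CommRing S] (φ : R →+* S), ∀ Y ∈ solPoints δ φ, evalHom φ Y f = 0) :
    f = 0 := by
  refine eq_zero_of_mem_relIdeal (Fact.out : p.Prime).pos (relPoly_mem_lowPoly hδ) hf ?_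
  rw [← Ideal.Quotient.eq_zero_iff_mem, ← evalHom_solGen]
  exact h _ _ _ (solGen_mem δ)

theorem frob_vers_iterate {S : Type u} [CommRing S] (φ : R →+* S) (k : ℕ)
    (x : TruncatedWittVector p n S) :
    frob p n ((vers p n)^[k] x) = (vers p n)^[k] (frob p n x) := by
  have h : ∀ k, (DRing.sigma p n R)^[k] (DRing.F p n R) = DRing.F p n R := fun k => by
    induction k with
    | zero => rfl
    | succ k ih => rw [Function.iterate_succ_apply', ih, DRing.sigma_F]
  rw [← wact_F φ, ← wact_F φ, ← wact_V_pow φ, ← wact_V_pow φ, ← wact_mul, ← wact_mul,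
    DRing.mul_V_pow, h]

theorem vers_iterate_mem_solPoints {S : Type u} [CommRing S] {φ : R →+* S} (k : ℕ)
    {Z : ι → TruncatedWittVector p n S}
    (hZ : Z ∈ solPoints (fun j i => (DRing.sigma p n R)^[k] (δ j i)) φ) :
    (fun i => (vers p n)^[k] (Z i)) ∈ solPoints δ φ := fun j => by
  rw [rhs_vers_iterate, frob_vers_iterate φ, hZ j]

/-- The block diagonal matrix. -/
noncomputable def blk {X : Type*} [Zero X] (δ δ' : ι → ι → X) : ι ⊕ ι → ι ⊕ ι → X :=
  Sum.elim (fun j => Sum.elim (δ j) 0) fun j => Sum.elim 0 (δ' j)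

/-- A pair of solutions is a solution for the block diagonal matrix, so the previous principle also
applies to reduced polynomials in two vectors. -/
theorem isVShape_blk {δ' : ι → ι → DRing p n R} {α' : ι → ι → TruncatedWittVector p n R}
    (hδ : IsVShape δ α) (hδ' : IsVShape δ' α') : IsVShape (blk δ δ') (blk α α') := by
  rintro (j | j) (i | i)
  · exact hδ j i
  · exact ⟨0, by simp [blk]⟩
  · exact ⟨0, by simp [blk]⟩
  · exact hδ' j i

theorem blk_inl_mem {δ' : ι → ι → DRing p n R} {S : Type u} [CommRing S] {φ : R →+* S}
    {Y : ι ⊕ ι → TruncatedWittVector p n S} (hY : Y ∈ solPoints (blk δ δ') φ) :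
    (fun i => Y (Sum.inl i)) ∈ solPoints δ φ := fun j => by
  rw [hY (Sum.inl j), rhs, Fintype.sum_sum_type]
  simp [blk, rhs]

theorem blk_inr_mem {δ' : ι → ι → DRing p n R} {S : Type u} [CommRing S] {φ : R →+* S}
    {Y : ι ⊕ ι → TruncatedWittVector p n S} (hY : Y ∈ solPoints (blk δ δ') φ) :
    (fun i => Y (Sum.inr i)) ∈ solPoints δ' φ := fun j => by
  rw [hY (Sum.inr j), rhs, Fintype.sum_sum_type]
  simp [blk, rhs]

/-- The substitution needs to be correct only on variables allowed in `f`; this permits arbitrary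
choices at the levels that do not occur. -/
theorem evalHom_aeval {κ : Type} [Fintype κ] {S : Type u} [CommRing S] (φ : R →+* S)
    {X : ι → TruncatedWittVector p n S} {Y : κ → TruncatedWittVector p n S} {s : Set (ι × Fin n)}
    {f : MvPolynomial (ι × Fin n) R} (hf : f ∈ supported R s)
    (g : ι × Fin n → MvPolynomial (κ × Fin n) R)
    (h : ∀ ik ∈ s, evalHom φ Y (g ik) = (X ik.1).coeff ik.2) :
    evalHom φ Y (aeval g f) = evalHom φ X f := by
  have h1 : evalHom φ Y (aeval g f) = eval₂Hom φ (fun ik => evalHom φ Y (g ik)) f := by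
    have h2 : (evalHom φ Y).comp (aeval g : MvPolynomial (ι × Fin n) R →ₐ[R] _).toRingHom =
        eval₂Hom φ (fun ik => evalHom φ Y (g ik)) := by
      refine MvPolynomial.ringHom_ext (fun r => ?_) fun ik => ?_
      · rw [eval₂Hom_C]
        refine Eq.trans ?_ (evalHom_C φ Y r)
        exact congrArg (evalHom φ Y) (aeval_C g r)
      · rw [eval₂Hom_X']
        exact congrArg (evalHom φ Y) (aeval_X g ik)
    exact RingHom.congr_fun h2 f
  rw [h1]
  exact eval₂Hom_congr' rfl (fun ik hik _ => h ik (mem_supported.mp hf hik)) rfl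

variable (δ) in
/-- The polynomial function `f` is additive on the group of solutions. -/
def IsAdditive (f : MvPolynomial (ι × Fin n) R) : Prop :=
  ∀ (S : Type u) [CommRing S] (φ : R →+* S), ∀ X ∈ solPoints δ φ, ∀ Y ∈ solPoints δ φ,
    evalHom φ (X + Y) f = evalHom φ X f + evalHom φ Y f

variable (R ι n) in
/-- Restriction of polynomials on pairs to the first factor. -/
noncomputable def fstHom : MvPolynomial ((ι ⊕ ι) × Fin n) R →ₐ[R] MvPolynomial (ι × Fin n) R :=
  aeval fun v => Sum.elim (fun i => X (i, v.2)) (fun _ => 0) v.1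

theorem fstHom_inl (i : ι) (k : Fin n) : fstHom n R ι (X (Sum.inl i, k)) = X (i, k) := aeval_X _ _

theorem fstHom_inr (i : ι) (k : Fin n) : fstHom n R ι (X (Sum.inr i, k)) = 0 := aeval_X _ _

/-- Adding `V ^ m Z` leaves the levels below `m` unchanged and adds `Z_(i,0)` to `X_(i,m)`. So
additivity becomes an identity of reduced polynomials in `X` and `Z`; its derivative in `Z_(j,0)` at
`Z = 0` says that `∂f/∂X_(j,m)` equals its value at the origin. -/
theorem pderiv_eq_C_of_isAdditive (hδ : IsVShape δ α) {f : MvPolynomial (ι × Fin n) R}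
    (hf : f ∈ restrictDegree (ι × Fin n) R (p - 1)) (ha : IsAdditive δ f) (m : Fin n)
    (hm : f ∈ supported R {ik : ι × Fin n | ik.2 ≤ m}) (j : ι) :
    pderiv (j, m) f = C (constantCoeff (pderiv (j, m) f)) := by
  classical
  -- `g₂`, `g₀` and `g₁` give the components up to level `m` of `X + V ^ m Z`, `X` and `V ^ m Z`;
  -- the second block of variables is `Z`, a solution for the twisted matrix.
  let g₂ : ι × Fin n → MvPolynomial ((ι ⊕ ι) × Fin n) R := fun ik =>
    X (Sum.inl ik.1, ik.2) + if ik.2 = m then X (Sum.inr ik.1, 0) else 0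
  let g₀ : ι × Fin n → MvPolynomial ((ι ⊕ ι) × Fin n) R := fun ik => X (Sum.inl ik.1, ik.2)
  let g₁ : ι × Fin n → MvPolynomial ((ι ⊕ ι) × Fin n) R := fun ik =>
    if ik.2 = m then X (Sum.inr ik.1, 0) else 0
  -- Each new variable can occur only in the image of one old variable, recorded by `π`; hence the
  -- substituted polynomials remain reduced.
  let π : (ι ⊕ ι) × Fin n → ι × Fin n := fun v =>
    Sum.elim (fun i => (i, v.2)) (fun i => (i, m)) v.1
  have hπ₀ : ∀ v i, degreeOf v (g₀ i) ≤ if i = π v then 1 else 0 := by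
    rintro v i
    exact degreeOf_X_le_ite fun h => by rw [h]; rfl
  have hπ₁ : ∀ v i, degreeOf v (g₁ i) ≤ if i = π v then 1 else 0 := by
    rintro ⟨a, k⟩ ⟨i, l⟩
    by_cases hl : l = m
    · simp only [g₁, if_pos hl]
      exact degreeOf_X_le_ite fun h => by rw [h, hl]; rfl
    · simp only [g₁, if_neg hl, degreeOf_zero]
      exact Nat.zero_le _
  have hπ₂ : ∀ v i, degreeOf v (g₂ i) ≤ if i = π v then 1 else 0 := fun v i =>
    (degreeOf_add_le _ _ _).trans (max_le (hπ₀ v i) (hπ₁ v i))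
  have hzero : aeval g₂ f - aeval g₀ f - aeval g₁ f = 0 := by
    refine eq_zero_of_forall_evalHom (isVShape_blk hδ (hδ.sigma_iterate m.1)) ?_ ?_
    · exact Submodule.sub_mem _ (Submodule.sub_mem _ (aeval_mem_restrictDegree _ π hπ₂ hf)
        (aeval_mem_restrictDegree _ π hπ₀ hf)) (aeval_mem_restrictDegree _ π hπ₁ hf)
    · intro S _ φ Y hY
      have h := ha S φ _ (blk_inl_mem hY) _ (vers_iterate_mem_solPoints m.1 (blk_inr_mem hY))
      have hc : ∀ i, ∀ k ≤ m, ((vers p n)^[m.1] (Y (Sum.inr i))).coeff k =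
          if k = m then (Y (Sum.inr i)).coeff 0 else 0 := by
        intro i k hk
        split_ifs with h0
        · exact coeff_vers_iterate_add _ _ _ _ (by simp [h0])
        · exact coeff_vers_iterate_of_lt _ _ _ (lt_of_le_of_ne hk fun h => h0 (Fin.ext h))
      rw [map_sub, map_sub, sub_sub, sub_eq_zero]
      refine Eq.trans ?_ (h.trans (congrArg₂ (· + ·) ?_ ?_))
      · refine evalHom_aeval φ hm g₂ fun ik hik => ?_
        rw [Pi.add_apply, coeff_add_vers_iterate _ _ _ _ hik, hc _ _ hik]
        simp only [g₂, map_add, evalHom_X]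
        split_ifs
        · rw [evalHom_X]
        · rw [map_zero]
      · refine (evalHom_aeval φ hm g₀ fun ik hik => ?_).symm
        simp only [g₀, evalHom_X]
      · refine (evalHom_aeval φ hm g₁ fun ik hik => ?_).symm
        rw [hc _ _ hik]
        simp only [g₁]
        split_ifs
        · rw [evalHom_X]
        · rw [map_zero]
  have hd := congrArg (fun q => fstHom n R ι (pderiv (Sum.inr j, 0) q)) hzero
  simp only [map_sub, map_zero, map_pderiv_aeval] at hd
  have e₀ : ∀ i, fstHom n R ι (pderiv (Sum.inr j, 0) (g₀ i)) = 0 := fun i => by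
    rw [pderiv_X_of_ne (by simp), map_zero]
  have e₁ : ∀ i, fstHom n R ι (pderiv (Sum.inr j, 0) (g₁ i)) = if i = (j, m) then 1 else 0 := by
    rintro ⟨i, k⟩
    simp only [g₁]
    by_cases hk : k = m
    · rw [if_pos hk, pderiv_X, Pi.single_apply]
      simp only [Prod.mk.injEq, Sum.inr.injEq, and_true, hk]
      split_ifs <;> simp
    · rw [if_neg hk, if_neg (fun h => hk (Prod.ext_iff.mp h).2), map_zero, map_zero]
  have e₂ : ∀ i, fstHom n R ι (pderiv (Sum.inr j, 0) (g₂ i)) = if i = (j, m) then 1 else 0 :=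
    fun i => by
      have : g₂ i = g₀ i + g₁ i := rfl
      rw [this, map_add, map_add, e₀, e₁, zero_add]
  simp only [e₀, e₁, e₂, mul_zero, mul_ite, mul_one, Finset.sum_const_zero, sub_zero,
    Finset.sum_ite_eq', Finset.mem_univ, if_true] at hd
  have hid : ∀ q, fstHom n R ι (aeval g₂ q) = q := by
    intro q
    rw [← AlgHom.comp_apply, comp_aeval]
    refine (congrArg (fun g => aeval g q) (funext fun ik => ?_)).trans (aeval_X_left_apply q)
    simp only [g₂, map_add, fstHom_inl]
    split_ifs
    · rw [fstHom_inr, add_zero]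
    · rw [map_zero, add_zero]
  rw [hid, aeval_aeval_of_forall_eq_zero, sub_eq_zero] at hd
  · exact hd
  · intro i
    simp only [g₁]
    split_ifs
    · rw [fstHom_inr]
    · rw [map_zero]

/-- By constancy of the derivatives, a variable of level `m` occurs in `f` only as a linear monomial
on its own. -/
theorem exists_eq_add_sum_of_isAdditive (hδ : IsVShape δ α) {f : MvPolynomial (ι × Fin n) R}
    (hf : f ∈ restrictDegree (ι × Fin n) R (p - 1)) (ha : IsAdditive δ f) (m : Fin n)
    (hm : f ∈ supported R {ik : ι × Fin n | ik.2 ≤ m}) :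
    ∃ (s : ι → R) (f₀ : MvPolynomial (ι × Fin n) R), f₀ ∈ restrictDegree (ι × Fin n) R (p - 1) ∧
      f₀ ∈ supported R {ik : ι × Fin n | ik.2 < m} ∧ f = f₀ + ∑ j, C (s j) * X (j, m) := by
  classical
  have hp := (Fact.out : p.Prime).one_lt
  let s : ι → R := fun j => coeff (Finsupp.single (j, m) 1) f
  refine ⟨s, f - ∑ j, C (s j) * X (j, m), ?_, ?_, by ring⟩
  · refine Submodule.sub_mem _ hf (Submodule.sum_mem _ fun j _ => ?_)
    rw [C_mul_X_eq_monomial, mem_restrictDegree]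
    intro e he i
    rw [Finset.mem_singleton.mp (support_monomial_subset he), Finsupp.single_apply]
    split_ifs <;> omega
  · rw [mem_supported]
    rintro ⟨j, k⟩ hv
    obtain ⟨e, he, hek⟩ := (mem_vars_iff_mem_support _).mp (Finset.mem_coe.mp hv)
    rw [Finsupp.mem_support_iff] at hek
    rw [mem_support_iff] at he
    change k < m
    by_contra hk
    refine he ?_
    have hcs : coeff e (∑ j, C (s j) * X (j, m)) = ∑ j, if Finsupp.single (j, m) 1 = e then s j else 0 := by
      rw [coeff_sum]
      exact Finset.sum_congr rfl fun j _ => by rw [C_mul_X_eq_monomial, coeff_monomial]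
    rw [coeff_sub, hcs]
    by_cases hex : ∃ j', e = Finsupp.single (j', m) 1
    · obtain ⟨j', rfl⟩ := hex
      rw [Finset.sum_eq_single j']
      · rw [if_pos rfl, sub_self]
      · intro i _ hi
        refine if_neg fun h => hi ?_
        exact (Prod.ext_iff.mp (Finsupp.single_left_injective one_ne_zero h)).1
      · intro h; exact absurd (Finset.mem_univ _) h
    · rw [Finset.sum_eq_zero, sub_zero]
      · rcases (not_lt.mp hk).lt_or_eq with hk' | rfl
        · by_contra hc
          have := mem_supported.mp hm (Finset.mem_coe.mpr ((mem_vars_iff_mem_support (j, k)).mpr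
            ⟨e, mem_support_iff.mpr hc, Finsupp.mem_support_iff.mpr hek⟩))
          exact absurd this (not_le.mpr hk')
        · exact eq_of_pderiv_eq_C hf (pderiv_eq_C_of_isAdditive hδ hf ha m hm j) hek
            fun h => hex ⟨j, h⟩
      · intro i _
        exact if_neg fun h => hex ⟨i, h.symm⟩

/-- The defect of additivity of `f₀` must cancel `∑ s_i carry(X_i, Y_i)`. Differentiating in
`Y_(j,0)` at `Y = 0` equates `s_j X_(j,0) ^ (p - 1)` with a derivative of `f₀` up to a constant, but
in characteristic `p` no derivative in `X_(j,0)` contains this monomial. -/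
theorem eq_zero_of_isAdditive_add_sum (hδ : IsVShape δ α) {f₀ : MvPolynomial (ι × Fin n) R}
    (hf : f₀ ∈ restrictDegree (ι × Fin n) R (p - 1))
    (h₀ : f₀ ∈ supported R {ik : ι × Fin n | ik.2 = 0}) (s : ι → R) (l : Fin n) (hl : l.1 = 1)
    (ha : IsAdditive δ (f₀ + ∑ j, C (s j) * X (j, l))) (j : ι) : s j = 0 := by
  classical
  have hp := (Fact.out : p.Prime).one_lt
  let g₂ : ι × Fin n → MvPolynomial ((ι ⊕ ι) × Fin n) R := fun ik =>
    X (Sum.inl ik.1, ik.2) + X (Sum.inr ik.1, ik.2)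
  let g₀ : ι × Fin n → MvPolynomial ((ι ⊕ ι) × Fin n) R := fun ik => X (Sum.inl ik.1, ik.2)
  let g₁ : ι × Fin n → MvPolynomial ((ι ⊕ ι) × Fin n) R := fun ik => X (Sum.inr ik.1, ik.2)
  let c : ι → MvPolynomial ((ι ⊕ ι) × Fin n) R := fun i =>
    carry p (X (Sum.inl i, 0)) (X (Sum.inr i, 0))
  let π : (ι ⊕ ι) × Fin n → ι × Fin n := fun v => (Sum.elim id id v.1, v.2)
  have hπ₀ : ∀ v i, degreeOf v (g₀ i) ≤ if i = π v then 1 else 0 := by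
    rintro v i
    exact degreeOf_X_le_ite fun h => by rw [h]; rfl
  have hπ₁ : ∀ v i, degreeOf v (g₁ i) ≤ if i = π v then 1 else 0 := by
    rintro v i
    exact degreeOf_X_le_ite fun h => by rw [h]; rfl
  have hπ₂ : ∀ v i, degreeOf v (g₂ i) ≤ if i = π v then 1 else 0 := fun v i =>
    (degreeOf_add_le _ _ _).trans (max_le (hπ₀ v i) (hπ₁ v i))
  have hzero : aeval g₂ f₀ + ∑ i, C (s i) * c i - aeval g₀ f₀ - aeval g₁ f₀ = 0 := by
    refine eq_zero_of_forall_evalHom (isVShape_blk hδ hδ) ?_ ?_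
    · refine Submodule.sub_mem _ (Submodule.sub_mem _ (Submodule.add_mem _
        (aeval_mem_restrictDegree _ π hπ₂ hf) (Submodule.sum_mem _ fun i _ => ?_))
        (aeval_mem_restrictDegree _ π hπ₀ hf)) (aeval_mem_restrictDegree _ π hπ₁ hf)
      rw [← smul_eq_C_mul]
      exact Submodule.smul_mem _ _ (carry_mem_restrictDegree (by simp))
    · intro S _ φ Y hY
      have h := ha S φ _ (blk_inl_mem hY) _ (blk_inr_mem hY)
      simp only [map_add, map_sum, map_mul, evalHom_C, evalHom_X, Pi.add_apply,
        coeff_one_add _ _ l hl, mul_add, Finset.sum_add_distrib] at h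
      have t₂ : evalHom φ Y (aeval g₂ f₀) =
          evalHom φ ((fun i => Y (Sum.inl i)) + fun i => Y (Sum.inr i)) f₀ := by
        refine evalHom_aeval φ h₀ g₂ ?_
        rintro ⟨i, k⟩ rfl
        simp only [g₂, map_add, evalHom_X, Pi.add_apply, coeff_zero_add]
      have t₀ : evalHom φ Y (aeval g₀ f₀) = evalHom φ (fun i => Y (Sum.inl i)) f₀ :=
        evalHom_aeval φ h₀ g₀ fun ik _ => by simp only [g₀, evalHom_X]
      have t₁ : evalHom φ Y (aeval g₁ f₀) = evalHom φ (fun i => Y (Sum.inr i)) f₀ :=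
        evalHom_aeval φ h₀ g₁ fun ik _ => by simp only [g₁, evalHom_X]
      simp only [map_sub, map_add, map_sum, map_mul, evalHom_C, t₀, t₁, t₂, c, map_carry, evalHom_X]
      linear_combination h
  have hd := congrArg (fun q => fstHom n R ι (pderiv (Sum.inr j, 0) q)) hzero
  simp only [map_sub, map_add, map_sum, map_zero, map_pderiv_aeval, pderiv_C_mul, map_mul] at hd
  have e₀ : ∀ i, fstHom n R ι (pderiv (Sum.inr j, 0) (g₀ i)) = 0 := fun i => by
    rw [pderiv_X_of_ne (by simp), map_zero]
  have e₁ : ∀ i, fstHom n R ι (pderiv (Sum.inr j, 0) (g₁ i)) = if i = (j, 0) then 1 else 0 := by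
    rintro ⟨i, k⟩
    simp only [g₁]
    rw [pderiv_X, Pi.single_apply]
    simp only [Prod.mk.injEq, Sum.inr.injEq]
    split_ifs <;> simp
  have e₂ : ∀ i, fstHom n R ι (pderiv (Sum.inr j, 0) (g₂ i)) = if i = (j, 0) then 1 else 0 :=
    fun i => by
      have : g₂ i = g₀ i + g₁ i := rfl
      rw [this, map_add, map_add, e₀, e₁, zero_add]
  have ec : ∀ i, fstHom n R ι (pderiv (Sum.inr j, 0) (c i)) =
      if i = j then -X (j, 0) ^ (p - 1) else 0 := by
    intro i
    split_ifs with h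
    · subst h
      rw [map_pderiv_carry (by simp) _ (fstHom_inr _ _), fstHom_inl]
    · have : pderiv (Sum.inr j, (0 : Fin n)) (c i) = 0 := by
        simp only [c, carry, map_neg, map_sum]
        rw [Finset.sum_eq_zero, neg_zero]
        intro k _
        rw [← map_natCast C, mul_comm, pderiv_C_mul, pderiv_mul, pderiv_pow, pderiv_pow,
          pderiv_X_of_ne (by simp), pderiv_X_of_ne (by simp [h])]
        simp
      rw [this, map_zero]
  simp only [e₀, e₁, e₂, ec, mul_zero, mul_ite, mul_one, Finset.sum_const_zero, sub_zero,
    Finset.sum_ite_eq', Finset.mem_univ, if_true] at hd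
  have hid : ∀ q, fstHom n R ι (aeval g₂ q) = q := by
    intro q
    rw [← AlgHom.comp_apply, comp_aeval]
    refine (congrArg (fun g => aeval g q) (funext fun ik => ?_)).trans (aeval_X_left_apply q)
    simp only [g₂, map_add, fstHom_inl, fstHom_inr, add_zero]
  rw [hid, aeval_aeval_of_forall_eq_zero _ _ (fun i => fstHom_inr _ _)] at hd
  have hC : fstHom n R ι (C (s j)) = C (s j) := aeval_C _ _
  rw [hC] at hd
  -- At this monomial the derivative of `f₀` has a coefficient divisible by `p`, and the constant
  -- does not contribute because `p - 1 > 0`.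
  have hd' := congrArg (coeff (Finsupp.single (j, (0 : Fin n)) (p - 1))) hd
  have h5 : (0 : ι × Fin n →₀ ℕ) ≠ Finsupp.single (j, (0 : Fin n)) (p - 1) := fun h0 => by
    have := DFunLike.congr_fun h0 (j, (0 : Fin n))
    rw [Finsupp.single_eq_same] at this
    simp only [Finsupp.coe_zero, Pi.zero_apply] at this
    omega
  have h6 : ((p - 1 : ℕ) : R) + 1 = 0 := by
    rw [← Nat.cast_add_one, Nat.sub_add_cancel hp.le]; exact natCast_eq_zero p R
  rw [coeff_sub, coeff_add, coeff_pderiv, Finsupp.single_eq_same, h6, mul_zero, coeff_C_mul,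
    coeff_neg, X_pow_eq_monomial, coeff_monomial, if_pos rfl, algebraMap_eq, coeff_C, if_neg h5,
    coeff_zero] at hd'
  linear_combination -hd'

/-- Descending on the top level: its linear part is split off, and restriction along `V ^ m`, from
solutions for the twisted matrix, lowers level `m + 1` to level `1`, where the carry argument shows
that the linear part is zero. -/
theorem eq_sum_of_isAdditive (hδ : IsVShape δ α) {f : MvPolynomial (ι × Fin n) R}
    (hf : f ∈ restrictDegree (ι × Fin n) R (p - 1)) (ha : IsAdditive δ f) (m : ℕ) (hmn : m < n)
    (hm : f ∈ supported R {ik : ι × Fin n | ik.2 ≤ ⟨m, hmn⟩}) :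
    ∃ s : ι → R, f = ∑ j, C (s j) * X (j, 0) := by
  classical
  induction m generalizing f with
  | zero =>
    have h00 : (⟨0, hmn⟩ : Fin n) = 0 := Fin.ext (by simp)
    obtain ⟨s, f₀, -, h₀, rfl⟩ := exists_eq_add_sum_of_isAdditive hδ hf ha ⟨0, hmn⟩ hm
    refine ⟨s, ?_⟩
    rw [h00] at h₀ ha ⊢
    have he : {ik : ι × Fin n | ik.2 < 0} = ∅ := Set.eq_empty_of_forall_notMem fun ik h =>
      absurd h (not_lt.mpr (Fin.zero_le ik.2))
    rw [he, supported_empty, Algebra.mem_bot] at h₀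
    obtain ⟨r, rfl⟩ := h₀
    -- Additivity at the zero solution removes the constant term.
    have h := ha R (RingHom.id R) 0 (zero_mem _) 0 (zero_mem _)
    rw [add_zero, left_eq_add, map_add, algebraMap_eq, evalHom_C, map_sum,
      Finset.sum_eq_zero] at h
    · rw [add_zero] at h
      rw [show r = 0 from h, map_zero, zero_add]
    · intro i _
      rw [map_mul, evalHom_X, Pi.zero_apply, TruncatedWittVector.coeff_zero, mul_zero]
  | succ m ih =>
    obtain ⟨s, f₀, hf₀, h₀, rfl⟩ := exists_eq_add_sum_of_isAdditive hδ hf ha _ hm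
    have h1n : 1 < n := by omega
    -- On `V ^ m Z` the components below level `m` vanish and those of level `m` are the zeroth
    -- components of `Z`.
    let g : ι × Fin n → MvPolynomial (ι × Fin n) R := fun ik =>
      if ik.2.1 = m then X (ik.1, 0) else 0
    have hs : ∀ j, s j = 0 := by
      refine eq_zero_of_isAdditive_add_sum (f₀ := aeval g f₀) (hδ.sigma_iterate m) ?_ ?_ s
        ⟨1, h1n⟩ rfl ?_
      · refine aeval_mem_restrictDegree g (fun v => (v.1, ⟨m, by omega⟩)) ?_ hf₀
        rintro ⟨a, k⟩ ⟨i, l⟩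
        simp only [g]
        by_cases hl : l.1 = m
        · rw [if_pos hl]
          exact degreeOf_X_le_ite fun h => Prod.ext_iff.mpr ⟨(Prod.ext_iff.mp h).1.symm, Fin.ext hl⟩
        · rw [if_neg hl, degreeOf_zero]
          exact Nat.zero_le _
      · refine aeval_mem_supported g (fun ik => ?_) f₀
        simp only [g]
        split_ifs
        · exact Algebra.subset_adjoin ⟨(ik.1, 0), rfl, rfl⟩
        · exact Subalgebra.zero_mem _
      · have key : ∀ (S : Type u) [CommRing S] (φ : R →+* S) (Z : ι → TruncatedWittVector p n S),
            evalHom φ Z (aeval g f₀ + ∑ j, C (s j) * X (j, ⟨1, h1n⟩)) =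
            evalHom φ (fun i => (vers p n)^[m] (Z i)) (f₀ + ∑ j, C (s j) * X (j, ⟨m + 1, hmn⟩)) := by
          intro S _ φ Z
          rw [map_add, map_add]
          congr 1
          · refine evalHom_aeval φ h₀ g ?_
            rintro ⟨i, k⟩ hk
            simp only [g]
            split_ifs with hkm
            · rw [evalHom_X]
              exact (coeff_vers_iterate_add _ _ _ _ (by simp [hkm])).symm
            · rw [map_zero]
              refine (coeff_vers_iterate_of_lt _ _ _ ?_).symm
              have : k.1 < m + 1 := hk
              omega
          · simp only [map_sum, map_mul, evalHom_C, evalHom_X]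
            refine Finset.sum_congr rfl fun i _ => ?_
            rw [coeff_vers_iterate_add m (Z i) ⟨m + 1, hmn⟩ ⟨1, h1n⟩ (add_comm _ _)]
        intro S _ φ Y hY Z hZ
        rw [key, key, key, ← ha S φ _ (vers_iterate_mem_solPoints m hY) _
          (vers_iterate_mem_solPoints m hZ)]
        congr 2
        funext i
        simp only [Pi.add_apply, ← wact_V_pow φ, map_add]
    simp only [hs, map_zero, zero_mul, Finset.sum_const_zero, add_zero] at ha ⊢
    refine ih hf₀ ha (by omega) ?_
    refine supported_mono (fun ik hik => ?_) h₀
    exact Nat.lt_succ_iff.mp hik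

/-- Every additive function on the group of solutions is a linear combination of the zeroth
components. -/
theorem exists_eq_sum_of_additive (hδ : IsVShape δ α)
    (h : ∀ (S : Type u) [CommRing S] (_ : R →+* S), (ι → TruncatedWittVector p n S) → S)
    (hadd : ∀ (S : Type u) [CommRing S] (φ : R →+* S), ∀ X ∈ solPoints δ φ, ∀ Y ∈ solPoints δ φ,
      h S φ (X + Y) = h S φ X + h S φ Y)
    (hnat : ∀ (S T : Type u) [CommRing S] [CommRing T] (φ : R →+* S) (f : S →+* T),
      ∀ X ∈ solPoints δ φ, h T (f.comp φ) (fun i => wittMap p n f (X i)) = f (h S φ X)) :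
    ∃ s : ι → R, ∀ (S : Type u) [CommRing S] (φ : R →+* S), ∀ X ∈ solPoints δ φ,
      h S φ X = ∑ j, φ (s j) * (X j).coeff 0 := by
  -- By naturality `h` is determined by its value at the universal solution, represented here by a
  -- polynomial and then by a reduced one.
  obtain ⟨f', hf'⟩ := Ideal.Quotient.mk_surjective (h _ _ (solGen δ))
  obtain ⟨f, hf, hff⟩ := exists_sub_mem_relIdeal (Fact.out : p.Prime).pos (relPoly_mem_lowPoly hδ) f'
  have hev : ∀ (S : Type u) [CommRing S] (φ : R →+* S), ∀ X ∈ solPoints δ φ,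
      h S φ X = evalHom φ X f := by
    intro S _ φ X hX
    have h1 : evalHom φ X f' = evalHom φ X f := by
      rw [← sub_eq_zero, ← map_sub]
      exact relIdeal_le_ker δ hX _ hff
    let ψ : SolRing δ →+* S := Ideal.Quotient.lift _ (evalHom φ X) (relIdeal_le_ker δ hX)
    have hψ : ψ.comp (algebraMap R (SolRing δ)) = φ := by
      ext r
      refine Eq.trans ?_ (evalHom_C φ X r)
      exact Ideal.Quotient.lift_mk (relIdeal p (relPoly δ)) (evalHom φ X) (relIdeal_le_ker δ hX)
    have h2 := hnat _ _ (algebraMap R (SolRing δ)) ψ _ (solGen_mem δ)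
    rw [← hf', hψ] at h2
    have h3 : (fun i => wittMap p n ψ (solGen δ i)) = X := by
      funext i
      rw [solGen, ← wittMap_comp, Ideal.Quotient.lift_comp_mk, wittMap_evalHom_gen]
    rw [h3] at h2
    rw [h2, ← h1]
    exact Ideal.Quotient.lift_mk (relIdeal p (relPoly δ)) (evalHom φ X) (relIdeal_le_ker δ hX)
  have ha : IsAdditive δ f := fun S _ φ X hX Y hY => by
    rw [← hev S φ X hX, ← hev S φ Y hY, ← hadd S φ X hX Y hY, hev S φ _ (add_mem hX hY)]
  have hn := Nat.pos_of_ne_zero (NeZero.ne n)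
  obtain ⟨s, rfl⟩ := eq_sum_of_isAdditive hδ hf ha (n - 1) (by omega) (by
    rw [mem_supported]
    rintro ⟨i, k⟩ -
    exact Fin.le_def.mpr (Nat.le_pred_of_lt k.2))
  refine ⟨s, fun S _ φ X hX => ?_⟩
  rw [hev S φ X hX]
  simp only [map_sum, map_mul, evalHom_C, evalHom_X]

end Primitive

/-! ### Modules generated by a solution of `F t = δ t` -/

section Generated

open GroupFunctor

variable {p : ℕ} [Fact p.Prime] {n : ℕ} [NeZero n] {R : Type u} [CommRing R] [Algebra (ZMod p) R]
  {ι : Type} [Fintype ι] {δ : ι → ι → DRing p n R} {α : ι → ι → TruncatedWittVector p n R}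
  {N : Type*} [AddCommGroup N] [Module (DRing p n R) N]

theorem ofW_smul_V_smul (a : TruncatedWittVector p n R) (x : N) :
    DRing.ofW p n R a • DRing.V p n R • x =
      DRing.V p n R • DRing.ofW p n R (frob p n a) • x := by
  rw [← mul_smul, DRing.ofW_mul_V, mul_smul]

theorem V_smul_ofW_smul_F_smul (a : TruncatedWittVector p n R) (x : N) :
    DRing.V p n R • DRing.ofW p n R a • DRing.F p n R • x = DRing.ofW p n R (vers p n a) • x := by
  rw [← mul_smul, ← mul_smul, DRing.V_mul_ofW_mul_F]

theorem F_smul_ofW_smul (a : TruncatedWittVector p n R) (x : N) :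
    DRing.F p n R • DRing.ofW p n R a • x = DRing.ofW p n R (frob p n a) • DRing.F p n R • x := by
  rw [← mul_smul, DRing.F_mul_ofW, mul_smul]

theorem F_smul_V_smul (x : N) : DRing.F p n R • DRing.V p n R • x =
    DRing.V p n R • DRing.F p n R • x := by
  rw [← mul_smul, ← mul_smul, DRing.F_mul_V, DRing.V_mul_F]

theorem coeff_zero_smul_modV (a : TruncatedWittVector p n R) (x : N) :
    a.coeff 0 • (QuotientAddGroup.mk x : ModV p n R N) =
      QuotientAddGroup.mk (DRing.ofW p n R a • x) := by
  change modVActionR p n R N (proj p n R a) _ = _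
  unfold modVActionR
  rw [RingHom.liftOfSurjective_comp_apply]
  rfl

/-- The map `(a, m) ↦ ∑ a_j t_j + V m`. -/
noncomputable def genHom (t : ι → N) : (ι → TruncatedWittVector p n R) × N →+ N where
  toFun am := ∑ j, DRing.ofW p n R (am.1 j) • t j + DRing.V p n R • am.2
  map_zero' := by simp
  map_add' x y := by
    simp only [Prod.fst_add, Prod.snd_add, Pi.add_apply, map_add, add_smul, smul_add,
      Finset.sum_add_distrib]
    abel

variable {t : ι → N}

theorem V_smul_mem_range_genHom (x : N) : DRing.V p n R • x ∈ (genHom (p := p) (n := n) (R := R) t).range :=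
  ⟨(0, x), by simp [genHom]⟩

theorem ofW_smul_mem_range_genHom (a : TruncatedWittVector p n R) (j : ι) :
    DRing.ofW p n R a • t j ∈ (genHom (p := p) (n := n) (R := R) t).range := by
  classical
  refine ⟨(Pi.single j a, 0), ?_⟩
  change ∑ i, DRing.ofW p n R ((Pi.single j a : ι → TruncatedWittVector p n R) i) • t i +
    DRing.V p n R • (0 : N) = _
  rw [smul_zero, add_zero, Finset.sum_eq_single j]
  · rw [Pi.single_eq_same]
  · intro i _ hi
    rw [Pi.single_eq_of_ne hi, map_zero, zero_smul]
  · intro h; exact absurd (Finset.mem_univ j) h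

/-- The image contains the `t_j` and is stable under `𝔇`. Stability under `F` is the point: it uses
`F t = δ t` and the shape of `δ`. -/
theorem genHom_surjective (hδ : IsVShape δ α) (hgen : Submodule.span (DRing p n R) (Set.range t) = ⊤)
    (ht : ∀ j, DRing.F p n R • t j = ∑ i, δ j i • t i) :
    Function.Surjective (genHom (p := p) (n := n) (R := R) t) := by
  have hsmul : ∀ (d : DRing p n R) (x : N), x ∈ (genHom (p := p) (n := n) (R := R) t).range →
      d • x ∈ (genHom (p := p) (n := n) (R := R) t).range := by
    intro d
    induction d using DRing.induction with
    | hw b =>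
      rintro _ ⟨⟨a, y⟩, rfl⟩
      change DRing.ofW p n R b • (∑ j, _ + DRing.V p n R • y) ∈ _
      rw [smul_add, ofW_smul_V_smul, Finset.smul_sum]
      refine add_mem (sum_mem fun j _ => ?_) (V_smul_mem_range_genHom _)
      rw [← mul_smul, ← map_mul]
      exact ofW_smul_mem_range_genHom _ _
    | hF =>
      rintro _ ⟨⟨a, y⟩, rfl⟩
      change DRing.F p n R • (∑ j, _ + DRing.V p n R • y) ∈ _
      rw [smul_add, F_smul_V_smul, Finset.smul_sum]
      refine add_mem (sum_mem fun j _ => ?_) (V_smul_mem_range_genHom _)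
      rw [F_smul_ofW_smul, ht, Finset.smul_sum]
      refine sum_mem fun i _ => ?_
      obtain ⟨d, hd⟩ := hδ j i
      rw [hd, add_smul, smul_add, mul_smul, ofW_smul_V_smul, ← mul_smul, ← map_mul]
      exact add_mem (ofW_smul_mem_range_genHom _ _) (V_smul_mem_range_genHom _)
    | hV => exact fun x _ => V_smul_mem_range_genHom x
    | hadd d d' h h' => exact fun x hx => by rw [add_smul]; exact add_mem (h x hx) (h' x hx)
    | hmul d d' h h' => exact fun x hx => by rw [mul_smul]; exact h _ (h' x hx)
  intro x
  have hx : x ∈ Submodule.span (DRing p n R) (Set.range t) := by rw [hgen]; trivial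
  change x ∈ (genHom (p := p) (n := n) (R := R) t).range
  induction hx using Submodule.span_induction with
  | mem x hx =>
    obtain ⟨j, rfl⟩ := hx
    have := ofW_smul_mem_range_genHom (t := t) (1 : TruncatedWittVector p n R) j
    rwa [map_one, one_smul] at this
  | zero => exact zero_mem _
  | add x y _ _ hx hy => exact add_mem hx hy
  | smul d x _ hx => exact hsmul d x hx

open MvPolynomial in
-- Linear polynomials are reduced since `p > 1`, so the zeroth components are independent functions
-- on the group of solutions.
theorem eq_zero_of_sum_coeff_zero (hδ : IsVShape δ α) {s : ι → R}
    (h : ∀ (S : Type u) [CommRing S] (φ : R →+* S), ∀ X ∈ solPoints δ φ,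
      ∑ j, φ (s j) * (X j).coeff 0 = 0) : s = 0 := by
  classical
  have h0 : ∑ j, C (s j) * (X (j, 0) : MvPolynomial (ι × Fin n) R) = 0 := by
    refine eq_zero_of_forall_evalHom hδ (Submodule.sum_mem _ fun j _ => ?_) fun S _ φ Y hY => ?_
    · rw [C_mul_X_eq_monomial, mem_restrictDegree]
      intro e he i
      have hp := (Fact.out : p.Prime).one_lt
      rw [Finset.mem_singleton.mp (support_monomial_subset he), Finsupp.single_apply]
      split_ifs <;> omega
    · simp only [map_sum, map_mul, evalHom_C, evalHom_X]
      exact h S φ Y hY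
  funext i
  have h1 := congrArg (coeff (Finsupp.single (i, (0 : Fin n)) 1)) h0
  rw [coeff_sum, Finset.sum_eq_single i] at h1
  · rwa [C_mul_X_eq_monomial, coeff_monomial, if_pos rfl] at h1
  · intro j _ hj
    rw [C_mul_X_eq_monomial, coeff_monomial, if_neg]
    exact fun h => hj (Prod.ext_iff.mp (Finsupp.single_left_injective one_ne_zero h)).1
  · intro h; exact absurd (Finset.mem_univ i) h

/-- The group homomorphism `f ↦ f(x)`. -/
noncomputable def valAt {G : GroupFunctor.{u, v} R} {S : Type u} [CommRing S] (φ : R →+* S) (x : G.obj S φ) :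
    Hom G (witt p n R) →+ TruncatedWittVector p n S where
  toFun f := f.val φ x
  map_zero' := rfl
  map_add' _ _ := rfl

theorem valAt_smul {G : GroupFunctor.{u, v} R} {S : Type u} [CommRing S] (φ : R →+* S)
    (x : G.obj S φ) (d : DRing p n R) (f : Hom G (witt p n R)) :
    valAt φ x (d • f) = wact p n φ d (valAt φ x f) := Hom_smul_val d f φ x

/-- The linear map `ev` sends `t_j` to the `j`-th coordinate function. -/
def IsEval (t : ι → N) (ev : N →ₗ[DRing p n R] Hom (sol δ) (witt p n R)) : Prop :=
  ∀ (j : ι) (S : Type u) [CommRing S] (φ : R →+* S) (X : solPoints δ φ),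
    valAt (G := sol δ) φ X (ev (t j)) = X.1 j

variable {ev : N →ₗ[DRing p n R] Hom (sol δ) (witt p n R)}

theorem IsEval.apply (hev : IsEval t ev) (j : ι) {S : Type u} [CommRing S] (φ : R →+* S)
    (X : solPoints δ φ) : valAt (G := sol δ) φ X (ev (t j)) = X.1 j := hev j S φ X

theorem IsEval.coeff_zero_genHom (hev : IsEval t ev) (am : (ι → TruncatedWittVector p n R) × N)
    {S : Type u} [CommRing S] (φ : R →+* S) (X : solPoints δ φ) :
    (valAt (G := sol δ) φ X (ev (genHom t am))).coeff 0 =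
      ∑ j, φ ((am.1 j).coeff 0) * (X.1 j).coeff 0 := by
  change (valAt (G := sol δ) φ X (ev (∑ j, DRing.ofW p n R (am.1 j) • t j +
    DRing.V p n R • am.2))).coeff 0 = _
  simp only [map_add, map_sum, map_smul, valAt_smul, coeff_zero_add, coeff_zero_sum, wact_V,
    coeff_zero_vers, add_zero, wact_ofW, hev.apply, coeff_zero_mul, coeff_wittMap]

/-- Write `x = ∑ a_j t_j + V m`. Independence of the zeroth components gives `a_j = V(b_j)`, and
then `a_j t_j = V b_j F t_j`. -/
theorem IsEval.mem_rangeV (hev : IsEval t ev) (hδ : IsVShape δ α)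
    (hgen : Submodule.span (DRing p n R) (Set.range t) = ⊤)
    (ht : ∀ j, DRing.F p n R • t j = ∑ i, δ j i • t i) (x : N)
    (h : ∀ (S : Type u) [CommRing S] (φ : R →+* S) (X : solPoints δ φ),
      (valAt (G := sol δ) φ X (ev x)).coeff 0 = 0) : ∃ y, x = DRing.V p n R • y := by
  obtain ⟨am, rfl⟩ := genHom_surjective hδ hgen ht x
  have h0 := eq_zero_of_sum_coeff_zero hδ (s := fun j => (am.1 j).coeff 0) fun S _ φ X hX => by
    rw [← hev.coeff_zero_genHom am φ ⟨X, hX⟩, h]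
  choose b hb using fun j => exists_vers_of_proj_eq_zero p n R (am.1 j) (congrFun h0 j)
  refine ⟨∑ j, DRing.ofW p n R (b j) • DRing.F p n R • t j + am.2, ?_⟩
  change ∑ j, DRing.ofW p n R (am.1 j) • t j + DRing.V p n R • am.2 = _
  rw [smul_add, Finset.smul_sum]
  simp only [V_smul_ofW_smul_F_smul, ← hb]

theorem coeff_zero_eq_zero_of_vers_iterate {S : Type*} [CommRing S] {k : ℕ} (hk : k < n)
    {x : TruncatedWittVector p n S} (h : (vers p n)^[k] x = 0) : x.coeff 0 = 0 := by
  rw [← coeff_vers_iterate_add k x ⟨k, hk⟩ 0 (by simp), h, TruncatedWittVector.coeff_zero]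

/-- If `x = V ^ k y` with `i + k < n`, then `V ^ (i + k)` kills the value of `y`, whose zeroth
component must therefore vanish; so another `V` splits off. The case `i = 0`, `k = n` gives
injectivity of `ev`, and `k = n - i` gives the kernel condition of cosmoothness. -/
theorem IsEval.exists_eq_V_pow_smul (hev : IsEval t ev) (hδ : IsVShape δ α)
    (hgen : Submodule.span (DRing p n R) (Set.range t) = ⊤)
    (ht : ∀ j, DRing.F p n R • t j = ∑ i, δ j i • t i) (i : ℕ) (x : N)
    (h : ev (DRing.V p n R ^ i • x) = 0) (k : ℕ) (hk : i + k ≤ n) :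
    ∃ y, x = DRing.V p n R ^ k • y := by
  induction k with
  | zero => exact ⟨x, by rw [pow_zero, one_smul]⟩
  | succ k ih =>
    obtain ⟨y, rfl⟩ := ih (by omega)
    obtain ⟨z, rfl⟩ := hev.mem_rangeV hδ hgen ht y fun S _ φ X => by
      refine coeff_zero_eq_zero_of_vers_iterate (k := i + k) (by omega) ?_
      rw [← mul_smul, ← pow_add] at h
      rw [← wact_V_pow φ, ← valAt_smul, ← map_smul, h, map_zero]
    exact ⟨z, by rw [pow_succ, mul_smul]⟩

theorem IsEval.injective (hev : IsEval t ev) (hδ : IsVShape δ α)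
    (hgen : Submodule.span (DRing p n R) (Set.range t) = ⊤)
    (ht : ∀ j, DRing.F p n R • t j = ∑ i, δ j i • t i) : Function.Injective ev := by
  rw [injective_iff_map_eq_zero]
  intro x hx
  obtain ⟨y, rfl⟩ := hev.exists_eq_V_pow_smul hδ hgen ht 0 x (by rwa [pow_zero, one_smul]) n
    (by omega)
  rw [DRing.V_pow, zero_smul]

/-- Successive approximation: once the first `k` components of `f - ev m` vanish, component `k` is
an additive function, hence `∑ s_j X_(j,0)`, and it is removed by adding `V ^ k ∑ a_j t_j` to `m`,
where `a_j` lifts `s_j`. -/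
theorem IsEval.surjective (hev : IsEval t ev) (hδ : IsVShape δ α) : Function.Surjective ev := by
  intro f
  have key : ∀ k ≤ n, ∃ m, ∀ (S : Type u) [CommRing S] (φ : R →+* S) (X : solPoints δ φ)
      (i : Fin n), i.1 < k → (valAt (G := sol δ) φ X (f - ev m)).coeff i = 0 := by
    intro k
    induction k with
    | zero => exact fun _ => ⟨0, fun _ _ _ _ i hi => absurd hi (Nat.not_lt_zero _)⟩
    | succ k ih =>
      intro hk
      obtain ⟨m, hm⟩ := ih (by omega)
      have hV : ∀ (S : Type u) [CommRing S] (φ : R →+* S) (X : solPoints δ φ),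
          ∃ y, valAt (G := sol δ) φ X (f - ev m) = (vers p n)^[k] y := fun S _ φ X =>
        exists_vers_iterate k _ (hm S φ X)
      classical
      obtain ⟨s, hs⟩ := exists_eq_sum_of_additive hδ
        -- The value `0` off the solutions is a dummy: only solutions enter the hypotheses and the
        -- conclusion.
        (fun S _ φ X => if hX : X ∈ solPoints δ φ then
          (valAt (G := sol δ) φ ⟨X, hX⟩ (f - ev m)).coeff ⟨k, hk⟩ else 0)
        (fun S _ φ X hX Y hY => by
          rw [dif_pos hX, dif_pos hY, dif_pos (add_mem hX hY)]
          have h1 : valAt (G := sol δ) φ ⟨X + Y, add_mem hX hY⟩ (f - ev m) =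
              valAt (G := sol δ) φ ⟨X, hX⟩ (f - ev m) + valAt (G := sol δ) φ ⟨Y, hY⟩ (f - ev m) :=
            map_add ((f - ev m).val φ) (⟨X, hX⟩ : solPoints δ φ) ⟨Y, hY⟩
          obtain ⟨y, hy⟩ := hV S φ ⟨Y, hY⟩
          rw [h1, hy, coeff_add_vers_iterate _ _ _ _ le_rfl])
        (fun S T _ _ φ g X hX => by
          rw [dif_pos hX, dif_pos (wittMap_mem_solPoints δ g rfl hX), ← coeff_wittMap]
          exact congrArg (fun z => TruncatedWittVector.coeff ⟨k, hk⟩ z)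
            ((f - ev m).val_map g rfl (⟨X, hX⟩ : solPoints δ φ)))
      choose a ha using fun j => proj_surjective p n R (s j)
      refine ⟨m + DRing.V p n R ^ k • ∑ j, DRing.ofW p n R (a j) • t j, fun S _ φ X i hi => ?_⟩
      have h1 : f - ev (m + DRing.V p n R ^ k • ∑ j, DRing.ofW p n R (a j) • t j) =
          (f - ev m) - DRing.V p n R ^ k • ∑ j, DRing.ofW p n R (a j) • ev (t j) := by
        simp only [map_add, map_smul, map_sum]
        abel
      obtain ⟨y, hy⟩ := hV S φ X
      rw [h1, map_sub, hy, valAt_smul, ← wact_V_pow φ, ← map_sub, wact_V_pow]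
      rcases Nat.lt_succ_iff_lt_or_eq.mp hi with h | h
      · exact coeff_vers_iterate_of_lt _ _ _ h
      · rw [coeff_vers_iterate_add k _ i 0 (by simp [h])]
        have h2 := hs S φ X.1 X.2
        have hki : (⟨k, hk⟩ : Fin n) = i := Fin.ext h.symm
        rw [dif_pos X.2, hki] at h2
        have h3 : y.coeff 0 = ∑ j, φ (s j) * (X.1 j).coeff 0 := by
          rw [← h2]
          refine Eq.trans ?_ (congrArg (TruncatedWittVector.coeff i) hy.symm)
          exact (coeff_vers_iterate_add k _ i 0 (by simp [h])).symm
        refine (map_sub (proj p n S) _ _).trans (sub_eq_zero.mpr (h3.trans ?_))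
        change _ = (valAt (G := sol δ) φ X (∑ j, DRing.ofW p n R (a j) • ev (t j))).coeff 0
        simp only [map_sum, valAt_smul, wact_ofW, hev.apply, coeff_zero_sum, coeff_zero_mul,
          coeff_wittMap]
        exact Finset.sum_congr rfl fun j _ => by rw [← ha j]; rfl
  obtain ⟨m, hm⟩ := key n le_rfl
  refine ⟨m, (sub_eq_zero.mp ?_).symm⟩
  refine Hom.ext_val fun S _ φ X => ?_
  ext i
  exact (hm S φ X i i.2).trans (TruncatedWittVector.coeff_zero p n S i).symm

/-- `N / V N` is free on the classes of the `t_j`: they generate by `genHom_surjective`, and a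
relation between them evaluates to a linear relation between zeroth components. -/
theorem IsEval.isCosmooth (hev : IsEval t ev) (hδ : IsVShape δ α)
    (hgen : Submodule.span (DRing p n R) (Set.range t) = ⊤)
    (ht : ∀ j, DRing.F p n R • t j = ∑ i, δ j i • t i) : IsCosmooth p n R N := by
  have hl : ∀ s : ι → R, ∀ a : ι → TruncatedWittVector p n R, (∀ j, (a j).coeff 0 = s j) →
      Fintype.linearCombination R (fun j => (QuotientAddGroup.mk (t j) : ModV p n R N)) s =
        QuotientAddGroup.mk (∑ j, DRing.ofW p n R (a j) • t j) := by
    intro s a ha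
    rw [Fintype.linearCombination_apply]
    refine Eq.trans ?_ (map_sum (QuotientAddGroup.mk' (rangeV p n R N)) _ _).symm
    exact Finset.sum_congr rfl fun j _ => by rw [← ha, coeff_zero_smul_modV]; rfl
  have hbij : Function.Bijective
      (Fintype.linearCombination R (fun j => (QuotientAddGroup.mk (t j) : ModV p n R N))) := by
    constructor
    · rw [injective_iff_map_eq_zero]
      intro s hs
      choose a ha using fun j => proj_surjective p n R (s j)
      rw [hl s a ha, QuotientAddGroup.eq_zero_iff] at hs
      obtain ⟨y, hy⟩ := hs
      refine eq_zero_of_sum_coeff_zero hδ fun S _ φ X hX => ?_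
      have h := hev.coeff_zero_genHom (a, -y) φ ⟨X, hX⟩
      have h0 : genHom t (a, -y) = 0 := by
        change ∑ j, DRing.ofW p n R (a j) • t j + DRing.V p n R • -y = 0
        rw [← hy, smul_neg]
        exact add_neg_cancel _
      rw [h0, map_zero, map_zero, TruncatedWittVector.coeff_zero] at h
      refine Eq.trans ?_ h.symm
      exact Finset.sum_congr rfl fun j _ => by rw [← ha j]; rfl
    · intro x
      obtain ⟨x, rfl⟩ := QuotientAddGroup.mk_surjective x
      obtain ⟨⟨a, y⟩, rfl⟩ := genHom_surjective hδ hgen ht x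
      refine ⟨fun j => (a j).coeff 0, ?_⟩
      rw [hl _ a fun _ => rfl, QuotientAddGroup.eq]
      refine ⟨y, ?_⟩
      change DRing.V p n R • y = -_ + (_ + DRing.V p n R • y)
      rw [neg_add_cancel_left]
  let e := LinearEquiv.ofBijective _ hbij
  refine ⟨Module.Finite.equiv e, Module.Projective.of_equiv e, fun i hi x => ⟨fun h => ?_, ?_⟩⟩
  · exact hev.exists_eq_V_pow_smul hδ hgen ht i x (by rw [h, map_zero]) (n - i) (by omega)
  · rintro ⟨y, rfl⟩
    rw [← mul_smul, ← pow_add, Nat.add_sub_cancel' hi, DRing.V_pow, zero_smul]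

end Generated

open GroupFunctor

/-! ### The module with generators `t_j` and relations `F t = δ t` -/

section SolMod

variable {p : ℕ} [Fact p.Prime] {n : ℕ} [NeZero n] {R : Type u} [CommRing R] [Algebra (ZMod p) R]
  {ι : Type} [Fintype ι] [DecidableEq ι] (δ : ι → ι → DRing p n R)

/-- The relations `F e_j = ∑ δ_ji e_i`. -/
noncomputable def solRel : Submodule (DRing p n R) (ι → DRing p n R) :=
  Submodule.span _ (Set.range fun j => Pi.single j (DRing.F p n R) - δ j)

/-- The `𝔇`-module generated by a solution of `F t = δ t`. -/
abbrev SolMod : Type u := (ι → DRing p n R) ⧸ solRel δ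

/-- The generators. -/
noncomputable def solModGen (j : ι) : SolMod δ := (solRel δ).mkQ (Pi.single j 1)

theorem mkQ_solRel (d : ι → DRing p n R) : (solRel δ).mkQ d = ∑ i, d i • solModGen δ i := by
  have h : d = ∑ i, d i • (Pi.single i 1 : ι → DRing p n R) := by
    funext k
    simp [Finset.sum_apply, Pi.single_apply]
  conv_lhs => rw [h]
  simp only [map_sum, map_smul, solModGen]

theorem F_smul_solModGen (j : ι) :
    DRing.F p n R • solModGen δ j = ∑ i, δ j i • solModGen δ i := by
  rw [← mkQ_solRel, solModGen, ← map_smul, ← sub_eq_zero, ← map_sub, ← LinearMap.mem_ker,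
    Submodule.ker_mkQ]
  refine Submodule.subset_span ⟨j, ?_⟩
  change Pi.single j _ - δ j = DRing.F p n R • Pi.single j 1 - δ j
  rw [← Pi.single_smul, smul_eq_mul, mul_one]

theorem span_solModGen : Submodule.span (DRing p n R) (Set.range (solModGen δ)) = ⊤ := by
  rw [eq_top_iff]
  rintro x -
  obtain ⟨d, rfl⟩ := (solRel δ).mkQ_surjective x
  rw [mkQ_solRel]
  exact Submodule.sum_mem _ fun i _ => Submodule.smul_mem _ _ (Submodule.subset_span ⟨i, rfl⟩)

variable {δ} {N : Type*} [AddCommGroup N] [Module (DRing p n R) N]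

/-- The homomorphism defined by a solution in `N`. -/
noncomputable def solModLift (X : ι → N) (hX : ∀ j, DRing.F p n R • X j = ∑ i, δ j i • X i) :
    SolMod δ →ₗ[DRing p n R] N :=
  (solRel δ).liftQ (Fintype.linearCombination (DRing p n R) X) (by
    refine Submodule.span_le.mpr ?_
    rintro _ ⟨j, rfl⟩
    rw [SetLike.mem_coe, LinearMap.mem_ker, map_sub, Fintype.linearCombination_apply_single, hX,
      Fintype.linearCombination_apply, sub_self])

theorem solModLift_gen (X : ι → N) (hX : ∀ j, DRing.F p n R • X j = ∑ i, δ j i • X i) (j : ι) :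
    solModLift X hX (solModGen δ j) = X j := by
  refine ((solRel δ).liftQ_apply _ _).trans ?_
  rw [Fintype.linearCombination_apply_single, one_smul]

/-- The coordinate functions on the group of solutions. -/
noncomputable def solCoord (δ : ι → ι → DRing p n R) (j : ι) : Hom (sol δ) (witt p n R) where
  app S _ φ := (Pi.evalAddMonoidHom (fun _ : ι => TruncatedWittVector p n S) j).comp
    (solPoints δ φ).subtype
  naturality _ _ _ := rfl

theorem F_smul_solCoord (j : ι) :
    DRing.F p n R • solCoord δ j = ∑ i, δ j i • solCoord δ i := by
  refine Hom.ext_val fun S _ φ X => ?_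
  change valAt φ X _ = valAt φ X _
  rw [map_sum]
  simp only [valAt_smul, wact_F]
  exact X.2 j

/-- The evaluation of elements of `SolMod δ` at solutions. -/
noncomputable def solEv (δ : ι → ι → DRing p n R) : SolMod δ →ₗ[DRing p n R] Hom (sol δ) (witt p n R) :=
  solModLift (solCoord δ) F_smul_solCoord

theorem isEval_solEv : IsEval (solModGen δ) (solEv δ) := fun j S _ φ X => by
  rw [solEv, solModLift_gen]; rfl

end SolMod

/-! ### Frames of a weak semidisplay -/

section JIdeal

variable {p : ℕ} [Fact p.Prime] {n : ℕ} [NeZero n] {R : Type u} [CommRing R] [Algebra (ZMod p) R]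

theorem ofW_vers_iterate (k : ℕ) (b : TruncatedWittVector p n R) :
    DRing.ofW p n R ((vers p n)^[k] b) =
      DRing.V p n R ^ k * DRing.ofW p n R b * DRing.F p n R ^ k := by
  induction k with
  | zero => simp
  | succ k ih =>
    rw [Function.iterate_succ_apply', ← DRing.V_mul_ofW_mul_F, ih, pow_succ', pow_succ]
    simp only [mul_assoc]

theorem mem_idealJ {a : TruncatedWittVector p n R} :
    a ∈ idealJ p n R ↔ ∀ i : Fin n, i.1 < n - 1 → a.coeff i = 0 := by
  rw [idealJ, RingHom.mem_ker, TruncatedWittVector.ext_iff]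
  constructor
  · intro h i hi
    have := h ⟨i, hi⟩
    rwa [TruncatedWittVector.coeff_truncate, TruncatedWittVector.coeff_zero] at this
  · intro h i
    rw [TruncatedWittVector.coeff_truncate, TruncatedWittVector.coeff_zero]
    exact h _ i.2

/-- Elements of `J` are of the form `V ^ (n - 1)(b)`, and `V ^ (n - 1)(b) = V ^ (n - 1) b F ^ (n -
1)` in `𝔇`, so one more `V` gives `V ^ n = 0`. -/
theorem V_mul_ofW_of_mem_idealJ {a : TruncatedWittVector p n R} (ha : a ∈ idealJ p n R) :
    DRing.V p n R * DRing.ofW p n R a = 0 := by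
  obtain ⟨b, rfl⟩ := exists_vers_iterate (n - 1) a (mem_idealJ.mp ha)
  rw [ofW_vers_iterate, ← mul_assoc, ← mul_assoc, ← pow_succ',
    Nat.sub_add_cancel (Nat.pos_of_ne_zero (NeZero.ne n)), DRing.V_pow, zero_mul, zero_mul]

theorem ofW_mul_V_of_mem_idealJ {a : TruncatedWittVector p n R} (ha : a ∈ idealJ p n R) :
    DRing.ofW p n R a * DRing.V p n R = 0 := by
  rw [DRing.ofW_mul_V]
  refine V_mul_ofW_of_mem_idealJ (mem_idealJ.mpr fun i hi => ?_)
  rw [frob, TruncatedWittVector.coeff_mk, mem_idealJ.mp ha i hi,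
    zero_pow (Fact.out : p.Prime).ne_zero]

end JIdeal

namespace WeakSemidisplay

variable {p : ℕ} [Fact p.Prime] {n : ℕ} [NeZero n] {R : Type u} [CommRing R] [Algebra (ZMod p) R]

/-- Generators `t_j` of `T` and `l_i` of `L` in a decomposition `M = T ⊕ L`, with coordinate
functions expressing that `T` and `L` are projective, and lifts of the elements `F₁ l_i`. -/
structure Frame (P : WeakSemidisplay p n R) where
  /-- the number of generators of `T` -/
  d : ℕ
  /-- the number of generators of `L` -/
  e : ℕ
  /-- the generators of `T` -/
  t : Fin d → P.M
  /-- the generators of `L` -/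
  l : Fin e → P.Q
  /-- lifts of the elements `F₁ l_i` -/
  z : Fin e → P.M
  mk_z : ∀ i, Submodule.Quotient.mk (z i) = P.F₁ (l i)
  /-- the coordinates on `T` -/
  τ : Fin d → P.M → TruncatedWittVector p n R
  /-- the coordinates on `L`, well defined modulo `J` -/
  θ : Fin e → P.M → TruncatedWittVector p n R
  τ_add : ∀ j x y, τ j (x + y) = τ j x + τ j y
  τ_smul : ∀ j a x, τ j (a • x) = a * τ j x
  θ_add : ∀ i x y, θ i (x + y) - (θ i x + θ i y) ∈ idealJ p n R
  θ_smul : ∀ i a x, θ i (a • x) - a * θ i x ∈ idealJ p n R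
  sum_eq : ∀ x, ∑ j, τ j x • t j + ∑ i, θ i x • (l i : P.M) = x
  τ_mem : ∀ j, ∀ y ∈ P.Q, τ j y ∈ idealI p n R
  smul_mem : ∀ a ∈ idealI p n R, ∀ j, a • t j ∈ P.Q

/-- Projectivity of `T` and `L` provides sections of surjections from free modules; their components
are the coordinates. -/
theorem nonempty_frame (P : WeakSemidisplay p n R) : Nonempty P.Frame := by
  obtain ⟨T, L, _, _, _, _, e, _, _, _, _, hsmul, hQ⟩ := P.exists_decomp
  obtain ⟨d, f, g, -, -, hfg⟩ := Module.Finite.exists_comp_eq_id_of_projective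
    (TruncatedWittVector p n R) T
  obtain ⟨d', f', g', -, -, hfg'⟩ := Module.Finite.exists_comp_eq_id_of_projective
    (TruncatedWittVector p (n - 1) R) L
  let tr := TruncatedWittVector.truncate (p := p) (R := R) (Nat.sub_le n 1)
  have htr : Function.Surjective tr := TruncatedWittVector.truncate_surjective _
  have hl : ∀ i, e.symm (0, f' (Pi.single i 1)) ∈ P.Q := fun i => by
    rw [hQ, AddEquiv.apply_symm_apply]; exact Submodule.zero_mem _
  choose z hz using fun i => Submodule.Quotient.mk_surjective _ (P.F₁ ⟨_, hl i⟩)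
  -- Coordinates on `L` lie in `W_{n-1}(R)`; the lifts to `W_n(R)` are arbitrary, hence linear only
  -- modulo `J`.
  choose θ hθ using fun (i : Fin d') (x : P.M) => htr (g' (e x).2 i)
  have hf : ∀ a : Fin d → TruncatedWittVector p n R, f a = ∑ j, a j • f (Pi.single j 1) := by
    intro a
    conv_lhs => rw [pi_eq_sum_univ' a, map_sum]
    simp only [map_smul]
  have hf' : ∀ a : Fin d' → TruncatedWittVector p (n - 1) R,
      f' a = ∑ j, a j • f' (Pi.single j 1) := by
    intro a
    conv_lhs => rw [pi_eq_sum_univ' a, map_sum]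
    simp only [map_smul]
  refine ⟨⟨d, d', fun j => e.symm (f (Pi.single j 1), 0), fun i => ⟨_, hl i⟩, z, hz,
    fun j x => g (e x).1 j, θ, ?_, ?_, ?_, ?_, ?_, ?_, ?_⟩⟩
  · intro j x y
    rw [map_add, Prod.fst_add, map_add, Pi.add_apply]
  · intro j a x
    rw [hsmul, map_smul, Pi.smul_apply, smul_eq_mul]
  · intro i x y
    rw [idealJ, RingHom.mem_ker, map_sub, map_add]
    change tr _ - (tr _ + tr _) = 0
    rw [hθ, hθ, hθ, map_add, Prod.snd_add, map_add, Pi.add_apply, sub_self]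
  · intro i a x
    rw [idealJ, RingHom.mem_ker, map_sub, map_mul]
    change tr _ - tr a * tr _ = 0
    rw [hθ, hθ, hsmul, map_smul, Pi.smul_apply, smul_eq_mul, sub_self]
  · intro x
    apply e.injective
    rw [map_add, map_sum, map_sum]
    simp only [hsmul, AddEquiv.apply_symm_apply, smul_zero]
    refine Prod.ext ?_ ?_
    · rw [Prod.fst_add, Prod.fst_sum, Prod.fst_sum]
      simp only [Finset.sum_const_zero, add_zero, ← hf]
      exact LinearMap.congr_fun hfg _
    · rw [Prod.snd_add, Prod.snd_sum, Prod.snd_sum]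
      simp only [Finset.sum_const_zero, zero_add]
      refine Eq.trans ?_ (LinearMap.congr_fun hfg' (e x).2)
      refine Eq.trans ?_ (hf' _).symm
      exact Finset.sum_congr rfl fun i _ => congrArg (· • _) (hθ i x)
  · intro j y hy
    have h := (hQ y).mp hy
    refine Submodule.smul_induction_on (p := fun x => g x j ∈ idealI p n R) h ?_ ?_
    · intro a ha x _
      rw [map_smul, Pi.smul_apply, smul_eq_mul]
      exact Ideal.mul_mem_right _ _ ha
    · intro x y hx hy
      rw [map_add, Pi.add_apply]
      exact add_mem hx hy
  · intro a ha j
    rw [hQ, hsmul, AddEquiv.apply_symm_apply]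
    exact Submodule.smul_mem_smul ha trivial

namespace Frame

variable {P : WeakSemidisplay p n R} (B : P.Frame)

/-- Successive approximations to the solution of `γ = V C + V D γ`. -/
noncomputable def approx : ℕ → Fin B.e → Fin B.d → DRing p n R
  | 0 => 0
  | m + 1 => fun i k => DRing.V p n R * (DRing.ofW p n R (B.τ k (B.z i)) +
      ∑ i', DRing.ofW p n R (B.θ i' (B.z i)) * approx m i' k)

theorem approx_succ (m : ℕ) (i : Fin B.e) (k : Fin B.d) : B.approx (m + 1) i k =
    DRing.V p n R * (DRing.ofW p n R (B.τ k (B.z i)) +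
      ∑ i', DRing.ofW p n R (B.θ i' (B.z i)) * B.approx m i' k) := rfl

/-- Each iteration puts one more factor `V` in front of the difference of successive approximations,
after moving coefficients past `V ^ m`. -/
theorem approx_succ_sub (m : ℕ) (i : Fin B.e) (k : Fin B.d) :
    ∃ d, B.approx (m + 1) i k - B.approx m i k = DRing.V p n R ^ m * d := by
  induction m generalizing i with
  | zero => exact ⟨_, by rw [pow_zero, one_mul]⟩
  | succ m ih =>
    choose d hd using ih
    refine ⟨∑ i', (DRing.sigma p n R)^[m] (DRing.ofW p n R (B.θ i' (B.z i))) * d i', ?_⟩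
    rw [B.approx_succ (m + 1), B.approx_succ m, ← mul_sub, add_sub_add_left_eq_sub, ← Finset.sum_sub_distrib]
    simp only [← mul_sub, hd, ← mul_assoc, DRing.mul_V_pow]
    simp only [pow_succ', mul_assoc, Finset.mul_sum]

/-- The solution of `γ = V C + V D γ`, expressing `l_i` by the `t_j` in `D(P)`. -/
noncomputable def γ : Fin B.e → Fin B.d → DRing p n R := B.approx n

theorem γ_eq (i : Fin B.e) (k : Fin B.d) :
    B.γ i k = DRing.V p n R * (DRing.ofW p n R (B.τ k (B.z i)) +
      ∑ i', DRing.ofW p n R (B.θ i' (B.z i)) * B.γ i' k) := by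
  obtain ⟨d, hd⟩ := B.approx_succ_sub n i k
  rw [DRing.V_pow, zero_mul, sub_eq_zero] at hd
  exact hd.symm

/-- The matrix of `F` on the generators `t_j` of `D(P)`. -/
noncomputable def δ (j k : Fin B.d) : DRing p n R :=
  DRing.ofW p n R (B.τ k (P.F (B.t j))) + ∑ i, DRing.ofW p n R (B.θ i (P.F (B.t j))) * B.γ i k

/-- Every entry of `γ` lies in `V 𝔇`, which is stable under left multiplication by `W_n(R)`. -/
theorem isVShape_δ : IsVShape B.δ fun j k => B.τ k (P.F (B.t j)) := by
  intro j k
  have h : ∀ i, ∃ d, DRing.ofW p n R (B.θ i (P.F (B.t j))) * B.γ i k = DRing.V p n R * d := fun i =>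
    ⟨_, by rw [γ_eq, ← mul_assoc, DRing.ofW_mul_V, mul_assoc]⟩
  choose d hd using h
  exact ⟨∑ i, d i, by rw [δ, Finset.mul_sum]; simp only [hd]⟩

variable {N : Type*} [AddCommGroup N] [Module (DRing p n R) N]

/-- The value at `x` of the map `M → N` defined by the images `X_j` of the `t_j`. -/
noncomputable def app (X : Fin B.d → N) (x : P.M) : N :=
  ∑ j, DRing.ofW p n R (B.τ j x) • X j +
    ∑ i, DRing.ofW p n R (B.θ i x) • ∑ k, B.γ i k • X k

theorem map_app {N' : Type*} [AddCommGroup N'] [Module (DRing p n R) N']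
    (g : N →ₗ[DRing p n R] N') (X : Fin B.d → N) (x : P.M) :
    g (B.app X x) = B.app (fun j => g (X j)) x := by
  simp only [app, map_add, map_sum, map_smul]

/-- The vector `γ X` takes the place of the values at the `l_i`: the fixed point equation is
precisely the condition `f(l_i) = V f(z_i)`. -/
theorem sum_γ_smul (X : Fin B.d → N) (i : Fin B.e) :
    ∑ k, B.γ i k • X k = DRing.V p n R • B.app X (B.z i) := by
  simp only [app, smul_add, Finset.smul_sum]
  conv_lhs =>
    enter [2, k]
    rw [γ_eq, mul_add, add_smul, Finset.mul_sum, Finset.sum_smul]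
  rw [Finset.sum_add_distrib, Finset.sum_comm]
  simp only [mul_smul]

/-- Since `γ X` lies in `V N` and `J V = 0`, the choice of the lifts `θ` does not matter; this makes
`app` linear. -/
theorem ofW_smul_sum_γ {a : TruncatedWittVector p n R} (ha : a ∈ idealJ p n R) (X : Fin B.d → N)
    (i : Fin B.e) : DRing.ofW p n R a • ∑ k, B.γ i k • X k = 0 := by
  rw [sum_γ_smul, ← mul_smul, ofW_mul_V_of_mem_idealJ ha, zero_smul]

theorem app_add (X : Fin B.d → N) (x y : P.M) : B.app X (x + y) = B.app X x + B.app X y := by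
  have h : ∀ i, DRing.ofW p n R (B.θ i (x + y)) • ∑ k, B.γ i k • X k =
      DRing.ofW p n R (B.θ i x) • ∑ k, B.γ i k • X k +
        DRing.ofW p n R (B.θ i y) • ∑ k, B.γ i k • X k := fun i => by
    rw [← add_smul, ← map_add, ← sub_eq_zero, ← sub_smul, ← map_sub]
    exact B.ofW_smul_sum_γ (B.θ_add i x y) X i
  simp only [app, h, B.τ_add, map_add, add_smul, Finset.sum_add_distrib]
  abel

theorem app_smul (X : Fin B.d → N) (a : TruncatedWittVector p n R) (x : P.M) :
    B.app X (a • x) = DRing.ofW p n R a • B.app X x := by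
  have h : ∀ i, DRing.ofW p n R (B.θ i (a • x)) • ∑ k, B.γ i k • X k =
      DRing.ofW p n R a • DRing.ofW p n R (B.θ i x) • ∑ k, B.γ i k • X k := fun i => by
    rw [← mul_smul, ← map_mul, ← sub_eq_zero, ← sub_smul, ← map_sub]
    exact B.ofW_smul_sum_γ (B.θ_smul i a x) X i
  simp only [app, h, B.τ_smul, map_mul, mul_smul, smul_add, Finset.smul_sum]

/-- The map `M → N` defined by the images of the `t_j`. -/
noncomputable def hom (X : Fin B.d → N) : P.M →+ N := AddMonoidHom.mk' (B.app X) (B.app_add X)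

theorem hom_apply (X : Fin B.d → N) (x : P.M) : B.hom X x = B.app X x := rfl

theorem hom_smul (X : Fin B.d → N) (a : TruncatedWittVector p n R) (x : P.M) :
    B.hom X (a • x) = DRing.ofW p n R a • B.hom X x := B.app_smul X a x

/-- The `t_j` may be dependent, so the map need not take the value `X j` at `t_j`; nevertheless its
value at `F t_j` is the right one, by the definition of `δ`. -/
theorem hom_F_t (X : Fin B.d → N) (hX : ∀ j, DRing.F p n R • X j = ∑ i, B.δ j i • X i)
    (j : Fin B.d) : B.hom X (P.F (B.t j)) = DRing.F p n R • X j := by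
  rw [hX, hom_apply, app]
  simp only [δ, add_smul, Finset.sum_add_distrib, Finset.sum_smul, Finset.smul_sum]
  congr 1
  rw [Finset.sum_comm]
  simp only [mul_smul]

theorem natCast_smul_eq (x : N) : (p : DRing p n R) • x = DRing.F p n R • DRing.V p n R • x := by
  rw [← mul_smul, DRing.F_mul_V]

theorem isDHom_hom (X : Fin B.d → N) (hX : ∀ j, DRing.F p n R • X j = ∑ i, B.δ j i • X i) :
    P.IsDHom (B.hom X) where
  smul := B.hom_smul X
  F x := by
    -- On `Q` one has `F = p F₁`, and `p = F V` in `𝔇`.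
    have hz : ∀ i, B.hom X (P.F (B.l i)) = DRing.F p n R • ∑ k, B.γ i k • X k := fun i => by
      rw [P.F_eq (B.l i) (B.z i) (B.mk_z i), sum_γ_smul, map_nsmul, ← natCast_smul_eq,
        Nat.cast_smul_eq_nsmul]
      rfl
    conv_lhs => rw [← B.sum_eq x]
    rw [map_add, map_add, map_sum, map_sum, map_sum, map_sum, hom_apply, app, smul_add,
      Finset.smul_sum, Finset.smul_sum]
    refine congrArg₂ _ (Finset.sum_congr rfl fun j _ => ?_) (Finset.sum_congr rfl fun i _ => ?_)
    · rw [map_smulₛₗ, hom_smul, B.hom_F_t X hX, F_smul_ofW_smul]; rfl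
    · rw [map_smulₛₗ, hom_smul, hz, F_smul_ofW_smul]; rfl
  V_F₁ y z h := by
    -- As `V J = 0`, it is enough to treat one lift of `F₁ y`; the next steps construct a convenient
    -- one.
    have hJ : ∀ m ∈ idealJ p n R • (⊤ : Submodule (TruncatedWittVector p n R) P.M),
        DRing.V p n R • B.hom X m = 0 := fun m hm => by
      refine Submodule.smul_induction_on hm ?_ ?_
      · intro a ha x _
        rw [hom_smul, ← mul_smul, V_mul_ofW_of_mem_idealJ ha, zero_smul]
      · intro x y hx hy
        rw [map_add, smul_add, hx, hy, add_zero]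
    choose b hb using fun j => exists_vers_of_proj_eq_zero p n R _ (B.τ_mem j y y.2)
    have hmem : ∀ j, vers p n (b j) • B.t j ∈ P.Q := fun j =>
      B.smul_mem _ (hb j ▸ B.τ_mem j y y.2) j
    -- Expand `y = ∑ V(b_j) t_j + ∑ θ_i(y) l_i` and apply the rule for `F₁ (V(a) x)` and
    -- semilinearity.
    have hz : Submodule.Quotient.mk (∑ j, b j • P.F (B.t j) +
        ∑ i, frob p n (B.θ i y) • B.z i) = P.F₁ y := by
      have hy : y = ∑ j, ⟨vers p n (b j) • B.t j, hmem j⟩ + ∑ i, B.θ i y • B.l i := by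
        refine Subtype.ext ?_
        rw [Submodule.coe_add, AddSubmonoidClass.coe_finsetSum, AddSubmonoidClass.coe_finsetSum]
        conv_lhs => rw [← B.sum_eq y]
        simp only [hb, Submodule.coe_smul]
      conv_rhs => rw [hy, map_add, map_sum, map_sum]
      simp only [P.F₁_vers, map_smulₛₗ, ← B.mk_z]
      rw [← Submodule.mkQ_apply, map_add, map_sum, map_sum]
      simp only [map_smul]
      rfl
    have hsub : DRing.V p n R • B.hom X z = DRing.V p n R • B.hom X (∑ j, b j • P.F (B.t j) +
        ∑ i, frob p n (B.θ i y) • B.z i) := by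
      rw [← sub_eq_zero, ← smul_sub, ← map_sub]
      exact hJ _ ((Submodule.Quotient.eq _).mp (h.trans hz.symm))
    rw [hsub, map_add, map_sum, map_sum, smul_add, Finset.smul_sum, Finset.smul_sum,
      B.hom_apply X (y : P.M), app]
    refine congrArg₂ _ (Finset.sum_congr rfl fun j _ => ?_) (Finset.sum_congr rfl fun i _ => ?_)
    · rw [hom_smul, B.hom_F_t X hX, V_smul_ofW_smul_F_smul, hb]
    · rw [hom_smul, ← ofW_smul_V_smul, sum_γ_smul]; rfl

variable {B}

/-- Both `f(l)` and `γ f(t)` satisfy the same fixed point equation; their difference is divisible by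
every power of `V`, hence zero as `V ^ n = 0`. -/
theorem sum_γ_smul_of_isDHom {f : P.M →+ N} (hf : P.IsDHom f) (i : Fin B.e) :
    f (B.l i) = ∑ k, B.γ i k • f (B.t k) := by
  have hfx : ∀ x, f x = ∑ j, DRing.ofW p n R (B.τ j x) • f (B.t j) +
      ∑ i, DRing.ofW p n R (B.θ i x) • f (B.l i) := fun x => by
    conv_lhs => rw [← B.sum_eq x]
    simp only [map_add, map_sum, hf.smul]
  have hstep : ∀ i, f (B.l i) - ∑ k, B.γ i k • f (B.t k) = DRing.V p n R •
      ∑ i', DRing.ofW p n R (B.θ i' (B.z i)) • (f (B.l i') - ∑ k, B.γ i' k • f (B.t k)) := fun i => by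
    rw [sum_γ_smul, ← hf.V_F₁ (B.l i) (B.z i) (B.mk_z i), ← smul_sub, hfx (B.z i), app,
      add_sub_add_left_eq_sub, ← Finset.sum_sub_distrib]
    simp only [smul_sub]
  have hpow : ∀ m : ℕ, ∀ i, ∃ w, f (B.l i) - ∑ k, B.γ i k • f (B.t k) = DRing.V p n R ^ m • w := by
    intro m
    induction m with
    | zero => exact fun i => ⟨_, by rw [pow_zero, one_smul]⟩
    | succ m ih =>
      intro i
      choose w hw using ih
      refine ⟨∑ i', (DRing.sigma p n R)^[m] (DRing.ofW p n R (B.θ i' (B.z i))) • w i', ?_⟩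
      rw [hstep]
      simp only [hw, ← mul_smul, DRing.mul_V_pow]
      simp only [pow_succ', mul_smul, Finset.smul_sum]
  obtain ⟨w, hw⟩ := hpow n i
  rwa [DRing.V_pow, zero_smul, sub_eq_zero] at hw

/-- The retraction property: a map is recovered from its values at the `t_j`. -/
theorem app_of_isDHom {f : P.M →+ N} (hf : P.IsDHom f) (x : P.M) :
    B.app (fun j => f (B.t j)) x = f x := by
  conv_rhs => rw [← B.sum_eq x]
  simp only [map_add, map_sum, hf.smul, app, sum_γ_smul_of_isDHom hf]

theorem F_smul_of_isDHom {f : P.M →+ N} (hf : P.IsDHom f) (j : Fin B.d) :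
    DRing.F p n R • f (B.t j) = ∑ i, B.δ j i • f (B.t i) := by
  rw [← hf.F, ← app_of_isDHom (B := B) hf, app]
  simp only [δ, add_smul, Finset.sum_add_distrib, Finset.sum_smul, Finset.smul_sum]
  congr 1
  rw [Finset.sum_comm]
  simp only [mul_smul]

end Frame

end WeakSemidisplay

/-! ### Functoriality of the Cartier dual -/

namespace GroupFunctor

section Functoriality

universe v₁ v₂ v₃

variable {R : Type u} [CommRing R] {G : GroupFunctor.{u, v₁} R} {H : GroupFunctor.{u, v₂} R}
  {K : GroupFunctor.{u, v₃} R}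

/-- Composition of homomorphisms. -/
def Hom.comp (β : Hom H K) (α : Hom G H) : Hom G K where
  app S _ φ := (β.app S φ).comp (α.app S φ)
  naturality f hf x := by
    refine (congrArg _ (α.naturality f hf x)).trans ?_
    exact β.naturality f hf _

/-- Base change of homomorphisms. -/
def Hom.baseChange (α : Hom G H) {S : Type u} [CommRing S] (φ : R →+* S) :
    Hom (G.baseChange φ) (H.baseChange φ) where
  app T _ ψ := α.app T (ψ.comp φ)
  naturality f hf x := α.naturality f (by rw [← hf, RingHom.comp_assoc]) x

/-- The dual of a homomorphism. -/
def Hom.dual (α : Hom G H) : Hom H.cartierDual G.cartierDual where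
  app S _ φ :=
    { toFun := fun β => Hom.comp (H := H.baseChange φ) β (α.baseChange φ)
      map_zero' := rfl
      map_add' := fun _ _ => rfl }
  naturality {S S'} _ _ {φ φ'} f hf β := by
    refine Hom.ext (funext fun T => funext fun _ => funext fun ψ => DFunLike.ext _ _ fun x => ?_)
    exact congrArg (Hom.app (G := H.baseChange φ) (H := Gm S) β T (ψ.comp f))
      (α.naturality (φ := ψ.comp φ') (φ' := (ψ.comp f).comp φ) (RingHom.id T)
        (by rw [RingHom.id_comp, RingHom.comp_assoc, hf]) x).symm

theorem Hom.biduality_naturality (α : Hom G H) {S : Type u} [CommRing S] (φ : R →+* S)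
    (x : G.obj S φ) :
    H.biduality.app S φ (α.app S φ x) = α.dual.dual.app S φ (G.biduality.app S φ x) := by
  refine Hom.ext (funext fun T => funext fun _ => funext fun ψ => DFunLike.ext _ _ fun β => ?_)
  exact congrArg (Hom.app (G := H.baseChange (ψ.comp φ)) (H := Gm T) β T (RingHom.id T))
    (α.naturality (φ' := ψ.comp φ) ψ rfl x).symm

/-- Biduality is natural and `β** α** = id`, so the biduality map of `G` is a retract of that of
`H`. -/
theorem biduality_bijective_of_retract (α : Hom G H) (β : Hom H G)
    (h : ∀ (S : Type u) [CommRing S] (φ : R →+* S) (x : G.obj S φ),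
      β.app S φ (α.app S φ x) = x)
    (hH : ∀ (S : Type u) [CommRing S] (φ : R →+* S), Function.Bijective (H.biduality.app S φ))
    (S : Type u) [CommRing S] (φ : R →+* S) : Function.Bijective (G.biduality.app S φ) := by
  have hcomp : β.comp α = ⟨fun S _ φ => AddMonoidHom.id _, fun _ _ _ => rfl⟩ :=
    Hom.ext (funext fun S => funext fun _ => funext fun φ => DFunLike.ext _ _ fun x => h S φ x)
  have hdd : ∀ y, β.dual.dual.app S φ (α.dual.dual.app S φ y) = y := fun y => by
    change (β.comp α).dual.dual.app S φ y = y
    rw [hcomp]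
    rfl
  constructor
  · intro x y hxy
    have hα : α.app S φ x = α.app S φ y := (hH S φ).1 (by
      rw [α.biduality_naturality, α.biduality_naturality, hxy])
    rw [← h S φ x, hα, h]
  · intro y
    obtain ⟨X, hX⟩ := (hH S φ).2 (α.dual.dual.app S φ y)
    exact ⟨β.app S φ X, by rw [β.biduality_naturality, hX, hdd]⟩

end Functoriality

/-! ### Pullback of homomorphisms to Witt vectors. -/

section Pullback

universe v₁ v₂

variable {p : ℕ} [Fact p.Prime] {n : ℕ} {R : Type u} [CommRing R] [Algebra (ZMod p) R]
  {G : GroupFunctor.{u, v₁} R} {H : GroupFunctor.{u, v₂} R}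

/-- The `𝔇`-linear map `Hom(H, W_n) → Hom(G, W_n)` defined by a homomorphism `G → H`. -/
noncomputable def Hom.pullback (α : Hom G H) :
    Hom H (witt p n R) →ₗ[DRing p n R] Hom G (witt p n R) where
  toFun f := f.comp α
  map_add' _ _ := rfl
  map_smul' d f := Hom.ext_val fun S _ φ x => by
    refine (Hom_smul_val d f φ (α.app S φ x)).trans ?_
    exact (Hom_smul_val d (f.comp α) φ x).symm

theorem Hom.pullback_bijective (α : Hom G H)
    (hα : ∀ (S : Type u) [CommRing S] (φ : R →+* S), Function.Bijective (α.app S φ)) :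
    Function.Bijective (α.pullback (p := p) (n := n)) := by
  constructor
  · intro f g hfg
    refine Hom.ext_val fun S _ φ y => ?_
    obtain ⟨x, rfl⟩ := (hα S φ).2 y
    exact congrArg (fun k => Hom.val k φ x) hfg
  · intro f
    let e : ∀ (S : Type u) [CommRing S] (φ : R →+* S), G.obj S φ ≃+ H.obj S φ := fun S _ φ =>
      AddEquiv.ofBijective (α.app S φ) (hα S φ)
    have he : ∀ (S : Type u) [CommRing S] (φ : R →+* S) (y : H.obj S φ),
        α.app S φ ((e S φ).symm y) = y := fun S _ φ y => (e S φ).apply_symm_apply y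
    have he' : ∀ (S : Type u) [CommRing S] (φ : R →+* S) (x : G.obj S φ),
        (e S φ).symm (α.app S φ x) = x := fun S _ φ x => (e S φ).symm_apply_apply x
    refine ⟨⟨fun S _ φ => (f.app S φ).comp (e S φ).symm.toAddMonoidHom, ?_⟩, ?_⟩
    · intro S S' _ _ φ φ' g hg y
      refine Eq.trans (congrArg (f.app S' φ') ?_) (f.naturality g hg ((e S φ).symm y))
      apply (hα S' φ').1
      change α.app S' φ' ((e S' φ').symm (H.map g hg y)) = _
      rw [he, α.naturality, he]
    · exact Hom.ext_val fun S _ φ x => congrArg (f.app S φ) (he' S φ x)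

end Pullback

end GroupFunctor

/-! ### Retracts of cosmooth modules -/

section Retract

variable {p : ℕ} [Fact p.Prime] {n : ℕ} [NeZero n] {R : Type u} [CommRing R] [Algebra (ZMod p) R]
  {N N' : Type*} [AddCommGroup N] [Module (DRing p n R) N] [AddCommGroup N']
  [Module (DRing p n R) N']

/-- The map `N / V N → N' / V N'` induced by a homomorphism `N → N'`. -/
noncomputable def modVMap (g : N →ₗ[DRing p n R] N') : ModV p n R N →ₗ[R] ModV p n R N' where
  toFun := QuotientAddGroup.map _ _ g.toAddMonoidHom (by
    rintro _ ⟨x, rfl⟩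
    exact ⟨g x, (map_smul g _ x).symm⟩)
  map_add' := map_add _
  map_smul' r x := by
    obtain ⟨x, rfl⟩ := QuotientAddGroup.mk_surjective x
    obtain ⟨a, rfl⟩ := proj_surjective p n R r
    refine (congrArg (QuotientAddGroup.map _ _ g.toAddMonoidHom _)
      (coeff_zero_smul_modV a x)).trans ?_
    refine Eq.trans ?_ (coeff_zero_smul_modV a (g x)).symm
    exact congrArg QuotientAddGroup.mk (map_smul g _ x)

/-- `N / V N` becomes a direct summand of `N' / V N'`, and a preimage under a power of `V` found in
`N'` is carried back by `b`. -/
theorem IsCosmooth.of_retract (a : N →ₗ[DRing p n R] N') (b : N' →ₗ[DRing p n R] N)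
    (h : ∀ x, b (a x) = x) (hN : IsCosmooth p n R N') : IsCosmooth p n R N := by
  obtain ⟨h1, h2, h3⟩ := hN
  have hba : ∀ x, modVMap b (modVMap a x) = x := fun x => by
    obtain ⟨x, rfl⟩ := QuotientAddGroup.mk_surjective x
    exact congrArg QuotientAddGroup.mk (h x)
  refine ⟨Module.Finite.of_surjective (modVMap b) fun x => ⟨_, hba x⟩,
    Module.Projective.of_split (modVMap a) (modVMap b) (LinearMap.ext hba), fun i hi x => ⟨?_, ?_⟩⟩
  · intro hx
    obtain ⟨y, hy⟩ := (h3 i hi (a x)).mp (by rw [← map_smul, hx, map_zero])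
    exact ⟨b y, by rw [← map_smul, ← hy, h]⟩
  · rintro ⟨y, rfl⟩
    rw [← mul_smul, ← pow_add, Nat.add_sub_cancel' hi, DRing.V_pow, zero_smul]

end Retract

/-! ### The Dieudonné module of a weak semidisplay -/

namespace WeakSemidisplay

open GroupFunctor

variable {p : ℕ} [Fact p.Prime] {n : ℕ} [NeZero n] {R : Type u} [CommRing R] [Algebra (ZMod p) R]
  (P : WeakSemidisplay p n R)

theorem DMod_hom_ext {N : Type*} [AddCommGroup N] [Module (DRing p n R) N]
    {g g' : P.DMod →ₗ[DRing p n R] N} (h : ∀ x, g (P.toDMod x) = g' (P.toDMod x)) : g = g' := by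
  refine Submodule.linearMap_qext _ (Finsupp.lhom_ext fun x d => ?_)
  have h1 : Finsupp.single x d = d • Finsupp.single x (1 : DRing p n R) := by simp
  rw [h1, map_smul, map_smul]
  exact congrArg (d • ·) (h x)

theorem toDMod_add (x y : P.M) : P.toDMod (x + y) = P.toDMod x + P.toDMod y := by
  rw [toDMod, toDMod, toDMod, ← map_add, ← sub_eq_zero, ← map_sub, ← LinearMap.mem_ker,
    Submodule.ker_mkQ]
  exact Submodule.subset_span (DModRel.add x y)

/-- The additive map `M → D(P)`. -/
noncomputable def toDModHom : P.M →+ P.DMod := AddMonoidHom.mk' P.toDMod P.toDMod_add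

theorem isDHom_toDModHom : P.IsDHom P.toDModHom :=
  (P.existsUnique_DMod_hom P.toDModHom).mpr
    ⟨LinearMap.id, fun _ => rfl, fun _ hg => P.DMod_hom_ext hg⟩

variable {P} in
/-- The homomorphism from `D(P)` given by its universal property. -/
noncomputable def IsDHom.lift {N : Type*} [AddCommGroup N] [Module (DRing p n R) N] {f : P.M →+ N}
    (hf : P.IsDHom f) : P.DMod →ₗ[DRing p n R] N :=
  ((P.existsUnique_DMod_hom f).mp hf).choose

variable {P} in
theorem IsDHom.lift_toDMod {N : Type*} [AddCommGroup N] [Module (DRing p n R) N] {f : P.M →+ N}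
    (hf : P.IsDHom f) (x : P.M) : hf.lift (P.toDMod x) = f x :=
  ((P.existsUnique_DMod_hom f).mp hf).choose_spec.1 x

/-- Evaluation at an element of `M`. -/
noncomputable def evalHom : P.M →+ Hom P.dual (witt p n R) where
  toFun x :=
    { app := fun _ _ φ =>
        { toFun := fun η : P.dualPoints φ => η.1 x
          map_zero' := rfl
          map_add' := fun _ _ => rfl }
      naturality := fun _ _ _ => rfl }
  map_zero' := Hom.ext_val fun _ _ φ η => map_zero (Subtype.val (p := (· ∈ P.dualPoints φ)) η)
  map_add' x y := Hom.ext_val fun _ _ φ η => map_add (Subtype.val (p := (· ∈ P.dualPoints φ)) η) x y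

theorem isDHom_evalHom : P.IsDHom P.evalHom where
  smul a x := Hom.ext_val fun S _ φ (η : P.dualPoints φ) => by
    refine Eq.trans ?_ (valAt_smul (G := P.dual) φ η _ _).symm
    rw [wact_ofW]
    exact map_smulₛₗ η.1 a x
  F x := Hom.ext_val fun S _ φ (η : P.dualPoints φ) => by
    refine Eq.trans ?_ (valAt_smul (G := P.dual) φ η _ _).symm
    rw [wact_F]
    exact η.2.1 x
  V_F₁ y z h := Hom.ext_val fun S _ φ (η : P.dualPoints φ) => by
    refine (valAt_smul (G := P.dual) φ η _ _).trans ?_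
    rw [wact_V]
    exact (η.2.2 y z h).symm

/-- The evaluation homomorphism `D(P) → Hom(Hom(P, 1), W_n)`. -/
noncomputable def ev : P.DMod →ₗ[DRing p n R] Hom P.dual (witt p n R) := P.isDHom_evalHom.lift

theorem ev_toDMod (x : P.M) : P.ev (P.toDMod x) = P.evalHom x := P.isDHom_evalHom.lift_toDMod x

/-! ### Points of `Hom(P, 1)` as maps into the `𝔇`-module `W_n(S)`. -/

section Points

variable {P} {S : Type u} [CommRing S] (φ : R →+* S)

/-- With `W_n(S)` regarded as a `𝔇`-module, the frame computations apply to `Hom(P, 1)` exactly as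
to `D(P)`. -/
theorem isDHom_iff_mem_dualPoints (η : P.M →ₛₗ[wittMap p n φ] TruncatedWittVector p n S) :
    letI : Module (DRing p n R) (TruncatedWittVector p n S) := Module.compHom _ (wact p n φ)
    η ∈ P.dualPoints φ ↔ P.IsDHom η.toAddMonoidHom := by
  letI : Module (DRing p n R) (TruncatedWittVector p n S) := Module.compHom _ (wact p n φ)
  constructor
  · intro h
    refine ⟨fun a x => ?_, fun x => ?_, fun y z hz => ?_⟩
    · exact (map_smulₛₗ η a x).trans (wact_ofW φ a (η x)).symm
    · exact (h.1 x).trans (wact_F φ (η x)).symm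
    · exact (wact_V φ (η z)).trans (h.2 y z hz).symm
  · intro h
    refine ⟨fun x => ?_, fun y z hz => ?_⟩
    · exact (h.F x).trans (wact_F φ (η x))
    · exact (h.V_F₁ y z hz).symm.trans (wact_V φ (η z))

variable (B : P.Frame)

/-- The semilinear map defined by the images of the `t_j`. -/
noncomputable def Frame.pointMap (X : Fin B.d → TruncatedWittVector p n S) :
    P.M →ₛₗ[wittMap p n φ] TruncatedWittVector p n S :=
  letI : Module (DRing p n R) (TruncatedWittVector p n S) := Module.compHom _ (wact p n φ)
  { toFun := B.app X
    map_add' := B.app_add X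
    map_smul' := fun a x => (B.app_smul X a x).trans (wact_ofW φ a _) }

theorem Frame.pointMap_mem {X : Fin B.d → TruncatedWittVector p n S} (hX : X ∈ solPoints B.δ φ) :
    B.pointMap φ X ∈ P.dualPoints φ := by
  letI : Module (DRing p n R) (TruncatedWittVector p n S) := Module.compHom _ (wact p n φ)
  rw [isDHom_iff_mem_dualPoints]
  exact B.isDHom_hom X fun j => (wact_F φ (X j)).trans (hX j)

theorem Frame.mem_solPoints (η : P.dualPoints φ) : (fun j => η.1 (B.t j)) ∈ solPoints B.δ φ := by
  letI : Module (DRing p n R) (TruncatedWittVector p n S) := Module.compHom _ (wact p n φ)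
  intro j
  have h := (isDHom_iff_mem_dualPoints φ η.1).mp η.2
  exact (wact_F φ _).symm.trans (Frame.F_smul_of_isDHom (B := B) h j)

theorem Frame.pointMap_apply (X : Fin B.d → TruncatedWittVector p n S) (x : P.M) :
    B.pointMap φ X x = ∑ j, wact p n φ (DRing.ofW p n R (B.τ j x)) (X j) +
      ∑ i, wact p n φ (DRing.ofW p n R (B.θ i x)) (∑ k, wact p n φ (B.γ i k) (X k)) := rfl

theorem Frame.pointMap_of_dualPoints (η : P.dualPoints φ) :
    B.pointMap φ (fun j => η.1 (B.t j)) = η.1 := by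
  letI : Module (DRing p n R) (TruncatedWittVector p n S) := Module.compHom _ (wact p n φ)
  exact LinearMap.ext fun x =>
    Frame.app_of_isDHom (B := B) ((isDHom_iff_mem_dualPoints φ η.1).mp η.2) x

end Points

/-! ### `D(P)` and `Hom(P, 1)` as retracts. -/

namespace Frame

variable {P} (B : P.Frame)

/-- The embedding of `Hom(P, 1)` into the group of solutions of `F X = δ X`. -/
noncomputable def toSol : Hom P.dual (sol B.δ) where
  app _ _ φ :=
    { toFun := fun η : P.dualPoints φ => ⟨fun j => η.1 (B.t j), B.mem_solPoints φ η⟩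
      map_zero' := rfl
      map_add' := fun _ _ => rfl }
  naturality _ _ _ := rfl

/-- The retraction of the group of solutions of `F X = δ X` to `Hom(P, 1)`. -/
noncomputable def ofSol : Hom (sol B.δ) P.dual where
  app _ _ φ :=
    { toFun := fun X => (⟨B.pointMap φ X.1, B.pointMap_mem φ X.2⟩ : P.dualPoints φ)
      map_zero' := Subtype.ext (LinearMap.ext fun x => by
        change B.pointMap φ 0 x = 0
        simp only [pointMap_apply, Pi.zero_apply, map_zero, Finset.sum_const_zero, add_zero])
      map_add' := fun X Y => Subtype.ext (LinearMap.ext fun x => by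
        change B.pointMap φ (X.1 + Y.1) x = B.pointMap φ X.1 x + B.pointMap φ Y.1 x
        simp only [pointMap_apply, Pi.add_apply, map_add, Finset.sum_add_distrib]
        abel) }
  naturality {_ _} _ _ {φ φ'} f hf X := Subtype.ext (LinearMap.ext fun x => by
    change B.pointMap φ' (fun i => wittMap p n f (X.1 i)) x = wittMap p n f (B.pointMap φ X.1 x)
    simp only [pointMap_apply, map_add, map_sum, wittMap_wact φ f hf])

theorem ofSol_toSol {S : Type u} [CommRing S] (φ : R →+* S) (η : P.dual.obj S φ) :
    B.ofSol.app S φ (B.toSol.app S φ η) = η := Subtype.ext (B.pointMap_of_dualPoints φ η)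

theorem biduality_bijective (B : P.Frame) (S : Type u) [CommRing S] (φ : R →+* S) :
    Function.Bijective (P.dual.biduality.app S φ) :=
  biduality_bijective_of_retract B.toSol B.ofSol (fun _ _ φ η => B.ofSol_toSol φ η)
    (fun _ _ φ => biduality_sol_bijective B.isVShape_δ φ) S φ

/-- The embedding of `D(P)` into the module generated by a solution of `F t = δ t`. -/
noncomputable def toSolMod : P.DMod →ₗ[DRing p n R] SolMod B.δ :=
  (B.isDHom_hom (solModGen B.δ) (F_smul_solModGen B.δ)).lift

theorem toSolMod_toDMod (x : P.M) : B.toSolMod (P.toDMod x) = B.app (solModGen B.δ) x :=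
  (B.isDHom_hom (solModGen B.δ) (F_smul_solModGen B.δ)).lift_toDMod x

/-- The retraction of the module generated by a solution of `F t = δ t` to `D(P)`. -/
noncomputable def ofSolMod : SolMod B.δ →ₗ[DRing p n R] P.DMod :=
  solModLift (fun j => P.toDMod (B.t j)) fun j => F_smul_of_isDHom (B := B) P.isDHom_toDModHom j

theorem ofSolMod_gen (j : Fin B.d) : B.ofSolMod (solModGen B.δ j) = P.toDMod (B.t j) :=
  solModLift_gen _ _ j

theorem ofSolMod_toSolMod (m : P.DMod) : B.ofSolMod (B.toSolMod m) = m := by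
  have h : B.ofSolMod.comp B.toSolMod = LinearMap.id := P.DMod_hom_ext fun x => by
    rw [LinearMap.comp_apply, toSolMod_toDMod, map_app]
    simp only [ofSolMod_gen]
    exact app_of_isDHom (B := B) P.isDHom_toDModHom x
  exact LinearMap.congr_fun h m

theorem isCosmooth (B : P.Frame) : IsCosmooth p n R P.DMod :=
  IsCosmooth.of_retract B.toSolMod B.ofSolMod B.ofSolMod_toSolMod
    (isEval_solEv.isCosmooth B.isVShape_δ (span_solModGen B.δ) (F_smul_solModGen B.δ))

/-- Together with `solEv_toSolMod`, this exhibits `ev` as a retract of the evaluation of `SolMod δ`,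
which transfers bijectivity. -/
theorem ev_ofSolMod (m : SolMod B.δ) :
    P.ev (B.ofSolMod m) = B.toSol.pullback (solEv B.δ m) := by
  have hm : m ∈ Submodule.span (DRing p n R) (Set.range (solModGen B.δ)) := by
    rw [span_solModGen]; trivial
  induction hm using Submodule.span_induction with
  | mem x hx =>
    obtain ⟨j, rfl⟩ := hx
    rw [ofSolMod_gen, ev_toDMod, solEv, solModLift_gen]
    rfl
  | zero => simp only [map_zero]
  | add x y _ _ hx hy => simp only [map_add, hx, hy]
  | smul d x _ hx => simp only [map_smul, hx]

theorem solEv_toSolMod (m : P.DMod) :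
    solEv B.δ (B.toSolMod m) = B.ofSol.pullback (P.ev m) := by
  have h : (solEv B.δ).comp B.toSolMod = B.ofSol.pullback.comp P.ev := P.DMod_hom_ext fun x => by
    rw [LinearMap.comp_apply, LinearMap.comp_apply, toSolMod_toDMod, map_app, ev_toDMod]
    refine Hom.ext_val fun S _ φ X => ?_
    have hX : valAt (G := sol B.δ) φ X (B.app (fun j => solEv B.δ (solModGen B.δ j)) x) =
        B.pointMap φ X.1 x := by
      simp only [app, map_add, map_sum, valAt_smul, isEval_solEv.apply, pointMap_apply]
    exact hX
  exact LinearMap.congr_fun h m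

theorem ev_bijective (B : P.Frame) : Function.Bijective P.ev := by
  have hinj := isEval_solEv.injective B.isVShape_δ (span_solModGen B.δ) (F_smul_solModGen B.δ)
  have hsurj := isEval_solEv.surjective B.isVShape_δ
  constructor
  · intro m m' h
    have h1 : B.toSolMod m = B.toSolMod m' := hinj (by rw [solEv_toSolMod, solEv_toSolMod, h])
    rw [← B.ofSolMod_toSolMod m, h1, ofSolMod_toSolMod]
  · intro g
    obtain ⟨m, hm⟩ := hsurj (B.ofSol.pullback g)
    refine ⟨B.ofSolMod m, ?_⟩
    rw [ev_ofSolMod, hm]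
    exact Hom.ext_val fun S _ φ η => congrArg (g.app S φ) (B.ofSol_toSol φ η)

end Frame

end WeakSemidisplay

end Semidisplay

theorem propositionp {p : ℕ} [Fact p.Prime] {n : ℕ} [NeZero n] {R : Type u} [CommRing R]
    [Algebra (ZMod p) R] (P : Semidisplay.WeakSemidisplay p n R) :
    Semidisplay.IsCosmooth p n R P.DMod ∧
    ∃ e : P.DMod ≃ₗ[Semidisplay.DRing p n R] Semidisplay.cartierModule p n P.zink,
      ∀ (x : P.M) (S : Type u) [CommRing S] (φ : R →+* S) (η : P.dualPoints φ),
        (e (P.toDMod x)).app S φ ((P.dual.biduality).app S φ η) = η.1 x := by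
  obtain ⟨B⟩ := P.nonempty_frame
  refine ⟨B.isCosmooth, ?_⟩
  let e₁ := LinearEquiv.ofBijective P.ev B.ev_bijective
  -- The dual of `zink` is the bidual of `Hom(P, 1)`, so pullback along biduality identifies
  -- homomorphisms out of it with those out of `Hom(P, 1)`.
  let e₂ := LinearEquiv.ofBijective (P.dual.biduality.pullback (p := p) (n := n))
    (P.dual.biduality.pullback_bijective B.biduality_bijective)
  refine ⟨e₁.trans e₂.symm, fun x S _ φ η => ?_⟩
  have h : P.dual.biduality.pullback (e₂.symm (e₁ (P.toDMod x))) = P.evalHom x := by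
    rw [← P.ev_toDMod]
    exact e₂.apply_symm_apply _
  exact congrArg (fun f => Semidisplay.GroupFunctor.Hom.val f φ η) h
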